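/- Let $G$ be a second countable locally compact Hausdorff groupoid with unit space $G^{(0)}$, source and range maps $s,r$, and left Haar system $\lambda=\{\lambda^u\}_{u\in G^{(0)}}$. Let $\mu$ be a Radon measure on $G^{(0)}$ that is quasi-invariant, i.e. $\nu=\int\lambda^u\,d\mu(u)$ and its image under inversion have the same null sets. A unitary representation of $G$ on $\mu$ is a Borel Hilbert bundle $\{\mathcal H(u)\}_{u\in G^{(0)}}$ with a Borel homomorphism $g\mapsto L_g$, where $L_g:\mathcal H(s(g))\to\mathcal H(r(g))$ is unitary. Two of them, $L$ and $L'$, both on $\mu$, are equivalent if there is an isomorphism of Borel Hilbert bundles, given by unitaries $U(u)$, $u\in G^{(0)}$, with $U(r(g))L_g=L'_gU(s(g))$ for all $g\in G$. Tensor products are taken fibrewise. Let $L$ be a unitary representation of $G$ on $\mu$. (1) Let $H$ be a closed subgroupoid of $G$ with the same unit space and with a Haar system, and let $m$ be a quasi-invariant measure on $G/H$ defined by $\mu$. This means that $m=\int m_u\,d\mu(u)$, where $u\mapsto m_u$ is a Borel family of Radon measures, $m_u$ is carried by $(G/H)_u=\{xH: r(x)=u\}$, the measures $g\,m_{s(g)}$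 and $m_{r(g)}$ are equivalent for all $g\in G$, and $m$ has the same null sets as the image of $\nu$ in $G/H$. Write $D(g^{-1},\cdot)$ for the Radon–Nikodym derivative of $g\,m_{s(g)}$ with respect to $m_{r(g)}$. Let $\operatorname{Ind}_H^G(L|_H)$ be the induced representation: its fibre at $u$ is the completion of the space of the Borel functions $\xi$ on $G$ with $\xi(x)\in\mathcal H(s(x))$, $\xi(xh)=L_{h^{-1}}\xi(x)$ for $h\in H$ and $\int_{(G/H)_u}\|\xi(x)\|^2\,dm_u(xH)<\infty$, and $(\operatorname{Ind}_H^G(L|_H))_g\,\xi(x)=D(g^{-1},xH)^{1/2}\,\xi(g^{-1}x)$. Let $\rho^{G/H}$ be the quasi-regular representation, with fibres $L^2((G/H)_u,m_u)$ and $\rho^{G/H}_g\xi(y)=D(g^{-1},y)^{1/2}\,\xi(g^{-1}y)$. Then $\operatorname{Ind}_H^G(L|_H)$ and $L\otimes\rho^{G/H}$ are unitary representations of $G$ on $\mu$, and they are equivalent. (2) In particular (the case $H=G^{(0)}$), let $\rho^G$ be the left regular representation, with fibres $L^2(G^u,\lambda^u)$, where $G^u=r^{-1}(u)$, and $\rho^G_g\xi(x)=\xi(g^{-1}x)$.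 Let $\dim L$ be the trivial representation of multiplicity $n(u)=\dim\mathcal H(u)$: its fibre at $u$ is the standard Hilbert space of dimension $n(u)$, namely $\mathbb C^{n(u)}$ or, when $n(u)=\infty$, $\ell^2(\mathbb N)$, and every $g$ acts as the identity (note that $n(s(g))=n(r(g))$). Then $L\otimes\rho^G$ and $(\dim L)\otimes\rho^G$ are unitary representations of $G$ on $\mu$, and they are equivalent. -/

import Mathlib

open CategoryTheory MeasureTheory ProbabilityTheory
open scoped ENNReal TensorProduct InnerProductSpace

universe u v w w'

noncomputable section

namespace LCG

/-! ### Locally compact groupoids -/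

section Groupoids

/-- The set of all arrows of a groupoid with unit space `X`. An arrow `g` has source `g.left` and
range `g.right`. The product `g h` of the literature is `h ≫ g` in Mathlib's notation. -/
abbrev Arr (X : Type u) [Groupoid.{v} X] : Type max u v := Quiver.Total X

variable {X : Type u} [Groupoid.{v} X]

/-- The unit at `u`, as an arrow. -/
def Arr.one (u : X) : Arr X := ⟨u, u, 𝟙 u⟩

/-- The inverse of an arrow. -/
def Arr.inv (g : Arr X) : Arr X := ⟨g.right, g.left, Groupoid.inv g.hom⟩

/-- The product `g h` of two arrows with `s(g) = r(h)`. -/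
def Arr.mul (g h : Arr X) (e : h.right = g.left) : Arr X :=
  ⟨h.left, g.right, h.hom ≫ eqToHom e ≫ g.hom⟩

open Classical in
/-- Left translation `x ↦ g x` by an arrow `g : u ⟶ v`. It is defined on the arrows with range `u`;
all other arrows are left alone. -/
def lmul {u v : X} (g : u ⟶ v) (x : Arr X) : Arr X :=
  if h : x.right = u then ⟨x.left, v, x.hom ≫ eqToHom h ≫ g⟩ else x

theorem lmul_of_eq {u v : X} (g : u ⟶ v) (x : Arr X) (h : x.right = u) :
    lmul g x = ⟨x.left, v, x.hom ≫ eqToHom h ≫ g⟩ := dif_pos h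

theorem lmul_of_ne {u v : X} (g : u ⟶ v) (x : Arr X) (h : ¬ x.right = u) :
    lmul g x = x := dif_neg h

theorem lmul_inv_lmul {u v : X} (g : u ⟶ v) (x : Arr X) (h : x.right = u) :
    lmul (Groupoid.inv g) (lmul g x) = x := by
  obtain ⟨a, b, x⟩ := x
  obtain rfl : b = u := h
  rw [lmul_of_eq g ⟨a, b, x⟩ rfl, lmul_of_eq (Groupoid.inv g) _ rfl]
  simp

variable (X) in
/-- A groupoid with a second countable locally compact Hausdorff topology on its arrows for which
the structure maps are continuous; as `Arr.one` is then an embedding, the unit space carries the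
relative topology. -/
class LocallyCompactGroupoid [TopologicalSpace X] [TopologicalSpace (Arr X)] : Prop extends
    T2Space (Arr X), LocallyCompactSpace (Arr X), SecondCountableTopology (Arr X) where
  continuous_source : Continuous fun g : Arr X => g.left
  continuous_range : Continuous fun g : Arr X => g.right
  continuous_one : Continuous (Arr.one : X → Arr X)
  continuous_inv : Continuous (Arr.inv : Arr X → Arr X)
  continuous_mul : Continuous fun p : {p : Arr X × Arr X // p.2.right = p.1.left} =>
    Arr.mul p.1.1 p.1.2 p.2

variable (X) in
/-- A left Haar system `u ↦ λ^u`. -/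
structure HaarSystem [TopologicalSpace X] [TopologicalSpace (Arr X)]
    [MeasurableSpace (Arr X)] where
  /-- The measure `λ^u`. -/
  meas : X → Measure (Arr X)
  finite_on_compacts : ∀ u, IsFiniteMeasureOnCompacts (meas u)
  /-- The support of `λ^u` is `G^u`, the set of arrows with range `u`. -/
  support_eq : ∀ u, (meas u).support = {g | g.right = u}
  continuous_integral : ∀ f : Arr X → ℝ, Continuous f → HasCompactSupport f →
    Continuous fun u => ∫ g, f g ∂(meas u)
  left_invariant : ∀ {u v : X} (g : u ⟶ v), (meas u).map (lmul g) = meas v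

/-- The measure `μ` on the unit space is quasi-invariant: `ν = ∫ λ^u dμ(u)` and its image `ν⁻¹`
under inversion have the same null sets. -/
def IsQuasiInvariant [TopologicalSpace X] [MeasurableSpace X] [TopologicalSpace (Arr X)]
    [MeasurableSpace (Arr X)] (haar : HaarSystem X) (μ : Measure X) : Prop :=
  μ.bind haar.meas ≪ (μ.bind haar.meas).map Arr.inv ∧
    (μ.bind haar.meas).map Arr.inv ≪ μ.bind haar.meas

end Groupoids

/-! ### Borel Hilbert bundles and unitary representations -/

section Representations

/-- A family of Hilbert spaces over `X` together with a set of sections that are called Borel. -/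
structure HilbertBundle (X : Type u) where
  /-- The fibre over a point. -/
  Fiber : X → Type w
  [normed : ∀ u, NormedAddCommGroup (Fiber u)]
  [innerProduct : ∀ u, InnerProductSpace ℂ (Fiber u)]
  [complete : ∀ u, CompleteSpace (Fiber u)]
  /-- The Borel sections. -/
  IsBorelSection : (∀ u, Fiber u) → Prop

attribute [instance] HilbertBundle.normed HilbertBundle.innerProduct HilbertBundle.complete

/-- A Borel Hilbert bundle: there is a fundamental sequence, that is a sequence of sections with
Borel inner products whose values span a dense subspace of every fibre and which determines the
Borel sections. -/
def HilbertBundle.IsBorel {X : Type u} [MeasurableSpace X] (E : HilbertBundle.{u, w} X) : Prop :=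
  ∃ f : ℕ → ∀ u, E.Fiber u,
    (∀ m n, Measurable fun u => ⟪f m u, f n u⟫_ℂ) ∧
    (∀ u, Dense (Submodule.span ℂ (Set.range fun n => f n u) : Set (E.Fiber u))) ∧
    ∀ ξ : ∀ u, E.Fiber u, E.IsBorelSection ξ ↔ ∀ n, Measurable fun u => ⟪f n u, ξ u⟫_ℂ

/-- The data of a representation: a bundle over the unit space and an operator
`L_g : H(s(g)) → H(r(g))` for every arrow `g`. -/
structure HilbertRep (X : Type u) [Groupoid.{v} X] extends HilbertBundle.{u, w} X where
  /-- The operator `L_g`. -/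
  op : ∀ {u v : X}, (u ⟶ v) → (Fiber u →ₗᵢ[ℂ] Fiber v)

variable {X : Type u} [Groupoid.{v} X]

/-- The bundle is a Borel Hilbert bundle and `g ↦ L_g` is a Borel homomorphism to the groupoid of
Hilbert space isomorphisms between its fibres. -/
structure HilbertRep.IsBorelHom [MeasurableSpace X] [MeasurableSpace (Arr X)]
    (L : HilbertRep.{u, v, w} X) : Prop where
  bundle : L.toHilbertBundle.IsBorel
  surjective : ∀ {u v : X} (g : u ⟶ v), Function.Surjective (L.op g)
  map_id : ∀ (u : X) (ξ : L.Fiber u), L.op (𝟙 u) ξ = ξ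
  map_comp : ∀ {u v w : X} (h : u ⟶ v) (g : v ⟶ w) (ξ : L.Fiber u),
    L.op (h ≫ g) ξ = L.op g (L.op h ξ)
  borel : ∀ ξ η : ∀ u, L.Fiber u, L.IsBorelSection ξ → L.IsBorelSection η →
    Measurable fun g : Arr X => ⟪η g.right, L.op g.hom (ξ g.left)⟫_ℂ

section

variable [TopologicalSpace X] [MeasurableSpace X] [TopologicalSpace (Arr X)]
  [MeasurableSpace (Arr X)]

/-- The triple made of the measure `μ`, the bundle of `L` and the operators of `L` is a unitary
representation. -/
def IsUnitaryRep (haar : HaarSystem X) (μ : Measure X) (L : HilbertRep.{u, v, w} X) : Prop :=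
  IsQuasiInvariant haar μ ∧ L.IsBorelHom

/-- Two unitary representations with the same quasi-invariant measure `μ` are equivalent: there is
a family of unitaries between the fibres that identifies the Borel sections (so that it is an
isomorphism of Borel Hilbert bundles) and intertwines the operators of all arrows. -/
structure Equivalent (haar : HaarSystem X) (μ : Measure X) (L : HilbertRep.{u, v, w} X)
    (L' : HilbertRep.{u, v, w'} X) : Prop where
  left : IsUnitaryRep haar μ L
  right : IsUnitaryRep haar μ L'
  exists_intertwiner : ∃ U : ∀ u, L.Fiber u ≃ₗᵢ[ℂ] L'.Fiber u,
    (∀ ξ : ∀ u, L.Fiber u, L.IsBorelSection ξ ↔ L'.IsBorelSection fun u => U u (ξ u)) ∧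
    ∀ {u v : X} (g : u ⟶ v) (ξ : L.Fiber u), U v (L.op g ξ) = L'.op g (U u ξ)

end

/-! ### Tensor products -/

open UniformSpace in
/-- The extension of a linear isometry to the completions. -/
def completionMap {E : Type*} {F : Type*} [SeminormedAddCommGroup E] [InnerProductSpace ℂ E]
    [SeminormedAddCommGroup F] [InnerProductSpace ℂ F] (f : E →ₗᵢ[ℂ] F) :
    Completion E →ₗᵢ[ℂ] Completion F where
  toLinearMap := f.toContinuousLinearMap.completion.toLinearMap
  norm_map' x := by
    have hc : Continuous f.toContinuousLinearMap.completion :=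
      f.toContinuousLinearMap.completion.continuous
    refine Completion.induction_on x (isClosed_eq hc.norm continuous_norm) fun a => ?_
    change ‖f.toContinuousLinearMap.completion (a : Completion E)‖ = _
    simp

/-- The fibrewise tensor product `L ⊗ L'`, with Hilbert space tensor products as fibres. Its Borel
structure is the one for which the sections `ξ ⊗ η`, with `ξ` and `η` Borel, are fundamental. -/
def HilbertRep.tensor [MeasurableSpace X] (L : HilbertRep.{u, v, w} X) (L' : HilbertRep.{u, v, w'} X) :
    HilbertRep.{u, v, max w w'} X where
  Fiber u := UniformSpace.Completion (L.Fiber u ⊗[ℂ] L'.Fiber u)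
  IsBorelSection Ξ := ∀ (ξ : ∀ u, L.Fiber u) (η : ∀ u, L'.Fiber u),
    L.IsBorelSection ξ → L'.IsBorelSection η → Measurable fun u =>
      ⟪((ξ u ⊗ₜ[ℂ] η u : L.Fiber u ⊗[ℂ] L'.Fiber u) :
        UniformSpace.Completion (L.Fiber u ⊗[ℂ] L'.Fiber u)), Ξ u⟫_ℂ
  op g := completionMap (TensorProduct.mapIsometry (L.op g) (L'.op g))

/-! ### The regular representation and the multiples of the trivial representation -/

/-- The bundle of the spaces `L²(Y, κ_u)` for a family of measures on `Y`. Its Borel structure is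
the one for which the Borel functions on `Y` that are square integrable for all `κ_u` are
fundamental. -/
def l2Bundle [MeasurableSpace X] {Y : Type w} [MeasurableSpace Y] (κ : X → Measure Y) :
    HilbertBundle.{u, w} X where
  Fiber u := Lp ℂ 2 (κ u)
  IsBorelSection Ξ := ∀ f : Y → ℂ, Measurable f → ∀ hf : ∀ u, MemLp f 2 (κ u),
    Measurable fun u => ⟪(hf u).toLp f, Ξ u⟫_ℂ

/-- The `n`-dimensional Hilbert space, `ℂⁿ` for finite `n` and `ℓ²(ℕ)` for `n = ∞`. -/
abbrev StdHilbert (n : ℕ∞) : Type := lp (fun _ : {k : ℕ // (k : ℕ∞) < n} => ℂ) 2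

/-- The identity of `StdHilbert n`, for two names of the same number. -/
def StdHilbert.cast {m n : ℕ∞} (h : m = n) : StdHilbert m →ₗᵢ[ℂ] StdHilbert n :=
  h ▸ LinearIsometry.id

/-- The dimension of a fibre. -/
def HilbertBundle.dim (E : HilbertBundle.{u, w} X) (u : X) : ℕ∞ :=
  Cardinal.toENat (Module.rank ℂ (E.Fiber u))

theorem HilbertRep.dim_eq [MeasurableSpace X] [MeasurableSpace (Arr X)]
    (L : HilbertRep.{u, v, w} X) (hL : L.IsBorelHom) {u v : X} (g : u ⟶ v) :
    L.dim u = L.dim v := by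
  unfold HilbertBundle.dim
  rw [(LinearEquiv.ofBijective (L.op g).toLinearMap
    ⟨(L.op g).injective, hL.surjective g⟩).rank_eq]

open Classical in
/-- The representation `dim L`: the trivial representation whose multiplicity at `u` is the
dimension `n(u)` of the fibre of `L`, which is constant on orbits. The fibre at `u` is the
`n(u)`-dimensional standard Hilbert space, the Borel sections are those with Borel coordinates, and
all arrows act as the identity. -/
def HilbertRep.dimRep [MeasurableSpace X] [MeasurableSpace (Arr X)]
    (L : HilbertRep.{u, v, w} X) (hL : L.IsBorelHom) : HilbertRep.{u, v, 0} X where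
  Fiber u := StdHilbert (L.dim u)
  IsBorelSection ξ := ∀ k : ℕ, Measurable fun u =>
    if h : (k : ℕ∞) < L.dim u then (ξ u : ∀ _ : {k : ℕ // (k : ℕ∞) < L.dim u}, ℂ) ⟨k, h⟩ else 0
  op g := StdHilbert.cast (L.dim_eq hL g)

section

variable [TopologicalSpace X] [TopologicalSpace (Arr X)] [MeasurableSpace (Arr X)]
  [BorelSpace (Arr X)] [LocallyCompactGroupoid X]

theorem measurableSet_range_eq (u : X) : MeasurableSet {x : Arr X | x.right = u} := by
  have h : {x : Arr X | x.right = u} = {x | Arr.one x.right = Arr.one u} := by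
    ext x
    refine ⟨fun hx => ?_, fun hx => congrArg Quiver.Total.left hx⟩
    change Arr.one x.right = Arr.one u
    rw [show x.right = u from hx]
  rw [h]
  exact (isClosed_eq (LocallyCompactGroupoid.continuous_one.comp
    LocallyCompactGroupoid.continuous_range) continuous_const).measurableSet

theorem measurable_lmul {u v : X} (g : u ⟶ v) : Measurable (lmul g : Arr X → Arr X) := by
  refine measurable_of_restrict_of_restrict_compl (measurableSet_range_eq u) ?_ ?_
  · have hφ : Continuous fun x : {x : Arr X | x.right = u} =>
        (⟨((⟨u, v, g⟩ : Arr X), x.1), x.2⟩ :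
          {p : Arr X × Arr X // p.2.right = p.1.left}) :=
      (continuous_const.prodMk continuous_subtype_val).subtype_mk _
    have hc := LocallyCompactGroupoid.continuous_mul.comp hφ
    convert hc.measurable using 1
    ext x : 1
    exact lmul_of_eq g x.1 x.2
  · convert measurable_subtype_coe (α := Arr X) using 1
    ext x : 1
    exact lmul_of_ne g x.1 x.2

theorem measurePreserving_lmul (haar : HaarSystem X) {u v : X} (g : u ⟶ v) :
    MeasurePreserving (lmul g) (haar.meas u) (haar.meas v) :=
  ⟨measurable_lmul g, haar.left_invariant g⟩

/-- The left regular representation `ρ^G`, with fibres `L²(G^u, λ^u)` and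
`(ρ_g ξ)(x) = ξ(g⁻¹ x)`. -/
def regularRep [MeasurableSpace X] (haar : HaarSystem X) : HilbertRep.{u, v, max u v} X where
  toHilbertBundle := l2Bundle haar.meas
  op g := Lp.compMeasurePreservingₗᵢ ℂ (lmul (Groupoid.inv g))
    (measurePreserving_lmul haar (Groupoid.inv g))

end

end Representations

/-! ### Closed subgroupoids and homogeneous spaces -/

section Subgroupoids

variable {X : Type u} [Groupoid.{v} X]

variable (X) in
/-- A closed subgroupoid with the same unit space. -/
structure ClosedSubgroupoid [TopologicalSpace (Arr X)] extends Subgroupoid X where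
  isWide : toSubgroupoid.IsWide
  isClosed : IsClosed {g : Arr X | g.hom ∈ arrows g.left g.right}

variable [TopologicalSpace (Arr X)] (H : ClosedSubgroupoid X)

namespace ClosedSubgroupoid

/-- The unit space of `H`, which is that of the ambient groupoid. -/
def Obj (_ : ClosedSubgroupoid X) : Type u := X

/-- A unit, as a unit of `H`. -/
def obj (u : X) : H.Obj := u

/-- A unit of `H`, as a unit of the ambient groupoid. -/
def val (u : H.Obj) : X := u

/-- The subgroupoid `H` as a groupoid. -/
instance : Groupoid.{v} H.Obj where
  Hom u v := H.arrows (H.val u) (H.val v)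
  id u := ⟨𝟙 (H.val u), H.isWide.id_mem _⟩
  comp f g := ⟨f.1 ≫ g.1, H.mul f.2 g.2⟩
  id_comp f := Subtype.ext (Category.id_comp f.1)
  comp_id f := Subtype.ext (Category.comp_id f.1)
  assoc f g h := Subtype.ext (Category.assoc f.1 g.1 h.1)
  inv f := ⟨Groupoid.inv f.1, H.inv f.2⟩
  inv_comp f := Subtype.ext (Groupoid.inv_comp f.1)
  comp_inv f := Subtype.ext (Groupoid.comp_inv f.1)

/-- An arrow that lies in `H`, as an arrow of `H`. -/
def hom {u v : X} (h : u ⟶ v) (hh : h ∈ H.arrows u v) : H.obj u ⟶ H.obj v := ⟨h, hh⟩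

/-- The inclusion of the arrows. -/
def incl (h : Arr H.Obj) : Arr X := ⟨H.val h.left, H.val h.right, h.hom.1⟩

instance [TopologicalSpace X] : TopologicalSpace H.Obj := inferInstanceAs (TopologicalSpace X)

instance [MeasurableSpace X] : MeasurableSpace H.Obj := inferInstanceAs (MeasurableSpace X)

instance : TopologicalSpace (Arr H.Obj) := TopologicalSpace.induced H.incl inferInstance

instance [MeasurableSpace (Arr X)] : MeasurableSpace (Arr H.Obj) :=
  MeasurableSpace.comap H.incl inferInstance

/-- Two arrows `x`, `y` lie in the same left coset: `y = x h` for some `h` in `H`. -/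
def Rel (x y : Arr X) : Prop :=
  ∃ (a : X) (h : a ⟶ x.left), h ∈ H.arrows a x.left ∧ y = ⟨a, x.right, h ≫ x.hom⟩

/-- The partition into left cosets. -/
def cosetSetoid : Setoid (Arr X) where
  r := H.Rel
  iseqv :=
    { refl := fun x => ⟨x.left, 𝟙 _, H.isWide.id_mem _, by simp⟩
      symm := by
        rintro x y ⟨a, h, hh, rfl⟩
        exact ⟨x.left, Groupoid.inv h, H.inv hh, by simp⟩
      trans := by
        rintro x y z ⟨a, h, hh, rfl⟩ ⟨b, k, hk, rfl⟩
        exact ⟨b, k ≫ h, H.mul hk hh, by simp⟩ }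

/-- The space `G/H` of left cosets, with the quotient topology and the quotient Borel structure
(which is the Borel structure of the quotient topology when `H` has a Haar system). -/
abbrev Quo : Type (max u v) := Quotient H.cosetSetoid

/-- The coset of an arrow. -/
def coset (x : Arr X) : H.Quo := Quotient.mk H.cosetSetoid x

/-- The anchor map `x H ↦ r(x)`. -/
def anchor : H.Quo → X :=
  Quotient.lift (fun x : Arr X => x.right) (by rintro x y ⟨a, h, hh, rfl⟩; rfl)

theorem rel_lmul {u v : X} (g : u ⟶ v) {x y : Arr X} (hxy : H.Rel x y) :
    H.Rel (lmul g x) (lmul g y) := by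
  obtain ⟨a, h, hh, rfl⟩ := hxy
  by_cases e : x.right = u
  · rw [lmul_of_eq g x e, lmul_of_eq g (⟨a, x.right, h ≫ x.hom⟩ : Arr X) e]
    exact ⟨a, h, hh, by simp⟩
  · rw [lmul_of_ne g x e, lmul_of_ne g (⟨a, x.right, h ≫ x.hom⟩ : Arr X) e]
    exact ⟨a, h, hh, rfl⟩

/-- The action `x H ↦ g x H` of an arrow `g : u ⟶ v` on the cosets `x H` with `r(x) = u`; all other
cosets are left alone. -/
def act {u v : X} (g : u ⟶ v) : H.Quo → H.Quo :=
  Quotient.map (lmul g) fun _ _ h => H.rel_lmul g h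

theorem act_inv_act {u v : X} (g : u ⟶ v) (y : H.Quo) (hy : H.anchor y = u) :
    H.act (Groupoid.inv g) (H.act g y) = y := by
  induction y using Quotient.inductionOn with
  | h x => exact congrArg (Quotient.mk H.cosetSetoid) (lmul_inv_lmul g x hy)

theorem measurable_coset [MeasurableSpace (Arr X)] : Measurable H.coset :=
  measurable_from_quotient.1 measurable_id

theorem measurable_act [TopologicalSpace X] [MeasurableSpace (Arr X)] [BorelSpace (Arr X)]
    [LocallyCompactGroupoid X] {u v : X} (g : u ⟶ v) : Measurable (H.act g) :=
  measurable_from_quotient.2 (H.measurable_coset.comp (measurable_lmul g))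

/-- A function that is constant on cosets may be evaluated at any representative. -/
theorem apply_out {β : Type*} {φ : Arr X → β} (h : ∀ x y, H.Rel x y → φ x = φ y) (x : Arr X) :
    φ (H.coset x).out = φ x :=
  h _ _ (Quotient.exact (Quotient.out_eq (H.coset x)))

theorem measurable_out [MeasurableSpace (Arr X)] {β : Type*} [MeasurableSpace β] {φ : Arr X → β}
    (h : ∀ x y, H.Rel x y → φ x = φ y) (hφ : Measurable φ) :
    Measurable fun y : H.Quo => φ y.out := by
  refine measurable_from_quotient.2 ?_
  convert hφ using 1
  ext x
  exact H.apply_out h x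

instance [TopologicalSpace X] [LocallyCompactGroupoid X] : SigmaCompactSpace H.Quo := by
  refine isSigmaCompact_univ_iff.1 ?_
  have h := (isSigmaCompact_univ (X := Arr X)).image (f := H.coset) continuous_quotient_mk'
  rwa [Set.image_univ, show Set.range H.coset = Set.univ from
    Set.range_eq_univ.2 Quotient.mk_surjective] at h

end ClosedSubgroupoid

/-- The restriction `L|_H` of a representation to a subgroupoid with the same unit space. -/
def HilbertRep.restrict (L : HilbertRep.{u, v, w} X) (H : ClosedSubgroupoid X) :
    HilbertRep.{u, v, w} H.Obj where
  Fiber u := L.Fiber (H.val u)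
  IsBorelSection ξ := L.IsBorelSection ξ
  op h := L.op h.1

theorem HilbertRep.IsBorelHom.restrict [MeasurableSpace X] [MeasurableSpace (Arr X)]
    {L : HilbertRep.{u, v, w} X} (hL : L.IsBorelHom) (H : ClosedSubgroupoid X) :
    (L.restrict H).IsBorelHom where
  bundle := hL.bundle
  surjective g := hL.surjective g.1
  map_id u ξ := hL.map_id (H.val u) ξ
  map_comp h g ξ := hL.map_comp h.1 g.1 ξ
  borel ξ η hξ hη := (hL.borel ξ η hξ hη).comp (comap_measurable H.incl)

/-! ### Quasi-invariant measures on homogeneous spaces -/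

/-- A quasi-invariant measure on `G/H` defined by the measure `μ` on the unit space, together with
its decomposition: the measure is `m = ∫ m_u dμ(u)`, where `u ↦ m_u` is a Borel family of Radon
measures with `m_u` carried by the fibre `(G/H)_u` of the anchor map, the measures `g m_{s(g)}` and
`m_{r(g)}` are equivalent for every arrow `g`, and `m` has the same null sets as the image of
`∫ λ^u dμ(u)` in `G/H`. -/
structure QuotientMeasure [TopologicalSpace X] [MeasurableSpace X] [MeasurableSpace (Arr X)]
    (H : ClosedSubgroupoid X) (haar : HaarSystem X) (μ : Measure X) where
  /-- The measure `m_u`. -/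
  fiber : Kernel X H.Quo
  finite_on_compacts : ∀ u, IsFiniteMeasureOnCompacts (fiber u)
  carried : ∀ u, ∀ᵐ y ∂(fiber u), H.anchor y = u
  translate_ac : ∀ {u v : X} (g : u ⟶ v), (fiber u).map (H.act g) ≪ fiber v
  ac_translate : ∀ {u v : X} (g : u ⟶ v), fiber v ≪ (fiber u).map (H.act g)
  total_ac : μ.bind fiber ≪ (μ.bind haar.meas).map H.coset
  ac_total : (μ.bind haar.meas).map H.coset ≪ μ.bind fiber

namespace QuotientMeasure

variable {H} [TopologicalSpace X] [MeasurableSpace X] [MeasurableSpace (Arr X)]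
  {haar : HaarSystem X} {μ : Measure X} (m : QuotientMeasure H haar μ)

/-- For `g : u ⟶ v`, the Radon-Nikodym derivative `y ↦ D(g⁻¹, y)` of `g m_u` with respect to
`m_v`. -/
def deriv {u v : X} (g : u ⟶ v) : H.Quo → ℝ≥0∞ :=
  ((m.fiber u).map (H.act g)).rnDeriv (m.fiber v)

theorem measurable_deriv {u v : X} (g : u ⟶ v) : Measurable (m.deriv g) :=
  Measure.measurable_rnDeriv _ _

theorem act_inv_act_ae {u v : X} (g : u ⟶ v) :
    ∀ᵐ y ∂(m.fiber u), H.act (Groupoid.inv g) (H.act g y) = y := by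
  filter_upwards [m.carried u] with y hy using H.act_inv_act g y hy

/-- The factor `D(g⁻¹, y)^(1/2)`. -/
def sqrtDeriv {u v : X} (g : u ⟶ v) (y : H.Quo) : ℝ := √(m.deriv g y).toReal

theorem measurable_sqrtDeriv {u v : X} (g : u ⟶ v) : Measurable (m.sqrtDeriv g) :=
  (m.measurable_deriv g).ennreal_toReal.sqrt

theorem enorm_sqrtDeriv_smul {u v : X} (g : u ⟶ v) {E : Type*} [NormedAddCommGroup E]
    [NormedSpace ℂ E] (y : H.Quo) (hy : m.deriv g y < ∞) (z : E) :
    ‖(m.sqrtDeriv g y : ℂ) • z‖ₑ ^ 2 = m.deriv g y * ‖z‖ₑ ^ 2 := by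
  rw [enorm_smul, mul_pow]
  congr 1
  rw [← ofReal_norm, Complex.norm_real, sqrtDeriv, Real.norm_of_nonneg (Real.sqrt_nonneg _),
    ← ENNReal.ofReal_pow (Real.sqrt_nonneg _), Real.sq_sqrt ENNReal.toReal_nonneg,
    ENNReal.ofReal_toReal hy.ne]

variable [LocallyCompactGroupoid X] [BorelSpace (Arr X)]

instance sigmaFinite_fiber (u : X) : SigmaFinite (m.fiber u) := by
  have hf := m.finite_on_compacts u
  exact ⟨⟨{ set := compactCovering H.Quo
            set_mem := fun _ => trivial
            finite := fun n => (isCompact_compactCovering H.Quo n).measure_lt_top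
            spanning := iUnion_compactCovering H.Quo }⟩⟩

instance sigmaFinite_map {u v : X} (g : u ⟶ v) :
    SigmaFinite ((m.fiber u).map (H.act g)) := by
  refine SigmaFinite.of_map _ (f := H.act (Groupoid.inv g)) (H.measurable_act _).aemeasurable ?_
  rw [Measure.map_map (H.measurable_act _) (H.measurable_act _),
    show (m.fiber u).map (H.act (Groupoid.inv g) ∘ H.act g) = m.fiber u from
      (Measure.map_congr (m.act_inv_act_ae g)).trans Measure.map_id]
  infer_instance

theorem deriv_lt_top {u v : X} (g : u ⟶ v) : ∀ᵐ y ∂(m.fiber v), m.deriv g y < ∞ :=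
  Measure.rnDeriv_lt_top _ _

/-- Change of variables. -/
theorem lintegral_deriv_mul {u v : X} (g : u ⟶ v) {φ : H.Quo → ℝ≥0∞} (hφ : Measurable φ) :
    ∫⁻ y, m.deriv g y * φ (H.act (Groupoid.inv g) y) ∂(m.fiber v) = ∫⁻ y, φ y ∂(m.fiber u) := by
  have hφ' := hφ.comp (H.measurable_act (Groupoid.inv g))
  refine (lintegral_rnDeriv_mul (m.translate_ac g) hφ'.aemeasurable).trans ?_
  rw [lintegral_map hφ' (H.measurable_act g)]
  refine lintegral_congr_ae ?_
  filter_upwards [m.act_inv_act_ae g] with y hy using congrArg φ hy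

/-- The function `y ↦ D(g⁻¹, y)^(1/2) ξ(g⁻¹ y)`. -/
def koopmanFun {u v : X} (g : u ⟶ v) (ξ : H.Quo → ℂ) (y : H.Quo) : ℂ :=
  (m.sqrtDeriv g y : ℂ) • ξ (H.act (Groupoid.inv g) y)

theorem measurable_koopmanFun {u v : X} (g : u ⟶ v) {ξ : H.Quo → ℂ} (hξ : Measurable ξ) :
    Measurable (m.koopmanFun g ξ) :=
  (Complex.measurable_ofReal.comp (m.measurable_sqrtDeriv g)).smul
    (hξ.comp (H.measurable_act _))

theorem lintegral_koopmanFun {u v : X} (g : u ⟶ v) {ξ : H.Quo → ℂ} (hξ : Measurable ξ) :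
    ∫⁻ y, ‖m.koopmanFun g ξ y‖ₑ ^ 2 ∂(m.fiber v) = ∫⁻ y, ‖ξ y‖ₑ ^ 2 ∂(m.fiber u) := by
  rw [← m.lintegral_deriv_mul g (hξ.enorm.pow_const 2)]
  refine lintegral_congr_ae ?_
  filter_upwards [m.deriv_lt_top g] with y hy using m.enorm_sqrtDeriv_smul g y hy _

theorem koopmanFun_congr {u v : X} (g : u ⟶ v) {ξ η : H.Quo → ℂ} (hξ : Measurable ξ)
    (hη : Measurable η) (h : ξ =ᵐ[m.fiber u] η) :
    m.koopmanFun g ξ =ᵐ[m.fiber v] m.koopmanFun g η := by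
  have h0 : ∫⁻ y, ‖m.koopmanFun g (ξ - η) y‖ₑ ^ 2 ∂(m.fiber v) = 0 := by
    rw [m.lintegral_koopmanFun g (hξ.sub hη), lintegral_eq_zero_iff
      ((hξ.sub hη).enorm.pow_const 2)]
    filter_upwards [h] with y hy
    simp [hy]
  rw [lintegral_eq_zero_iff ((m.measurable_koopmanFun g (hξ.sub hη)).enorm.pow_const 2)] at h0
  filter_upwards [h0] with y hy
  have hy' : m.koopmanFun g (ξ - η) y = 0 := by simpa using hy
  rw [koopmanFun, Pi.sub_apply, smul_sub, sub_eq_zero] at hy'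
  exact hy'

theorem eLpNorm_two_eq {Y : Type*} [MeasurableSpace Y] (τ : Measure Y) (f : Y → ℂ) :
    eLpNorm f 2 τ = (∫⁻ y, ‖f y‖ₑ ^ 2 ∂τ) ^ (1 / 2 : ℝ) := by
  rw [eLpNorm_eq_lintegral_rpow_enorm_toReal (by norm_num) (by norm_num)]
  simp

theorem memLp_koopmanFun {u v : X} (g : u ⟶ v) (ξ : Lp ℂ 2 (m.fiber u)) :
    MemLp (m.koopmanFun g ξ) 2 (m.fiber v) := by
  have hξ := (Lp.stronglyMeasurable ξ).measurable
  refine ⟨(m.measurable_koopmanFun g hξ).aestronglyMeasurable, ?_⟩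
  rw [eLpNorm_two_eq, m.lintegral_koopmanFun g hξ, ← eLpNorm_two_eq]
  exact (Lp.memLp ξ).2

/-- The operator `L²((G/H)_u, m_u) → L²((G/H)_v, m_v)`, `ξ ↦ D(g⁻¹, ·)^(1/2) ξ(g⁻¹ ·)`. -/
def koopmanOp {u v : X} (g : u ⟶ v) : Lp ℂ 2 (m.fiber u) →ₗᵢ[ℂ] Lp ℂ 2 (m.fiber v) where
  toFun ξ := (m.memLp_koopmanFun g ξ).toLp _
  map_add' ξ η := by
    rw [← MemLp.toLp_add, MemLp.toLp_eq_toLp_iff]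
    have hξ := (Lp.stronglyMeasurable ξ).measurable
    have hη := (Lp.stronglyMeasurable η).measurable
    refine (m.koopmanFun_congr g (Lp.stronglyMeasurable (ξ + η)).measurable (hξ.add hη)
      (Lp.coeFn_add ξ η)).trans (Filter.Eventually.of_forall fun y => ?_)
    simp [koopmanFun, mul_add]
  map_smul' c ξ := by
    rw [RingHom.id_apply, ← MemLp.toLp_const_smul, MemLp.toLp_eq_toLp_iff]
    have hξ := (Lp.stronglyMeasurable ξ).measurable
    refine (m.koopmanFun_congr g (Lp.stronglyMeasurable (c • ξ)).measurable (hξ.const_smul c)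
      (Lp.coeFn_smul c ξ)).trans (Filter.Eventually.of_forall fun y => ?_)
    simp only [koopmanFun, Pi.smul_apply, smul_eq_mul]
    ring
  norm_map' ξ := by
    have hξ := (Lp.stronglyMeasurable ξ).measurable
    change ‖(m.memLp_koopmanFun g ξ).toLp _‖ = _
    rw [Lp.norm_toLp, Lp.norm_def, eLpNorm_two_eq, m.lintegral_koopmanFun g hξ, ← eLpNorm_two_eq]

/-- The quasi-regular representation `ρ^{G/H}`, that is the Koopman representation for the action
on `G/H`, with fibres `L²((G/H)_u, m_u)` and `(ρ_g ξ)(y) = D(g⁻¹, y)^(1/2) ξ(g⁻¹ y)`. -/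
def quasiRegularRep : HilbertRep.{u, v, max u v} X where
  toHilbertBundle := l2Bundle fun u => m.fiber u
  op g := m.koopmanOp g

end QuotientMeasure

/-! ### Measurability of inner products -/

section MeasurableInner

variable {Y : Type*} [MeasurableSpace Y] {V : Y → Type*} [∀ y, NormedAddCommGroup (V y)]
  [∀ y, InnerProductSpace ℂ (V y)]

theorem measurable_norm_sq_of_fundamental {f : ℕ → ∀ y, V y}
    (hf : ∀ m n, Measurable fun y => ⟪f m y, f n y⟫_ℂ)
    (hd : ∀ y, Dense (Submodule.span ℂ (Set.range fun n => f n y) : Set (V y)))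
    {ξ : ∀ y, V y} (hξ : ∀ n, Measurable fun y => ⟪f n y, ξ y⟫_ℂ) :
    Measurable fun y => ‖ξ y‖ ^ 2 := by
  let q : ℕ → ℂ := TopologicalSpace.denseSeq ℂ
  let c : (Σ n : ℕ, Fin n → ℕ) → ∀ y, V y := fun k y => ∑ i, q (k.2 i) • f i y
  have hc : ∀ y, DenseRange fun k => c k y := by
    intro y
    have hsub : (Submodule.span ℂ (Set.range fun n => f n y) : Set (V y)) ⊆
        closure (Set.range fun k => c k y) := by
      intro z hz
      obtain ⟨n, a, rfl⟩ : ∃ (n : ℕ) (a : Fin n → ℂ), ∑ i, a i • f i y = z := by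
        obtain ⟨a, rfl⟩ := (Finsupp.mem_span_range_iff_exists_finsupp).1 hz
        refine ⟨a.support.sup id + 1, fun i => a i, ?_⟩
        rw [Fin.sum_univ_eq_sum_range (fun i => a i • f i y), Finsupp.sum]
        symm
        refine Finset.sum_subset (fun i hi => ?_) fun i _ hi => ?_
        · exact Finset.mem_range.2 (Nat.lt_succ_of_le (Finset.le_sup (f := id) hi))
        · rw [Finsupp.notMem_support_iff.1 hi, zero_smul]
      have hcont : Continuous fun a : Fin n → ℂ => ∑ i, a i • f i y := by fun_prop
      have hq : DenseRange fun k : Fin n → ℕ => fun i => q (k i) :=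
        DenseRange.piMap fun _ => TopologicalSpace.denseRange_denseSeq ℂ
      have ha := hq a
      refine closure_mono ?_ (image_closure_subset_closure_image hcont ⟨a, ha, rfl⟩)
      rintro _ ⟨_, ⟨k, rfl⟩, rfl⟩
      exact ⟨⟨n, k⟩, rfl⟩
    exact (dense_closure.1 ((hd y).mono hsub))
  refine Measurable.isLUB (f := fun k y => 2 * (⟪c k y, ξ y⟫_ℂ).re - (⟪c k y, c k y⟫_ℂ).re)
    (fun k => ?_) fun y => ⟨?_, fun b hb => ?_⟩
  · have h1 : Measurable fun y => ⟪c k y, ξ y⟫_ℂ := by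
      simp only [c, sum_inner, inner_smul_left]
      exact Finset.measurable_fun_sum _ fun i _ => (hξ i).const_mul _
    have h2 : Measurable fun y => ⟪c k y, c k y⟫_ℂ := by
      simp only [c, sum_inner, inner_sum, inner_smul_left, inner_smul_right]
      exact Finset.measurable_fun_sum _ fun i _ =>
        (Finset.measurable_fun_sum _ fun j _ => (hf _ _).const_mul _).const_mul _
    exact ((Complex.measurable_re.comp h1).const_mul 2).sub (Complex.measurable_re.comp h2)
  · rintro _ ⟨k, rfl⟩
    have h := norm_sub_sq (𝕜 := ℂ) (c k y) (ξ y)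
    have h' := inner_self_eq_norm_sq (𝕜 := ℂ) (c k y)
    simp only [RCLike.re_to_complex] at h h'
    nlinarith [sq_nonneg ‖c k y - ξ y‖]
  · have hcont : Continuous fun z : V y => 2 * (⟪z, ξ y⟫_ℂ).re - (⟪z, z⟫_ℂ).re :=
      (continuous_const.mul (Complex.continuous_re.comp (continuous_id.inner continuous_const))).sub
        (Complex.continuous_re.comp (continuous_id.inner continuous_id))
    have h : ∀ z : V y, 2 * (⟪z, ξ y⟫_ℂ).re - (⟪z, z⟫_ℂ).re ≤ b := fun z =>
      (hc y).induction_on z (isClosed_le hcont continuous_const) fun k => hb ⟨k, rfl⟩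
    have h' := inner_self_eq_norm_sq (𝕜 := ℂ) (ξ y)
    simp only [RCLike.re_to_complex] at h'
    linarith [h (ξ y)]

theorem measurable_inner_of_fundamental {f : ℕ → ∀ y, V y}
    (hf : ∀ m n, Measurable fun y => ⟪f m y, f n y⟫_ℂ)
    (hd : ∀ y, Dense (Submodule.span ℂ (Set.range fun n => f n y) : Set (V y)))
    {ξ η : ∀ y, V y} (hξ : ∀ n, Measurable fun y => ⟪f n y, ξ y⟫_ℂ)
    (hη : ∀ n, Measurable fun y => ⟪f n y, η y⟫_ℂ) :
    Measurable fun y => ⟪ξ y, η y⟫_ℂ := by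
  have key : ∀ a : ℂ, Measurable fun y => ((‖ξ y + a • η y‖ : ℂ) ^ 2) := by
    intro a
    have h := measurable_norm_sq_of_fundamental hf hd (ξ := fun y => ξ y + a • η y) fun n => by
      simp only [inner_add_right, inner_smul_right]
      exact (hξ n).add ((hη n).const_mul a)
    convert Complex.measurable_ofReal.comp h using 1
    ext y
    simp
  have h1 := key 1
  have h2 := key (-1)
  have h3 := key (-Complex.I)
  have h4 := key Complex.I
  simp only [one_smul, neg_smul, ← sub_eq_add_neg] at h1 h2 h3 h4
  simp_rw [inner_eq_sum_norm_sq_div_four (𝕜 := ℂ) (_ : V _)]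
  exact ((h1.sub h2).add ((h3.sub h4).mul_const _)).div_const _

end MeasurableInner

/-! ### Induced representations -/

section Induced

variable {H} [MeasurableSpace (Arr X)]

/-- A Borel function `ξ` on `G` with `ξ(x)` in the fibre of `M` over `s(x)` and with
`ξ(x h) = M_{h⁻¹} ξ(x)` for all `h` in `H`. -/
structure IsEquivariant (M : HilbertRep.{u, v, w} H.Obj)
    (ξ : ∀ x : Arr X, M.Fiber (H.obj x.left)) : Prop where
  borel : ∀ f : ∀ a : H.Obj, M.Fiber a, M.IsBorelSection f →
    Measurable fun x : Arr X => ⟪f (H.obj x.left), ξ x⟫_ℂ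
  equivariant : ∀ (x : Arr X) {a : X} (h : a ⟶ x.left) (hh : h ∈ H.arrows a x.left),
    ξ ⟨a, x.right, h ≫ x.hom⟩ = M.op (H.hom (Groupoid.inv h) (H.inv hh)) (ξ x)

variable {M : HilbertRep.{u, v, w} H.Obj}

theorem IsEquivariant.norm_eq {ξ : ∀ x : Arr X, M.Fiber (H.obj x.left)} (hξ : IsEquivariant M ξ)
    (x y : Arr X) (hxy : H.Rel x y) : ‖ξ x‖ = ‖ξ y‖ := by
  obtain ⟨a, h, hh, rfl⟩ := hxy
  rw [hξ.equivariant x h hh, LinearIsometry.norm_map]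

theorem IsEquivariant.inner_eq {ξ η : ∀ x : Arr X, M.Fiber (H.obj x.left)}
    (hξ : IsEquivariant M ξ) (hη : IsEquivariant M η)
    (x y : Arr X) (hxy : H.Rel x y) : ⟪ξ x, η x⟫_ℂ = ⟪ξ y, η y⟫_ℂ := by
  obtain ⟨a, h, hh, rfl⟩ := hxy
  rw [hξ.equivariant x h hh, hη.equivariant x h hh, LinearIsometry.inner_map_map]

theorem IsEquivariant.add {ξ η : ∀ x : Arr X, M.Fiber (H.obj x.left)} (hξ : IsEquivariant M ξ)
    (hη : IsEquivariant M η) : IsEquivariant M (ξ + η) where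
  borel f hf := by
    simp only [Pi.add_apply, inner_add_right]
    exact (hξ.borel f hf).add (hη.borel f hf)
  equivariant x a h hh := by
    simp only [Pi.add_apply, map_add, hξ.equivariant x h hh, hη.equivariant x h hh]

theorem IsEquivariant.smul (c : ℂ) {ξ : ∀ x : Arr X, M.Fiber (H.obj x.left)}
    (hξ : IsEquivariant M ξ) : IsEquivariant M (c • ξ) where
  borel f hf := by
    simp only [Pi.smul_apply, inner_smul_right]
    exact (hξ.borel f hf).const_mul c
  equivariant x a h hh := by
    simp only [Pi.smul_apply, map_smul, hξ.equivariant x h hh]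

theorem IsEquivariant.zero : IsEquivariant M 0 where
  borel f hf := by
    simp only [Pi.zero_apply, inner_zero_right]
    exact measurable_const
  equivariant x a h hh := by simp

variable [TopologicalSpace X] [MeasurableSpace X] [BorelSpace X] [BorelSpace (Arr X)]
  [LocallyCompactGroupoid X]

theorem measurable_source : Measurable fun x : Arr X => H.obj x.left :=
  (LocallyCompactGroupoid.continuous_source (X := X)).measurable

theorem IsEquivariant.measurable_inner (hM : M.IsBorelHom)
    {ξ η : ∀ x : Arr X, M.Fiber (H.obj x.left)} (hξ : IsEquivariant M ξ)
    (hη : IsEquivariant M η) : Measurable fun x => ⟪ξ x, η x⟫_ℂ := by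
  obtain ⟨f, hf, hd, hb⟩ := hM.bundle
  have hfb : ∀ n, M.IsBorelSection (f n) := fun n => (hb _).2 fun k => hf k n
  exact measurable_inner_of_fundamental (f := fun n (x : Arr X) => f n (H.obj x.left))
    (fun k n => (hf k n).comp measurable_source) (fun x => hd (H.obj x.left))
    (fun n => hξ.borel _ (hfb n)) fun n => hη.borel _ (hfb n)

theorem IsEquivariant.measurable_inner_out (hM : M.IsBorelHom)
    {ξ η : ∀ x : Arr X, M.Fiber (H.obj x.left)} (hξ : IsEquivariant M ξ)
    (hη : IsEquivariant M η) : Measurable fun y : H.Quo => ⟪ξ y.out, η y.out⟫_ℂ :=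
  H.measurable_out (hξ.inner_eq hη) (hξ.measurable_inner hM hη)

theorem IsEquivariant.measurable_norm_out (hM : M.IsBorelHom)
    {ξ : ∀ x : Arr X, M.Fiber (H.obj x.left)} (hξ : IsEquivariant M ξ) :
    Measurable fun y : H.Quo => ‖ξ y.out‖ := by
  have h := (Complex.measurable_re.comp (hξ.measurable_inner_out hM hξ)).sqrt
  convert h using 1
  ext y
  exact norm_eq_sqrt_re_inner (𝕜 := ℂ) _

theorem IsEquivariant.measurable_enorm_out (hM : M.IsBorelHom)
    {ξ : ∀ x : Arr X, M.Fiber (H.obj x.left)} (hξ : IsEquivariant M ξ) :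
    Measurable fun y : H.Quo => ‖ξ y.out‖ₑ := by
  simp_rw [← ofReal_norm]
  exact (hξ.measurable_norm_out hM).ennreal_ofReal

variable {haar : HaarSystem X} {μ : Measure X}

/-- The equivariant functions that are square integrable on `(G/H)_u`. The norm of an equivariant
function is constant on cosets, so that it is a function on `G/H`, which is evaluated at
representatives. -/
def indSubmodule (hM : M.IsBorelHom) (m : QuotientMeasure H haar μ) (u : X) :
    Submodule ℂ (∀ x : Arr X, M.Fiber (H.obj x.left)) where
  carrier := {ξ | IsEquivariant M ξ ∧ ∫⁻ y, ‖ξ y.out‖ₑ ^ 2 ∂(m.fiber u) < ∞}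
  zero_mem' := ⟨IsEquivariant.zero, by simp⟩
  add_mem' := by
    rintro ξ η ⟨hξ, hξ'⟩ ⟨hη, hη'⟩
    refine ⟨hξ.add hη, ?_⟩
    have hb : ∀ y : H.Quo, ‖(ξ + η) y.out‖ₑ ^ 2 ≤ 2 * (‖ξ y.out‖ₑ ^ 2 + ‖η y.out‖ₑ ^ 2) := by
      intro y
      have h1 : ‖(ξ + η) y.out‖ ^ 2 ≤ 2 * (‖ξ y.out‖ ^ 2 + ‖η y.out‖ ^ 2) := by
        have h2 : ‖(ξ + η) y.out‖ ≤ ‖ξ y.out‖ + ‖η y.out‖ := norm_add_le _ _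
        nlinarith [norm_nonneg ((ξ + η) y.out), sq_nonneg (‖ξ y.out‖ - ‖η y.out‖)]
      have h3 := ENNReal.ofReal_le_ofReal h1
      rwa [ENNReal.ofReal_pow (norm_nonneg _), ENNReal.ofReal_mul (by norm_num),
        ENNReal.ofReal_add (by positivity) (by positivity), ENNReal.ofReal_pow (norm_nonneg _),
        ENNReal.ofReal_pow (norm_nonneg _), ofReal_norm, ofReal_norm, ofReal_norm,
        ENNReal.ofReal_ofNat] at h3
    refine (lintegral_mono hb).trans_lt ?_
    rw [lintegral_const_mul' _ _ (by norm_num),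
      lintegral_add_left ((hξ.measurable_enorm_out hM).pow_const 2)]
    exact ENNReal.mul_lt_top (by norm_num) (ENNReal.add_lt_top.2 ⟨hξ', hη'⟩)
  smul_mem' := by
    rintro c ξ ⟨hξ, hξ'⟩
    refine ⟨hξ.smul c, ?_⟩
    simp only [Pi.smul_apply, enorm_smul, mul_pow]
    rw [lintegral_const_mul' _ _ (by simp)]
    exact ENNReal.mul_lt_top (by simp) hξ'

/-- The pre-Hilbert space of the equivariant functions that are square integrable on `(G/H)_u`. -/
def IndPre (hM : M.IsBorelHom) (m : QuotientMeasure H haar μ) (u : X) : Type (max u v w) :=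
  indSubmodule hM m u

namespace IndPre

variable {hM : M.IsBorelHom} {m : QuotientMeasure H haar μ} {u : X}

instance : AddCommGroup (IndPre hM m u) := inferInstanceAs (AddCommGroup (indSubmodule hM m u))

instance : Module ℂ (IndPre hM m u) := inferInstanceAs (Module ℂ (indSubmodule hM m u))

/-- The function on `G`. -/
def toFun (ξ : IndPre hM m u) : ∀ x : Arr X, M.Fiber (H.obj x.left) := ξ.1

theorem isEquivariant (ξ : IndPre hM m u) : IsEquivariant M ξ.toFun := ξ.2.1

theorem memLp_norm (ξ : IndPre hM m u) :
    MemLp (fun y : H.Quo => ‖ξ.toFun y.out‖) 2 (m.fiber u) := by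
  refine ⟨(ξ.isEquivariant.measurable_norm_out hM).aestronglyMeasurable, ?_⟩
  rw [eLpNorm_eq_lintegral_rpow_enorm_toReal (by norm_num) (by norm_num)]
  refine ENNReal.rpow_lt_top_of_nonneg (by positivity) ?_
  simp only [ENNReal.toReal_ofNat, ENNReal.rpow_ofNat, enorm_norm]
  exact ξ.2.2.ne

theorem integrable_inner (ξ η : IndPre hM m u) :
    Integrable (fun y : H.Quo => ⟪ξ.toFun y.out, η.toFun y.out⟫_ℂ) (m.fiber u) := by
  refine (ξ.memLp_norm.integrable_mul η.memLp_norm).mono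
    (ξ.isEquivariant.measurable_inner_out hM η.isEquivariant).aestronglyMeasurable
    (Filter.Eventually.of_forall fun y => ?_)
  simpa using norm_inner_le_norm (𝕜 := ℂ) (ξ.toFun y.out) (η.toFun y.out)

/-- The inner product `∫ ⟪ξ(x), η(x)⟫ dm_u(x H)`. -/
abbrev core (hM : M.IsBorelHom) (m : QuotientMeasure H haar μ) (u : X) :
    PreInnerProductSpace.Core ℂ (IndPre hM m u) where
  inner ξ η := ∫ y, ⟪ξ.toFun y.out, η.toFun y.out⟫_ℂ ∂(m.fiber u)
  conj_inner_symm ξ η := by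
    change (starRingEnd ℂ) (∫ y, _ ∂(m.fiber u)) = ∫ y, _ ∂(m.fiber u)
    rw [← integral_conj]
    simp only [inner_conj_symm]
  re_inner_nonneg ξ := by
    change 0 ≤ RCLike.re (∫ y, ⟪ξ.toFun y.out, ξ.toFun y.out⟫_ℂ ∂(m.fiber u))
    rw [← integral_re (ξ.integrable_inner ξ)]
    exact integral_nonneg fun y => inner_self_nonneg
  add_left ξ ξ' η := by
    change ∫ y, _ ∂(m.fiber u) = ∫ y, _ ∂(m.fiber u) + ∫ y, _ ∂(m.fiber u)
    rw [← integral_add (ξ.integrable_inner η) (ξ'.integrable_inner η)]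
    refine integral_congr_ae (Filter.Eventually.of_forall fun y => ?_)
    exact inner_add_left _ _ _
  smul_left ξ η c := by
    change ∫ y, _ ∂(m.fiber u) = _ * ∫ y, _ ∂(m.fiber u)
    rw [← integral_const_mul]
    refine integral_congr_ae (Filter.Eventually.of_forall fun y => ?_)
    exact inner_smul_left _ _ _

instance : SeminormedAddCommGroup (IndPre hM m u) :=
  @InnerProductSpace.Core.toSeminormedAddCommGroup ℂ _ _ _ _ (core hM m u)

instance : InnerProductSpace ℂ (IndPre hM m u) := InnerProductSpace.ofCore (core hM m u)

theorem inner_def (ξ η : IndPre hM m u) :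
    ⟪ξ, η⟫_ℂ = ∫ y, ⟪ξ.toFun y.out, η.toFun y.out⟫_ℂ ∂(m.fiber u) := rfl

theorem norm_sq_eq (ξ : IndPre hM m u) :
    ‖ξ‖ ^ 2 = (∫⁻ y, ‖ξ.toFun y.out‖ₑ ^ 2 ∂(m.fiber u)).toReal := by
  rw [← inner_self_eq_norm_sq (𝕜 := ℂ), inner_def, ← integral_re (ξ.integrable_inner ξ)]
  simp_rw [inner_self_eq_norm_sq]
  rw [integral_eq_lintegral_of_nonneg_ae (Filter.Eventually.of_forall fun y => sq_nonneg _)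
    ((ξ.isEquivariant.measurable_norm_out hM).pow_const 2).aestronglyMeasurable]
  simp_rw [ENNReal.ofReal_pow (norm_nonneg _), ofReal_norm]

end IndPre

open Classical in
/-- The function `x ↦ D(g⁻¹, x H)^(1/2) ξ(g⁻¹ x)` on the arrows with range `v`, for `g : u ⟶ v`; it
is extended by zero. -/
def indFun (m : QuotientMeasure H haar μ) {u v : X} (g : u ⟶ v)
    (ξ : ∀ x : Arr X, M.Fiber (H.obj x.left)) (x : Arr X) : M.Fiber (H.obj x.left) :=
  if h : x.right = v then
    (m.sqrtDeriv g (H.coset x) : ℂ) • ξ ⟨x.left, u, x.hom ≫ eqToHom h ≫ Groupoid.inv g⟩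
  else 0

theorem isEquivariant_indFun (m : QuotientMeasure H haar μ) {u v : X} (g : u ⟶ v)
    {ξ : ∀ x : Arr X, M.Fiber (H.obj x.left)} (hξ : IsEquivariant M ξ) :
    IsEquivariant M (indFun m g ξ) where
  borel f hf := by
    have h1 : Measurable fun x : Arr X => (m.sqrtDeriv g (H.coset x) : ℂ) *
        ⟪f (H.obj (lmul (Groupoid.inv g) x).left), ξ (lmul (Groupoid.inv g) x)⟫_ℂ :=
      (Complex.measurable_ofReal.comp ((m.measurable_sqrtDeriv g).comp H.measurable_coset)).mul
        ((hξ.borel f hf).comp (measurable_lmul _))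
    convert h1.indicator (measurableSet_range_eq v) using 1
    ext x
    by_cases h : x.right = v
    · rw [Set.indicator_of_mem (show x ∈ {x : Arr X | x.right = v} from h), indFun, dif_pos h,
        inner_smul_right, lmul_of_eq _ _ h]
    · rw [Set.indicator_of_notMem (show x ∉ {x : Arr X | x.right = v} from h), indFun, dif_neg h,
        inner_zero_right]
  equivariant x a h hh := by
    by_cases e : x.right = v
    · have hc : H.coset ⟨a, x.right, h ≫ x.hom⟩ = H.coset x :=
        (Quotient.sound (s := H.cosetSetoid) ⟨a, h, hh, rfl⟩).symm
      rw [indFun, indFun, dif_pos e, dif_pos (show (⟨a, x.right, h ≫ x.hom⟩ : Arr X).right = v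
        from e), map_smul, hc]
      congr 1
      rw [← hξ.equivariant ⟨x.left, u, x.hom ≫ eqToHom e ≫ Groupoid.inv g⟩ h hh]
      have hk : ∀ k k' : a ⟶ u, k = k' → ξ ⟨a, u, k⟩ = ξ ⟨a, u, k'⟩ := by
        rintro k _ rfl
        rfl
      exact hk _ _ (Category.assoc _ _ _)
    · rw [indFun, indFun, dif_neg e, dif_neg (show ¬ (⟨a, x.right, h ≫ x.hom⟩ : Arr X).right = v
        from e), map_zero]

theorem lintegral_indFun (hM : M.IsBorelHom) (m : QuotientMeasure H haar μ) {u v : X} (g : u ⟶ v)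
    {ξ : ∀ x : Arr X, M.Fiber (H.obj x.left)} (hξ : IsEquivariant M ξ) :
    ∫⁻ y, ‖indFun m g ξ y.out‖ₑ ^ 2 ∂(m.fiber v) = ∫⁻ y, ‖ξ y.out‖ₑ ^ 2 ∂(m.fiber u) := by
  rw [← m.lintegral_deriv_mul g ((hξ.measurable_enorm_out hM).pow_const 2)]
  refine lintegral_congr_ae ?_
  filter_upwards [m.deriv_lt_top g, m.carried v] with y hy hv
  have hxy : H.coset y.out = y := Quotient.out_eq y
  have hx : (Quotient.out y).right = v := by rw [← hv]; exact congrArg H.anchor hxy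
  have hact : H.act (Groupoid.inv g) y = H.coset (lmul (Groupoid.inv g) y.out) := by
    conv_lhs => rw [← hxy]
    rfl
  have hn : ‖ξ (H.act (Groupoid.inv g) y).out‖ = ‖ξ (lmul (Groupoid.inv g) y.out)‖ := by
    rw [hact]
    exact H.apply_out (φ := fun x => ‖ξ x‖) (fun a b hab => hξ.norm_eq a b hab) _
  rw [indFun, dif_pos hx, hxy, m.enorm_sqrtDeriv_smul g y hy, ← ofReal_norm, ← ofReal_norm, hn,
    lmul_of_eq _ _ hx]

/-- The operator `ξ ↦ D(g⁻¹, ·)^(1/2) ξ(g⁻¹ ·)` on equivariant functions. -/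
def indOp (hM : M.IsBorelHom) (m : QuotientMeasure H haar μ) {u v : X} (g : u ⟶ v) :
    IndPre hM m u →ₗᵢ[ℂ] IndPre hM m v where
  toFun ξ := ⟨indFun m g ξ.toFun, isEquivariant_indFun m g ξ.isEquivariant, by
    rw [lintegral_indFun hM m g ξ.isEquivariant]; exact ξ.2.2⟩
  map_add' ξ η := by
    refine Subtype.ext (funext fun x => ?_)
    change indFun m g (ξ.toFun + η.toFun) x = indFun m g ξ.toFun x + indFun m g η.toFun x
    unfold indFun
    split_ifs <;> simp
  map_smul' c ξ := by
    refine Subtype.ext (funext fun x => ?_)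
    change indFun m g (c • ξ.toFun) x = c • indFun m g ξ.toFun x
    unfold indFun
    split_ifs
    · rw [Pi.smul_apply, smul_comm]
    · rw [smul_zero]
  norm_map' ξ := by
    refine (sq_eq_sq₀ (norm_nonneg _) (norm_nonneg _)).1 ?_
    rw [IndPre.norm_sq_eq, IndPre.norm_sq_eq]
    exact congrArg ENNReal.toReal (lintegral_indFun hM m g ξ.isEquivariant)

/-- An equivariant function that is square integrable on `(G/H)_u`, as an element of the completion
of the space of these functions. -/
def IndPre.toCompletion {hM : M.IsBorelHom} {m : QuotientMeasure H haar μ} {u : X}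
    (ξ : ∀ x : Arr X, M.Fiber (H.obj x.left)) (hξ : ξ ∈ indSubmodule hM m u) :
    UniformSpace.Completion (IndPre hM m u) :=
  UniformSpace.Completion.coe' (show IndPre hM m u from ⟨ξ, hξ⟩)

/-- The induced representation `Ind_H^G M` on the completions of the spaces of equivariant
functions that are square integrable on `(G/H)_u`, with
`(Ind M)_g ξ(x) = D(g⁻¹, x H)^(1/2) ξ(g⁻¹ x)`. Its Borel structure is the one for which the
equivariant Borel functions that are square integrable on all `(G/H)_u` are fundamental. -/
def ind (hM : M.IsBorelHom) (m : QuotientMeasure H haar μ) : HilbertRep.{u, v, max u v w} X where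
  Fiber u := UniformSpace.Completion (IndPre hM m u)
  IsBorelSection Ξ := ∀ (ξ : ∀ x : Arr X, M.Fiber (H.obj x.left))
    (hξ : ∀ u, ξ ∈ indSubmodule hM m u),
    Measurable fun u => ⟪IndPre.toCompletion ξ (hξ u), Ξ u⟫_ℂ
  op g := completionMap (indOp hM m g)

end Induced

end Subgroupoids

end LCG

end

/-!
Both equivalences come from the same picture: for a σ-finite measure `τ` the Hilbert space tensor
product `V ⊗ L²(τ)` is the space `L²(τ; V)` of vector-valued functions (`tensorLpEquiv`), so that the
fibre of `L ⊗ ρ` over `u` consists of functions with values in the fixed Hilbert space `H(u)`, and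
untwisting such functions by the operators `L_x`, `r(x) = u`, is a fibrewise unitary.

For the induced representation, the function `x ↦ L_x ξ(x)` of an equivariant `ξ` is constant on the
cosets `x H`, which gives an isometry from the equivariant functions to `L²((G/H)_u, m_u; H(u))`
(`indToLp`). Its range contains the elementary tensors `z ⊗ f`, as the images of
`x ↦ f(x H) L_x⁻¹ z` (`sectionInd`), hence it extends to a unitary on the completion
(`tensorIndEquiv`). On these functions the intertwining relation is an identity of functions
(`indFun_sectionInd`).

For the regular representation, the Gram–Schmidt process provides a Borel field `ε` of orthonormal
bases of the fibres (`HilbertBundle.IsBorel.exists_isFrame`). The vectors `L_x ε_k(s(x))` are a basis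
of `H(u)` for every `x` with `r(x) = u`, and the unitaries `B_x` that map the standard basis to them
satisfy `B_x = L_g B_{g⁻¹ x}` (`coordEquiv_cast`). Multiplication by `x ↦ B_x` therefore intertwines
`(dim L) ⊗ ρ^G` and `L ⊗ ρ^G` (`dimTensorEquiv_op`).

That the representations are Borel is reduced to fundamental sequences
(`HilbertRep.isBorelHom_of_isFundamental`). The coefficients are then integrals of jointly measurable
functions against kernels. This needs three facts. A Haar system of `H` makes `G → G/H` open, so that
`G/H` is a second countable Hausdorff space on which `G` acts by a Borel map
(`ClosedSubgroupoid.measurable_act_prod`). The Haar system and the measures `m_u` are σ-finite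
uniformly enough to be equivalent to finite kernels (`HasFiniteCover.hasFiniteDensity`), whence the
Radon–Nikodym derivatives `D(g⁻¹, y)` can be chosen jointly measurable
(`QuotientMeasure.exists_measurable_deriv`). They satisfy the cocycle identity
(`QuotientMeasure.deriv_comp`), so that the quasi-regular representation is multiplicative.
-/

noncomputable section

namespace LCG

/-! ### Topology and Borel structure of the arrows and of the coset space -/

section Topology

open Topology Set

/-- A `σ`-compact metrizable space is a Borel subset of its completion. -/
theorem standardBorelSpace_of_locallyCompact (Y : Type*) [TopologicalSpace Y] [T2Space Y]
    [LocallyCompactSpace Y] [SecondCountableTopology Y] [MeasurableSpace Y] [BorelSpace Y] :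
    StandardBorelSpace Y := by
  let := TopologicalSpace.metrizableSpaceMetric Y
  have hd := UniformSpace.Completion.denseRange_coe (α := Y)
  have : TopologicalSpace.SeparableSpace (UniformSpace.Completion Y) :=
    hd.separableSpace (UniformSpace.Completion.continuous_coe Y)
  borelize (UniformSpace.Completion Y)
  have he : IsEmbedding ((↑) : Y → UniformSpace.Completion Y) :=
    (UniformSpace.Completion.coe_isometry (α := Y)).isEmbedding
  have hr : MeasurableSet (range ((↑) : Y → UniformSpace.Completion Y)) := by
    obtain ⟨K, hK, hKu⟩ := isSigmaCompact_range (UniformSpace.Completion.continuous_coe Y)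
    rw [← hKu]
    exact MeasurableSet.iUnion fun n => (hK n).isClosed.measurableSet
  obtain ⟨τ, hb, hp⟩ := hr.standardBorel.polish
  let e : Y ≃ᵐ range ((↑) : Y → UniformSpace.Completion Y) :=
    (he.measurableEmbedding hr).equivRange
  let := τ.induced e
  refine ⟨this, ?_, ?_⟩
  · exact ⟨e.measurableEmbedding.comap_eq.symm.trans
      ((congrArg (MeasurableSpace.comap e) hb.measurable_eq).trans borel_comap.symm)⟩
  · exact (e.toEquiv.toHomeomorphOfIsInducing ⟨rfl⟩).isClosedEmbedding.polishSpace

variable {X : Type u} [Groupoid.{v} X] [TopologicalSpace X] [TopologicalSpace (Arr X)]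
  [LocallyCompactGroupoid X]

variable (X) in
theorem isEmbedding_one : IsEmbedding (Arr.one : X → Arr X) :=
  .of_leftInverse (f := fun g : Arr X => g.left) (fun _ => rfl)
    LocallyCompactGroupoid.continuous_source LocallyCompactGroupoid.continuous_one

variable (X) in
theorem t2Space_unit : T2Space X := (isEmbedding_one X).t2Space

theorem continuous_mul_of_eq {Z : Type*} [TopologicalSpace Z] {a b : Z → Arr X}
    (ha : Continuous a) (hb : Continuous b) (h : ∀ z, (b z).right = (a z).left) :
    Continuous fun z => Arr.mul (a z) (b z) (h z) :=
  LocallyCompactGroupoid.continuous_mul.comp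
    ((ha.prodMk hb).subtype_mk h)

theorem measurable_lmul_prod [MeasurableSpace (Arr X)] [BorelSpace (Arr X)] :
    Measurable fun p : Arr X × Arr X => lmul p.1.hom p.2 := by
  have := t2Space_unit X
  have hs : MeasurableSet {p : Arr X × Arr X | p.2.right = p.1.left} :=
    (isClosed_eq (LocallyCompactGroupoid.continuous_range.comp continuous_snd)
      (LocallyCompactGroupoid.continuous_source.comp continuous_fst)).measurableSet
  refine measurable_of_restrict_of_restrict_compl hs ?_ ?_
  · refine Eq.mp (congrArg Measurable ?_) (LocallyCompactGroupoid.continuous_mul (X := X)).measurable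
    exact funext fun p : {p : Arr X × Arr X // p.2.right = p.1.left} => (lmul_of_eq _ _ p.2).symm
  · convert (measurable_snd.comp measurable_subtype_coe :
      Measurable fun p : ({p : Arr X × Arr X | p.2.right = p.1.left}ᶜ : Set _) => p.1.2) using 1
    exact funext fun p => lmul_of_ne _ _ p.2

namespace ClosedSubgroupoid

variable (H : ClosedSubgroupoid X)

/-- The integrals of a nonnegative bump function with respect to a Haar system vary continuously
and are positive where the fibre meets the set where the function is positive. -/
theorem range_mem_nhds [MeasurableSpace (Arr X)] [BorelSpace (Arr X)] (haarH : HaarSystem H.Obj)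
    (h : Arr H.Obj) {W : Set (Arr H.Obj)} (hW : W ∈ 𝓝 h) :
    (fun k : Arr H.Obj => H.val k.right) '' W ∈ 𝓝 (H.val h.right) := by
  have hinj : Function.Injective H.incl := by
    rintro ⟨a, b, f, hf⟩ ⟨a', b', f', hf'⟩ he
    have he' : (⟨H.val a, H.val b, f⟩ : Arr X) = ⟨H.val a', H.val b', f'⟩ := he
    change X at a b a' b'
    obtain ⟨ha, hb, hf⟩ := Quiver.Total.mk.inj he'
    obtain rfl : a = a' := ha
    obtain rfl : b = b' := hb
    obtain rfl := eq_of_heq hf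
    rfl
  have hemb : IsClosedEmbedding H.incl := by
    refine ⟨⟨⟨rfl⟩, hinj⟩, ?_⟩
    convert H.isClosed
    ext g
    refine ⟨?_, fun hg => ⟨⟨g.left, g.right, g.hom, hg⟩, rfl⟩⟩
    rintro ⟨k, rfl⟩
    exact k.hom.2
  have : T2Space (Arr H.Obj) := hemb.isEmbedding.t2Space
  have : LocallyCompactSpace (Arr H.Obj) := hemb.locallyCompactSpace
  have : BorelSpace (Arr H.Obj) :=
    ⟨(congrArg (MeasurableSpace.comap H.incl) (BorelSpace.measurable_eq (α := Arr X))).trans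
      borel_comap.symm⟩
  obtain ⟨φ, hφ1, hφ0, hφc, hφ01⟩ := exists_continuous_one_zero_of_isCompact
    (isCompact_singleton (x := h)) (isOpen_interior (s := W)).isClosed_compl
    (disjoint_singleton_left.2 fun hn => hn (mem_interior_iff_mem_nhds.2 hW))
  have hpos : ∀ u : H.Obj, 0 < ∫ g, φ g ∂(haarH.meas u) → H.val u ∈
      (fun k : Arr H.Obj => H.val k.right) '' W := by
    intro u hu
    by_contra hn
    have hsupp : Function.support φ ⊆ (haarH.meas u).supportᶜ := by
      intro k hk hku
      rw [haarH.support_eq] at hku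
      refine hn ⟨k, interior_subset (by_contra fun hkW => hk (hφ0 hkW)), congrArg H.val hku⟩
    have h0 : φ =ᵐ[haarH.meas u] 0 := by
      have : SecondCountableTopology (Arr H.Obj) := hemb.isEmbedding.secondCountableTopology
      filter_upwards [Measure.support_mem_ae (μ := haarH.meas u)] with k hk
      by_contra hne
      exact hsupp hne hk
    rw [integral_congr_ae h0] at hu
    simp at hu
  have hc := haarH.continuous_integral φ φ.continuous hφc
  have hh : 0 < ∫ g, φ g ∂(haarH.meas h.right) := by
    have := haarH.finite_on_compacts h.right
    rw [integral_pos_iff_support_of_nonneg (fun g => (hφ01 g).1)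
      (φ.continuous.integrable_of_hasCompactSupport hφc)]
    have hm : h ∈ (haarH.meas h.right).support := by rw [haarH.support_eq]; rfl
    refine (Measure.mem_support_iff_forall _).1 hm _ (φ.continuous.isOpen_support.mem_nhds ?_)
    simp [hφ1 (mem_singleton h)]
  exact Filter.mem_of_superset ((isOpen_lt continuous_const hc).mem_nhds hh) hpos

/-- A neighbourhood of `x` moves into any neighbourhood of `x h` under right translation by
arrows of `H` near `h`; these exist at every unit near `s(x)`. -/
theorem isOpenMap_coset [MeasurableSpace (Arr X)] [BorelSpace (Arr X)]
    (haarH : HaarSystem H.Obj) : IsOpenMap H.coset := by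
  intro U hU
  change IsOpen (Quotient.mk H.cosetSetoid ⁻¹' _)
  refine isOpen_iff_mem_nhds.2 ?_
  rintro y ⟨z, hz, hzy⟩
  obtain ⟨a, h, hh, rfl⟩ : H.Rel y z := (Quotient.exact hzy.symm : H.Rel y z)
  have hmul := LocallyCompactGroupoid.continuous_mul (X := X)
  let p₀ : {p : Arr X × Arr X // p.2.right = p.1.left} := ⟨(y, ⟨a, y.left, h⟩), rfl⟩
  have hp₀ : Arr.mul p₀.1.1 p₀.1.2 p₀.2 ∈ U := by
    convert hz using 1
    simp [p₀, Arr.mul]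
  have hn := (hU.preimage hmul).mem_nhds (x := p₀) hp₀
  obtain ⟨V, hV, hVU⟩ := mem_nhds_induced _ _ _ |>.1 hn
  obtain ⟨V₁, hV₁, V₂, hV₂, hVV⟩ := mem_nhds_prod_iff.1 hV
  let h₀ : Arr H.Obj := ⟨a, y.left, h, hh⟩
  have hW : H.incl ⁻¹' V₂ ∈ 𝓝 h₀ :=
    (continuous_induced_dom.continuousAt (x := h₀)).preimage_mem_nhds hV₂
  have hr := H.range_mem_nhds haarH h₀ hW
  have hs := (LocallyCompactGroupoid.continuous_source (X := X)).continuousAt.preimage_mem_nhds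
    (x := y) hr
  filter_upwards [hV₁, hs] with y' hy' ⟨k, hk, hky⟩
  obtain ⟨b, c, k, hkk⟩ := k
  obtain rfl : c = y'.left := hky
  refine ⟨⟨b, y'.right, k ≫ y'.hom⟩, ?_, Quotient.sound (s := H.cosetSetoid)
    (H.cosetSetoid.symm ⟨b, k, hkk, rfl⟩)⟩
  have := hVU (show (⟨(y', ⟨b, y'.left, k⟩), rfl⟩ :
    {p : Arr X × Arr X // p.2.right = p.1.left}) ∈ _ from hVV ⟨hy', hk⟩)
  rw [Set.mem_preimage] at this
  convert this using 1
  simp only [Arr.mul, eqToHom_refl, Category.id_comp]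
  rfl

theorem isOpenQuotientMap_coset [MeasurableSpace (Arr X)] [BorelSpace (Arr X)]
    (haarH : HaarSystem H.Obj) : IsOpenQuotientMap H.coset :=
  ⟨Quotient.mk_surjective, continuous_quotient_mk', H.isOpenMap_coset haarH⟩

/-- Two arrows lie in the same coset if and only if they have the same range and `x⁻¹ y` lies in
the closed set `H`. -/
theorem t2Space_quo [MeasurableSpace (Arr X)] [BorelSpace (Arr X)]
    (haarH : HaarSystem H.Obj) : T2Space H.Quo := by
  have := t2Space_unit X
  rw [t2Space_iff_of_isOpenQuotientMap (H.isOpenQuotientMap_coset haarH)]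
  have hr := LocallyCompactGroupoid.continuous_range (X := X)
  have hs : IsClosed {p : Arr X × Arr X | p.1.right = p.2.right} :=
    isClosed_eq (hr.comp continuous_fst) (hr.comp continuous_snd)
  have hm : Continuous fun p : {p : Arr X × Arr X | p.1.right = p.2.right} =>
      Arr.mul (Arr.inv p.1.1) p.1.2 p.2.symm :=
    continuous_mul_of_eq (a := fun p : {p : Arr X × Arr X | p.1.right = p.2.right} =>
        Arr.inv p.1.1)
      (LocallyCompactGroupoid.continuous_inv.comp
        (continuous_fst.comp continuous_subtype_val))
      (continuous_snd.comp continuous_subtype_val) _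
  convert hs.isClosedEmbedding_subtypeVal.isClosedMap _ (H.isClosed.preimage hm) using 1
  ext ⟨x, y⟩
  constructor
  · intro hxy
    obtain ⟨a, h, hh, rfl⟩ : H.Rel x y := Quotient.exact hxy
    refine ⟨⟨(x, ⟨a, x.right, h ≫ x.hom⟩), rfl⟩, ?_, rfl⟩
    change (h ≫ x.hom) ≫ 𝟙 x.right ≫ Groupoid.inv x.hom ∈ H.arrows a x.left
    have e : (h ≫ x.hom) ≫ 𝟙 x.right ≫ Groupoid.inv x.hom = h := by simp
    rwa [e]
  · rintro ⟨⟨⟨x, y⟩, hr⟩, hp, he⟩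
    obtain ⟨rfl, rfl⟩ := Prod.mk.inj he
    obtain ⟨a, b, x⟩ := x
    obtain ⟨c, d, y⟩ := y
    obtain rfl : b = d := hr
    refine Quotient.sound (s := H.cosetSetoid) ⟨c, y ≫ Groupoid.inv x, ?_, by simp⟩
    change y ≫ 𝟙 b ≫ Groupoid.inv x ∈ H.arrows c a at hp
    rwa [Category.id_comp] at hp

theorem secondCountableTopology_quo [MeasurableSpace (Arr X)] [BorelSpace (Arr X)]
    (haarH : HaarSystem H.Obj) : SecondCountableTopology H.Quo :=
  (H.isOpenQuotientMap_coset haarH).isQuotientMap.secondCountableTopology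
    (H.isOpenMap_coset haarH)

theorem borelSpace_quo [MeasurableSpace (Arr X)] [BorelSpace (Arr X)]
    (haarH : HaarSystem H.Obj) : BorelSpace H.Quo := by
  have := standardBorelSpace_of_locallyCompact (Arr X)
  have := H.t2Space_quo haarH
  have := H.secondCountableTopology_quo haarH
  have : OpensMeasurableSpace H.Quo := ⟨MeasurableSpace.generateFrom_le fun U hU =>
    (IsOpen.preimage (f := H.coset) continuous_quotient_mk' hU).measurableSet⟩
  exact H.measurable_coset.borelSpace_codomain Quotient.mk_surjective

/-- By Suslin's theorem `G × G → G × G/H` is a quotient map for the Borel structures. -/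
theorem measurable_act_prod [MeasurableSpace (Arr X)] [BorelSpace (Arr X)]
    (haarH : HaarSystem H.Obj) : Measurable fun p : Arr X × H.Quo => H.act p.1.hom p.2 := by
  have := standardBorelSpace_of_locallyCompact (Arr X)
  have := H.t2Space_quo haarH
  have := H.secondCountableTopology_quo haarH
  have := H.borelSpace_quo haarH
  have hm : Measurable (Prod.map id H.coset : Arr X × Arr X → Arr X × H.Quo) :=
    measurable_id.prodMap H.measurable_coset
  refine (hm.measurable_comp_iff_of_surjective
    (Function.surjective_id.prodMap Quotient.mk_surjective)).1 ?_
  exact H.measurable_coset.comp measurable_lmul_prod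

end ClosedSubgroupoid

end Topology

/-! ### Fibrewise σ-finite kernels -/

section Kernels

open Set Filter Topology

variable {α Y Z : Type*} [MeasurableSpace α] [MeasurableSpace Y] [MeasurableSpace Z]

/-- There is one countable measurable cover of `Y` all of whose members have finite measure for
every `κ a`. No bound uniform in `a` is asked for. -/
def HasFiniteCover (κ : Kernel α Y) : Prop :=
  ∃ C : ℕ → Set Y, (∀ n, MeasurableSet (C n)) ∧ ⋃ n, C n = univ ∧ ∀ a n, κ a (C n) < ∞

/-- The kernel is equivalent to a finite kernel `κ'`, with a jointly measurable density that takes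
values in `(0, ∞)` everywhere. -/
def HasFiniteDensity (κ : Kernel α Y) : Prop :=
  ∃ (κ' : Kernel α Y) (w : α × Y → ℝ≥0∞), IsFiniteKernel κ' ∧ Measurable w ∧ (∀ p, w p ≠ 0) ∧
    (∀ p, w p ≠ ∞) ∧ ∀ a, κ' a = (κ a).withDensity fun y => w (a, y)

/-- The density is `∑ 2^(-n-1) 1_{C n} / (1 + κ a (C n))`. -/
theorem HasFiniteCover.hasFiniteDensity {κ : Kernel α Y} (hκ : HasFiniteCover κ) :
    HasFiniteDensity κ := by
  obtain ⟨C, hC, hCu, hCf⟩ := hκ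
  let c : ℕ → α → ℝ≥0∞ := fun n a => 2⁻¹ ^ (n + 1) * (1 + κ a (C n))⁻¹
  have hc : ∀ n, Measurable (c n) := fun n =>
    ((measurable_const.add (κ.measurable_coe (hC n))).inv).const_mul _
  have hc0 : ∀ n a, c n a ≠ 0 := fun n a => mul_ne_zero (pow_ne_zero _ (by simp))
    (ENNReal.inv_ne_zero.2 (ENNReal.add_lt_top.2 ⟨ENNReal.one_lt_top, hCf a n⟩).ne)
  have hsum : ∑' n : ℕ, (2⁻¹ : ℝ≥0∞) ^ (n + 1) = 1 := by
    rw [ENNReal.tsum_geometric_add_one, ENNReal.one_sub_inv_two, inv_inv,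
      ENNReal.inv_mul_cancel (by norm_num) (by norm_num)]
  have hcle : ∀ n a, c n a ≤ 2⁻¹ ^ (n + 1) := fun n a =>
    mul_le_of_le_one_right' (ENNReal.inv_le_one.2 le_self_add)
  let w : α × Y → ℝ≥0∞ := fun p => ∑' n, (C n).indicator (fun _ => c n p.1) p.2
  have hterm : ∀ n, Measurable fun p : α × Y => (C n).indicator (fun _ => c n p.1) p.2 := by
    intro n
    have : (fun p : α × Y => (C n).indicator (fun _ => c n p.1) p.2) =
        (Prod.snd ⁻¹' C n).indicator fun p => c n p.1 := rfl
    rw [this]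
    exact ((hc n).comp measurable_fst).indicator (measurable_snd (hC n))
  have hw : Measurable w := Measurable.tsum hterm
  have happ : ∀ a, ∀ A, MeasurableSet A →
      (κ a).withDensity (fun y => w (a, y)) A = ∑' n, c n a * κ a (A ∩ C n) := by
    intro a A hA
    rw [withDensity_apply _ hA]
    change ∫⁻ y in A, ∑' n, (C n).indicator (fun _ => c n a) y ∂(κ a) = _
    rw [lintegral_tsum fun n => (measurable_const.indicator (hC n)).aemeasurable]
    refine tsum_congr fun n => ?_
    rw [lintegral_indicator_const (hC n), Measure.restrict_apply (hC n), inter_comm]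
  refine ⟨⟨fun a => (κ a).withDensity fun y => w (a, y),
    Measure.measurable_of_measurable_coe _ fun A hA => ?_⟩, w, ⟨1, ENNReal.one_lt_top, fun a => ?_⟩,
    hw, fun p h => ?_, fun p => ne_of_lt ?_, fun a => rfl⟩
  · simp_rw [happ _ A hA]
    exact Measurable.tsum fun n => (hc n).mul (κ.measurable_coe (hA.inter (hC n)))
  · refine (happ a univ .univ).trans_le ((ENNReal.tsum_le_tsum fun n => ?_).trans hsum.le)
    rw [univ_inter, mul_assoc]
    refine mul_le_of_le_one_right' ?_
    rw [mul_comm]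
    exact ENNReal.div_le_of_le_mul (by rw [one_mul]; exact le_add_self)
  · obtain ⟨n, hn⟩ := mem_iUnion.1 (hCu.ge (mem_univ p.2))
    have := ENNReal.tsum_eq_zero.1 h n
    rw [indicator_of_mem hn] at this
    exact hc0 n p.1 this
  · refine ((ENNReal.tsum_le_tsum fun n => ?_).trans hsum.le).trans_lt ENNReal.one_lt_top
    exact (indicator_le_self' (by simp) _).trans (hcle n p.1)

namespace HasFiniteDensity

variable {κ η : Kernel α Y}

theorem eq_withDensity_inv {κ' : Kernel α Y} {w : α × Y → ℝ≥0∞} (hw : Measurable w)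
    (h0 : ∀ p, w p ≠ 0) (ht : ∀ p, w p ≠ ∞) (h : ∀ a, κ' a = (κ a).withDensity fun y => w (a, y))
    (a : α) : κ a = (κ' a).withDensity fun y => (w (a, y))⁻¹ := by
  have hwa : Measurable fun y => w (a, y) := hw.comp measurable_prodMk_left
  rw [h, withDensity_inv_same hwa (ae_of_all _ fun y => h0 _) (ae_of_all _ fun y => ht _)]

theorem isSFiniteKernel (hκ : HasFiniteDensity κ) : IsSFiniteKernel κ := by
  obtain ⟨κ', w, hf, hw, h0, ht, h⟩ := hκ
  have hm : Measurable (Function.uncurry fun a y => (w (a, y))⁻¹) := hw.inv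
  have : κ = κ'.withDensity fun a y => (w (a, y))⁻¹ := by
    ext1 a
    rw [Kernel.withDensity_apply _ hm, eq_withDensity_inv hw h0 ht h a]
  rw [this]
  exact Kernel.IsSFiniteKernel.withDensity κ' fun a y => ENNReal.inv_ne_top.2 (h0 _)

theorem sigmaFinite (hκ : HasFiniteDensity κ) (a : α) : SigmaFinite (κ a) := by
  obtain ⟨κ', w, hf, hw, h0, ht, h⟩ := hκ
  rw [eq_withDensity_inv hw h0 ht h a]
  exact SigmaFinite.withDensity_of_ne_top (ae_of_all _ fun y => ENNReal.inv_ne_top.2 (h0 _))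

theorem comap {β : Type*} [MeasurableSpace β] (hκ : HasFiniteDensity κ) {f : β → α}
    (hf : Measurable f) : HasFiniteDensity (κ.comap f hf) := by
  obtain ⟨κ', w, hfin, hw, h0, ht, h⟩ := hκ
  exact ⟨κ'.comap f hf, fun p => w (f p.1, p.2), inferInstance,
    hw.comp ((hf.comp measurable_fst).prodMk measurable_snd), fun _ => h0 _, fun _ => ht _,
    fun b => h (f b)⟩

end HasFiniteDensity

/-- The image of a kernel under a measurable family of maps. -/
def mapFamily (κ : Kernel α Y) [IsSFiniteKernel κ] {T : α × Y → Z} (hT : Measurable T) :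
    Kernel α Z where
  toFun a := (κ a).map fun y => T (a, y)
  measurable' := by
    refine Measure.measurable_of_measurable_coe _ fun A hA => ?_
    have hTa : ∀ a, Measurable fun y => T (a, y) := fun a => hT.comp measurable_prodMk_left
    simp_rw [fun a => Measure.map_apply (μ := κ a) (hTa a) hA]
    exact Kernel.measurable_kernel_prodMk_left (hT hA)

theorem HasFiniteDensity.mapFamily {κ : Kernel α Y} [IsSFiniteKernel κ] (hκ : HasFiniteDensity κ)
    {T : α × Y → Z} (hT : Measurable T) {S : α × Z → Y} (hS : Measurable S)
    (hST : ∀ a, ∀ᵐ y ∂(κ a), S (a, T (a, y)) = y) : HasFiniteDensity (mapFamily κ hT) := by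
  obtain ⟨κ', w, hfin, hw, h0, ht, h⟩ := hκ
  have hw' : Measurable fun p : α × Z => w (p.1, S p) := hw.comp (measurable_fst.prodMk hS)
  refine ⟨LCG.mapFamily κ' hT, fun p => w (p.1, S p), ⟨κ'.bound, κ'.bound_lt_top, fun a => ?_⟩,
    hw', fun _ => h0 _, fun _ => ht _, fun a => ?_⟩
  · change (κ' a).map _ univ ≤ _
    have hTa : Measurable fun y => T (a, y) := hT.comp measurable_prodMk_left
    rw [Measure.map_apply hTa .univ]
    exact κ'.measure_le_bound a _
  · change (κ' a).map _ = ((κ a).map _).withDensity _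
    have hTa : Measurable fun y => T (a, y) := hT.comp measurable_prodMk_left
    have hwa : Measurable fun y => w (a, S (a, y)) := hw'.comp measurable_prodMk_left
    ext A hA
    rw [Measure.map_apply hTa hA, withDensity_apply _ hA, h, withDensity_apply _ (hTa hA),
      setLIntegral_map hA hwa hTa]
    refine lintegral_congr_ae (ae_restrict_of_ae ?_)
    filter_upwards [hST a] with y hy
    rw [hy]

/-- The Radon–Nikodym derivatives of two kernels can be chosen jointly measurable: this is known
for finite kernels, and the general case follows by the change of densities. -/
theorem HasFiniteDensity.exists_measurable_rnDeriv [MeasurableSpace.CountablyGenerated Y]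
    {κ η : Kernel α Y} (hκ : HasFiniteDensity κ) (hη : HasFiniteDensity η)
    (hac : ∀ a, κ a ≪ η a) :
    ∃ D : α × Y → ℝ≥0∞, Measurable D ∧
      ∀ a, (fun y => D (a, y)) =ᵐ[η a] (κ a).rnDeriv (η a) := by
  have hσ := hη.sigmaFinite
  obtain ⟨κ', w, hfκ, hw, hw0, hwt, h⟩ := hκ
  obtain ⟨η', z, hfη, hz, hz0, hzt, k⟩ := hη
  have hR := Kernel.measurable_rnDeriv κ' η'
  refine ⟨fun p => z p * κ'.rnDeriv η' p.1 p.2 * (w p)⁻¹, (hz.mul hR).mul hw.inv, fun a => ?_⟩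
  have hza : Measurable fun y => z (a, y) := hz.comp measurable_prodMk_left
  have hwa : Measurable fun y => (w (a, y))⁻¹ := (hw.comp measurable_prodMk_left).inv
  have hRa : Measurable (κ'.rnDeriv η' a) := hR.comp measurable_prodMk_left
  have hac' : κ' a ≪ η' a := by
    rw [h, k]
    exact (withDensity_absolutelyContinuous _ _).trans ((hac a).trans
      (withDensity_absolutelyContinuous' hza.aemeasurable (ae_of_all _ fun _ => hz0 _)))
  have e : κ a = (η a).withDensity
      (((fun y => z (a, y)) * κ'.rnDeriv η' a) * fun y => (w (a, y))⁻¹) := by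
    rw [withDensity_mul _ (hza.mul hRa) hwa, withDensity_mul _ hza hRa, ← k,
      withDensity_congr_ae (Kernel.rnDeriv_eq_rnDeriv_measure (κ := κ') (η := η') (a := a)),
      Measure.withDensity_rnDeriv_eq _ _ hac']
    exact eq_withDensity_inv hw hw0 hwt h a
  conv_rhs => rw [e]
  exact (Measure.rnDeriv_withDensity (η a) ((hza.mul hRa).mul hwa)).symm

end Kernels

/-! ### The Haar system and the quotient measures as kernels -/

section HaarKernel

open Set Filter Topology

variable {X : Type u} [Groupoid.{v} X] [TopologicalSpace X]
  [TopologicalSpace (Arr X)] [MeasurableSpace (Arr X)] [LocallyCompactGroupoid X]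

theorem HaarSystem.range_eq_ae (haar : HaarSystem X) (u : X) :
    ∀ᵐ x ∂(haar.meas u), x.right = u := by
  have h := Measure.support_mem_ae (μ := haar.meas u)
  rw [haar.support_eq] at h
  exact h

variable [MeasurableSpace X] [BorelSpace (Arr X)]

theorem QuotientMeasure.hasFiniteCover {H : ClosedSubgroupoid X} (haarH : HaarSystem H.Obj)
    {haar : HaarSystem X} {μ : Measure X} (m : QuotientMeasure H haar μ) :
    HasFiniteCover m.fiber := by
  have := H.t2Space_quo haarH
  have := H.borelSpace_quo haarH
  exact ⟨compactCovering H.Quo, fun n => (isCompact_compactCovering _ n).measurableSet,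
    iUnion_compactCovering _, fun u n => by
      have := m.finite_on_compacts u
      exact (isCompact_compactCovering H.Quo n).measure_lt_top⟩

variable [BorelSpace X]

/-- The indicator function of a relatively compact open set is a pointwise limit of continuous
functions with compact support. -/
theorem HaarSystem.measurable_real_of_isOpen (haar : HaarSystem X) {W K : Set (Arr X)}
    (hW : IsOpen W) (hK : IsCompact K) (hWK : W ⊆ K) :
    Measurable fun u => haar.meas u W := by
  let := TopologicalSpace.metrizableSpaceMetric (Arr X)
  let δ : ℕ → ℝ := fun n => 1 / ((n : ℝ) + 1)
  have hδ : ∀ n, 0 < δ n := fun n => by positivity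
  let φ : ℕ → Arr X → ℝ := fun n x => 1 - (thickenedIndicator (hδ n) Wᶜ x : ℝ)
  have hφc : ∀ n, Continuous (φ n) := fun n =>
    continuous_const.sub (NNReal.continuous_coe.comp (thickenedIndicator (hδ n) Wᶜ).continuous)
  have hφ0 : ∀ n x, x ∉ W → φ n x = 0 := fun n x hx => by
    simp only [φ, thickenedIndicator_one (hδ n) Wᶜ hx, NNReal.coe_one, sub_self]
  have hφs : ∀ n, HasCompactSupport (φ n) := fun n =>
    HasCompactSupport.of_support_subset_isCompact hK fun x hx =>
      hWK (by_contra fun h => hx (hφ0 n x h))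
  have hφ1 : ∀ n x, ‖φ n x‖ ≤ W.indicator (fun _ => (1 : ℝ)) x := by
    intro n x
    by_cases hx : x ∈ W
    · rw [indicator_of_mem hx, Real.norm_eq_abs, abs_le]
      have h1 : (thickenedIndicator (hδ n) Wᶜ x : ℝ) ≤ 1 := by
        exact_mod_cast thickenedIndicator_le_one (hδ n) Wᶜ x
      have h2 : (0 : ℝ) ≤ (thickenedIndicator (hδ n) Wᶜ x : ℝ) := NNReal.coe_nonneg _
      constructor <;> simp only [φ] <;> linarith
    · rw [hφ0 n x hx, indicator_of_notMem hx, norm_zero]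
  have hlim : ∀ x, Tendsto (fun n => φ n x) atTop (𝓝 (W.indicator (fun _ => (1 : ℝ)) x)) := by
    intro x
    have h := thickenedIndicator_tendsto_indicator_closure hδ
      tendsto_one_div_add_atTop_nhds_zero_nat Wᶜ
    have h' := (NNReal.continuous_coe.tendsto _).comp ((tendsto_pi_nhds.1 h) x)
    rw [hW.isClosed_compl.closure_eq] at h'
    convert h'.const_sub 1 using 1
    congr 1
    by_cases hx : x ∈ W <;> simp [hx]
  have hfin : ∀ u, haar.meas u W ≠ ∞ := fun u => by
    have := haar.finite_on_compacts u
    exact ((measure_mono hWK).trans_lt hK.measure_lt_top).ne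
  have hr : Measurable fun u => (haar.meas u).real W := by
    refine measurable_of_tendsto_metrizable (f := fun n u => ∫ x, φ n x ∂(haar.meas u))
      (fun n => (haar.continuous_integral _ (hφc n) (hφs n)).measurable) ?_
    refine tendsto_pi_nhds.2 fun u => ?_
    rw [← integral_indicator_one hW.measurableSet]
    exact tendsto_integral_of_dominated_convergence (W.indicator fun _ => (1 : ℝ))
      (fun n => (hφc n).aestronglyMeasurable)
      ((integrable_indicator_iff hW.measurableSet).2 (integrableOn_const (hfin u)))
      (fun n => ae_of_all _ (hφ1 n)) (ae_of_all _ hlim)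
  convert hr.ennreal_ofReal using 1
  ext u
  exact (ENNReal.ofReal_toReal (hfin u)).symm

theorem HaarSystem.measurable_meas (haar : HaarSystem X) : Measurable haar.meas := by
  let K := CompactExhaustion.choice (Arr X)
  let O : ℕ → Set (Arr X) := fun n => interior (K n)
  have hO : ∀ n, IsOpen (O n) := fun n => isOpen_interior
  have hOu : ⋃ n, O n = univ := by
    refine eq_univ_of_forall fun x => ?_
    obtain ⟨n, hn⟩ := K.exists_mem x
    exact mem_iUnion.2 ⟨n + 1, K.subset_interior_succ n hn⟩
  have hmono : Monotone O := fun m n h => interior_mono (K.subset h)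
  have hfin : ∀ n u, IsFiniteMeasure ((haar.meas u).restrict (O n)) := fun n u => by
    have := haar.finite_on_compacts u
    refine ⟨?_⟩
    rw [Measure.restrict_apply_univ]
    exact (measure_mono interior_subset).trans_lt (K.isCompact n).measure_lt_top
  have hn : ∀ n, Measurable fun u => (haar.meas u).restrict (O n) := by
    intro n
    have hb : ∀ U, IsOpen U → Measurable fun u => (haar.meas u).restrict (O n) U := by
      intro U hU
      simp_rw [Measure.restrict_apply hU.measurableSet]
      exact haar.measurable_real_of_isOpen (hU.inter (hO n)) (K.isCompact n)
        (inter_subset_right.trans interior_subset)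
    exact Measurable.measure_of_isPiSystem (S := {U | IsOpen U})
      (BorelSpace.measurable_eq (α := Arr X)) isPiSystem_isOpen hb (hb _ isOpen_univ)
  refine Measure.measurable_of_measurable_coe _ fun A hA => ?_
  have hs : ∀ u, haar.meas u A = ⨆ n, (haar.meas u).restrict (O n) A := by
    intro u
    simp_rw [Measure.restrict_apply hA]
    rw [← Monotone.measure_iUnion fun m n h => inter_subset_inter_right A (hmono h),
      ← inter_iUnion, hOu, inter_univ]
  simp_rw [hs]
  exact Measurable.iSup fun n => (Measure.measurable_coe hA).comp (hn n)

/-- The Haar system as a kernel. -/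
def HaarSystem.kernel (haar : HaarSystem X) : Kernel X (Arr X) := ⟨haar.meas, haar.measurable_meas⟩

theorem HaarSystem.hasFiniteCover (haar : HaarSystem X) : HasFiniteCover haar.kernel :=
  ⟨compactCovering (Arr X), fun n => (isCompact_compactCovering _ n).measurableSet,
    iUnion_compactCovering _, fun u n => by
      have : IsFiniteMeasureOnCompacts (haar.kernel u) := haar.finite_on_compacts u
      exact (isCompact_compactCovering (Arr X) n).measure_lt_top⟩

end HaarKernel

/-! ### Isometries on completions of tensor products -/

section Completions

open UniformSpace

variable {E F G : Type*} [SeminormedAddCommGroup E] [InnerProductSpace ℂ E]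
  [NormedAddCommGroup F] [InnerProductSpace ℂ F] [NormedAddCommGroup G] [InnerProductSpace ℂ G]

theorem completionMap_coe {E' : Type*} [SeminormedAddCommGroup E'] [InnerProductSpace ℂ E']
    (f : E →ₗᵢ[ℂ] E') (x : E) : completionMap f (x : Completion E) = (f x : Completion E') := by
  change f.toContinuousLinearMap.completion (x : Completion E) = _
  simp

/-- The extension of a linear isometry to the completion of its domain. -/
def completionLift [CompleteSpace F] (f : E →ₗᵢ[ℂ] F) : Completion E →ₗᵢ[ℂ] F where
  toLinearMap := f.toContinuousLinearMap.fromCompletion.toLinearMap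
  norm_map' x := by
    have hc := f.toContinuousLinearMap.fromCompletion.continuous
    refine Completion.induction_on x (isClosed_eq hc.norm continuous_norm) fun a => ?_
    change ‖f.toContinuousLinearMap.fromCompletion (a : Completion E)‖ = _
    simp

theorem completionLift_coe [CompleteSpace F] (f : E →ₗᵢ[ℂ] F) (x : E) :
    completionLift f (x : Completion E) = f x :=
  f.toContinuousLinearMap.fromCompletion_apply_coe x

theorem surjective_of_denseRange {E : Type*} [NormedAddCommGroup E]
    [InnerProductSpace ℂ E] [CompleteSpace E] (f : E →ₗᵢ[ℂ] F) (hf : DenseRange f) :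
    Function.Surjective f :=
  Set.range_eq_univ.1
    (f.isometry.isClosedEmbedding.isClosed_range.closure_eq ▸ hf.closure_range)

/-- The completion of the domain of a linear isometry with dense range is the codomain. -/
def completionEquiv [CompleteSpace F] (f : E →ₗᵢ[ℂ] F) (hf : DenseRange f) :
    Completion E ≃ₗᵢ[ℂ] F :=
  LinearIsometryEquiv.ofSurjective (completionLift f)
    (surjective_of_denseRange _ (hf.mono (by
      rintro _ ⟨x, rfl⟩
      exact ⟨x, completionLift_coe f x⟩)))

theorem completionEquiv_coe [CompleteSpace F] (f : E →ₗᵢ[ℂ] F) (hf : DenseRange f) (x : E) :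
    completionEquiv f hf (x : Completion E) = f x := completionLift_coe f x

/-- The image of a dense span under a surjective isometry. -/
theorem dense_span_map {E F ι : Type*} [NormedAddCommGroup E] [InnerProductSpace ℂ E]
    [NormedAddCommGroup F] [InnerProductSpace ℂ F] (T : E →ₗᵢ[ℂ] F) (hT : Function.Surjective T)
    {f : ι → E} (hf : Dense (Submodule.span ℂ (Set.range f) : Set E)) :
    Dense (Submodule.span ℂ (Set.range fun n => T (f n)) : Set F) := by
  have h := hT.denseRange.dense_image T.continuous hf
  have e : T '' (Submodule.span ℂ (Set.range f) : Set E) =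
      (Submodule.span ℂ (Set.range fun n => T (f n)) : Set F) := by
    have := Submodule.map_span T.toLinearMap (Set.range f)
    rw [← Set.range_comp] at this
    exact congrArg (SetLike.coe) this
  rwa [e] at h

/-- A simple tensor, as an element of the Hilbert space tensor product. -/
def tmulC (x : F) (y : G) : Completion (F ⊗[ℂ] G) := ((x ⊗ₜ[ℂ] y : F ⊗[ℂ] G) : Completion (F ⊗[ℂ] G))

theorem inner_tmulC (x x' : F) (y y' : G) :
    ⟪tmulC x y, tmulC x' y'⟫_ℂ = ⟪x, x'⟫_ℂ * ⟪y, y'⟫_ℂ := by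
  simp [tmulC]

theorem completion_tensor_ext {K : Type*} [NormedAddCommGroup K] [NormedSpace ℂ K]
    {f g : Completion (F ⊗[ℂ] G) →ₗᵢ[ℂ] K} (h : ∀ x y, f (tmulC x y) = g (tmulC x y)) (z) :
    f z = g z := by
  refine Completion.induction_on z (isClosed_eq f.continuous g.continuous) fun a => ?_
  induction a using TensorProduct.induction_on with
  | zero => exact (map_zero f).trans (map_zero g).symm
  | tmul x y => exact h x y
  | add a b ha hb => simp only [Completion.coe_add, map_add, ha, hb]

theorem dense_span_tmulC {ι κ : Type*} {f : ι → F} {g : κ → G}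
    (hf : Dense (Submodule.span ℂ (Set.range f) : Set F))
    (hg : Dense (Submodule.span ℂ (Set.range g) : Set G)) :
    Dense (Submodule.span ℂ (Set.range fun p : ι × κ => tmulC (f p.1) (g p.2)) :
      Set (Completion (F ⊗[ℂ] G))) := by
  rw [Submodule.dense_iff_topologicalClosure_eq_top, Submodule.topologicalClosure_eq_top_iff,
    Submodule.eq_bot_iff]
  intro z hz
  let φ : F →L[ℂ] G →L[ℂ] ℂ :=
    ((ContinuousLinearMap.compL ℂ G (Completion (F ⊗[ℂ] G)) ℂ (innerSL ℂ z)).comp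
      (ContinuousLinearMap.compL ℂ G (F ⊗[ℂ] G) _ Completion.toComplL)).comp
      (TensorProduct.mkL ℂ F G)
  have hφ : ∀ x y, φ x y = ⟪z, tmulC x y⟫_ℂ := fun x y => rfl
  have h0 : φ = 0 := by
    refine ContinuousLinearMap.ext_on hf ?_
    rintro _ ⟨i, rfl⟩
    refine ContinuousLinearMap.ext_on hg ?_
    rintro _ ⟨k, rfl⟩
    exact inner_eq_zero_symm.1
      ((Submodule.mem_orthogonal _ z).1 hz _ (Submodule.subset_span ⟨(i, k), rfl⟩))
  have h1 : ∀ a, ⟪z, a⟫_ℂ = 0 := fun a => by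
    refine Completion.induction_on a (isClosed_eq (by fun_prop) continuous_const) fun a => ?_
    induction a using TensorProduct.induction_on with
    | zero => exact inner_zero_right z
    | tmul x y => exact (hφ x y).symm.trans (by rw [h0]; rfl)
    | add a b ha hb => rw [Completion.coe_add, inner_add_right, ha, hb, add_zero]
  exact inner_self_eq_zero.1 (h1 z)

end Completions

/-! ### Borel Hilbert bundles and representations -/

section Bundles

variable {X : Type u}

/-- A fundamental sequence of a Borel Hilbert bundle. -/
structure HilbertBundle.IsFundamental [MeasurableSpace X] (E : HilbertBundle.{u, w} X)
    (f : ℕ → ∀ u, E.Fiber u) : Prop where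
  measurable_inner : ∀ m n, Measurable fun u => ⟪f m u, f n u⟫_ℂ
  dense : ∀ u, Dense (Submodule.span ℂ (Set.range fun n => f n u) : Set (E.Fiber u))
  isBorelSection_iff : ∀ ξ : ∀ u, E.Fiber u,
    E.IsBorelSection ξ ↔ ∀ n, Measurable fun u => ⟪f n u, ξ u⟫_ℂ

theorem HilbertBundle.IsBorel.exists_isFundamental [MeasurableSpace X]
    {E : HilbertBundle.{u, w} X} (hE : E.IsBorel) : ∃ f, E.IsFundamental f :=
  let ⟨f, h1, h2, h3⟩ := hE
  ⟨f, h1, h2, h3⟩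

theorem measurable_inner_comm {Y : Type*} [MeasurableSpace Y] {V : Y → Type*}
    [∀ y, NormedAddCommGroup (V y)] [∀ y, InnerProductSpace ℂ (V y)] {ξ η : ∀ y, V y}
    (h : Measurable fun y => ⟪ξ y, η y⟫_ℂ) : Measurable fun y => ⟪η y, ξ y⟫_ℂ := by
  convert Complex.continuous_conj.measurable.comp h using 1
  exact funext fun y => (inner_conj_symm _ _).symm

namespace HilbertBundle.IsFundamental

variable [MeasurableSpace X] {E : HilbertBundle.{u, w} X} {f : ℕ → ∀ u, E.Fiber u}

theorem isBorel (hf : E.IsFundamental f) : E.IsBorel := ⟨f, hf.1, hf.2, hf.3⟩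

theorem isBorelSection (hf : E.IsFundamental f) (n : ℕ) : E.IsBorelSection (f n) :=
  (hf.isBorelSection_iff _).2 fun m => hf.measurable_inner m n

theorem measurable_inner_sections (hf : E.IsFundamental f) {ξ η : ∀ u, E.Fiber u}
    (hξ : E.IsBorelSection ξ) (hη : E.IsBorelSection η) : Measurable fun u => ⟪ξ u, η u⟫_ℂ :=
  measurable_inner_of_fundamental hf.1 hf.2 ((hf.isBorelSection_iff _).1 hξ)
    ((hf.isBorelSection_iff _).1 hη)

/-- Fibrewise unitaries identify the Borel sections of `E` with those of `E'`, once the images of a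
fundamental sequence have Borel inner products with a family of sections that determines the Borel
sections of `E'` and contains these images. -/
theorem isBorelSection_iff_map (hf : E.IsFundamental f) {E' : HilbertBundle.{u, w'} X}
    (U : ∀ u, E.Fiber u ≃ₗᵢ[ℂ] E'.Fiber u) {S : Set (∀ u, E'.Fiber u)}
    (hS : ∀ Ξ : ∀ u, E'.Fiber u, E'.IsBorelSection Ξ ↔ ∀ s ∈ S, Measurable fun u => ⟪s u, Ξ u⟫_ℂ)
    (hfS : ∀ n, (fun u => U u (f n u)) ∈ S)
    (hm : ∀ s ∈ S, ∀ n, Measurable fun u => ⟪U u (f n u), s u⟫_ℂ) (ξ : ∀ u, E.Fiber u) :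
    E.IsBorelSection ξ ↔ E'.IsBorelSection fun u => U u (ξ u) := by
  refine ⟨fun hξ => (hS _).2 fun s hs => ?_, fun hξ => (hf.isBorelSection_iff _).2 fun n => ?_⟩
  · have h1 : E.IsBorelSection fun u => (U u).symm (s u) :=
      (hf.isBorelSection_iff _).2 fun n => by
        convert hm s hs n using 2 with u
        rw [← (U u).inner_map_map, (U u).apply_symm_apply]
    convert hf.measurable_inner_sections h1 hξ using 2 with u
    rw [← (U u).inner_map_map ((U u).symm (s u)), (U u).apply_symm_apply]
  · convert (hS _).1 hξ _ (hfS n) using 2 with u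
    rw [(U u).inner_map_map]

theorem map (hf : E.IsFundamental f) {E' : HilbertBundle.{u, w'} X}
    (U : ∀ u, E.Fiber u ≃ₗᵢ[ℂ] E'.Fiber u)
    (hU : ∀ ξ : ∀ u, E.Fiber u, E.IsBorelSection ξ ↔ E'.IsBorelSection fun u => U u (ξ u)) :
    E'.IsFundamental fun n u => U u (f n u) where
  measurable_inner m n := by
    simpa only [LinearIsometryEquiv.inner_map_map] using hf.measurable_inner m n
  dense u := dense_span_map (U u).toLinearIsometry (U u).surjective (hf.dense u)
  isBorelSection_iff Ξ := by
    have h := hU fun u => (U u).symm (Ξ u)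
    simp only [LinearIsometryEquiv.apply_symm_apply] at h
    rw [← h, hf.isBorelSection_iff]
    refine forall_congr' fun n => ?_
    have e : ∀ u, ⟪f n u, (U u).symm (Ξ u)⟫_ℂ = ⟪U u (f n u), Ξ u⟫_ℂ := fun u => by
      rw [← (U u).inner_map_map, (U u).apply_symm_apply]
    simp_rw [e]

end HilbertBundle.IsFundamental

end Bundles

/-! ### The Borel Hilbert bundle of `L²`-spaces -/

section L2Bundle

open Set

variable {X : Type u} [MeasurableSpace X] {Y : Type w} [MeasurableSpace Y]

theorem measurable_inner_toLp (κ : Kernel X Y) {f g : Y → ℂ} (hf : Measurable f)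
    (hg : Measurable g) (hf2 : ∀ u, MemLp f 2 (κ u)) (hg2 : ∀ u, MemLp g 2 (κ u)) :
    Measurable fun u => ⟪(hf2 u).toLp f, (hg2 u).toLp g⟫_ℂ := by
  have h : ∀ u, ⟪(hf2 u).toLp f, (hg2 u).toLp g⟫_ℂ = ∫ y, ⟪f y, g y⟫_ℂ ∂(κ u) := by
    intro u
    rw [L2.inner_def]
    refine integral_congr_ae ?_
    filter_upwards [(hf2 u).coeFn_toLp, (hg2 u).coeFn_toLp] with y h1 h2
    rw [h1, h2]
  simp_rw [h]
  exact (StronglyMeasurable.integral_kernel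
    (hf.inner hg).stronglyMeasurable).measurable

/-- An integrable function whose integrals over the members of a generating algebra vanish is
almost everywhere zero. -/
theorem ae_eq_zero_of_forall_mem_algebra {τ : Measure Y} {𝒜 : Set (Set Y)} (h𝒜 : IsSetAlgebra 𝒜)
    (hgen : ‹MeasurableSpace Y› = .generateFrom 𝒜) {g : Y → ℂ} (hg : Integrable g τ)
    (h0 : ∀ A ∈ 𝒜, ∫ y in A, g y ∂τ = 0) : g =ᵐ[τ] 0 := by
  have htot : ∫ y, g y ∂τ = 0 := by
    rw [← setIntegral_univ, ← compl_empty]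
    exact h0 _ (h𝒜.compl_mem h𝒜.empty_mem)
  have key : ∀ s, MeasurableSet s → ∫ y in s, g y ∂τ = 0 := by
    intro s hs
    induction s, hs using MeasurableSpace.induction_on_inter hgen
      (fun s hs t ht _ => h𝒜.inter_mem hs ht) with
    | empty => simp
    | basic A hA => exact h0 A hA
    | compl A hA ih =>
      have := integral_add_compl hA hg
      rwa [ih, htot, zero_add] at this
    | iUnion A hd hA ih =>
      rw [integral_iUnion hA hd hg.integrableOn]
      simp [ih]
  exact hg.ae_eq_zero_of_forall_setIntegral_eq_zero fun s hs _ => key s hs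

/-- The indicator functions of the sets `A ∩ C n`, for `A` in a countable algebra that generates
the Borel structure and `C` a cover, are fundamental. -/
theorem exists_isFundamental_l2Bundle [MeasurableSpace.CountablyGenerated Y] {κ : Kernel X Y}
    (hκ : HasFiniteCover κ) : ∃ (f : ℕ → Y → ℂ) (hf2 : ∀ n u, MemLp (f n) 2 (κ u)),
      (∀ n, Measurable (f n)) ∧
      (l2Bundle fun u => κ u).IsFundamental fun n u => (hf2 n u).toLp (f n) := by
  obtain ⟨C, hC, hCu, hCf⟩ := hκ
  obtain ⟨A, hA⟩ : ∃ A : ℕ → Set Y, generateSetAlgebra (MeasurableSpace.countableGeneratingSet Y) =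
      range A := (countable_generateSetAlgebra
        (MeasurableSpace.countable_countableGeneratingSet)).exists_eq_range
    ⟨∅, isSetAlgebra_generateSetAlgebra.empty_mem⟩
  have hgen : ‹MeasurableSpace Y› = .generateFrom (range A) := by
    rw [← hA, generateFrom_generateSetAlgebra_eq, MeasurableSpace.generateFrom_countableGeneratingSet]
  have hAm : ∀ i, MeasurableSet (A i) := fun i => by
    rw [hgen]; exact MeasurableSpace.measurableSet_generateFrom (mem_range_self i)
  have hAC : ∀ n : ℕ, MeasurableSet (A n.unpair.1 ∩ C n.unpair.2) := fun n => (hAm _).inter (hC _)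
  have hACf : ∀ u (n : ℕ), κ u (A n.unpair.1 ∩ C n.unpair.2) ≠ ∞ := fun u n =>
    ((measure_mono inter_subset_right).trans_lt (hCf u _)).ne
  let f : ℕ → Y → ℂ := fun n => (A n.unpair.1 ∩ C n.unpair.2).indicator fun _ => 1
  have hf : ∀ n, Measurable (f n) := fun n => measurable_const.indicator (hAC n)
  have hf2 : ∀ n u, MemLp (f n) 2 (κ u) := fun n u =>
    memLp_indicator_const 2 (hAC n) 1 (Or.inr (hACf u n))
  have hdense : ∀ u, Dense (Submodule.span ℂ (range fun n => (hf2 n u).toLp (f n)) :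
      Set (Lp ℂ 2 (κ u))) := by
    intro u
    rw [Submodule.dense_iff_topologicalClosure_eq_top, Submodule.topologicalClosure_eq_top_iff,
      Submodule.eq_bot_iff]
    intro g hg
    have h0 : ∀ n : ℕ, ∫ y in A n.unpair.1 ∩ C n.unpair.2, g y ∂(κ u) = 0 := fun n =>
      (L2.inner_indicatorConstLp_one (hAC n) (hACf u n) g).symm.trans
        ((Submodule.mem_orthogonal _ g).1 hg _ (Submodule.subset_span (mem_range_self n)))
    rw [Lp.eq_zero_iff_ae_eq_zero]
    suffices h : ∀ᵐ y ∂((κ u).restrict (⋃ n, C n)), g y = 0 by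
      rwa [hCu, Measure.restrict_univ] at h
    refine (ae_restrict_iUnion_iff _ _).2 fun k => ?_
    refine ae_eq_zero_of_forall_mem_algebra (hA ▸ isSetAlgebra_generateSetAlgebra) hgen
      (integrableOn_Lp_of_measure_ne_top g (by norm_num) (hCf u k).ne) ?_
    rintro _ ⟨i, rfl⟩
    rw [Measure.restrict_restrict (hAm i)]
    simpa using h0 (Nat.pair i k)
  refine ⟨f, hf2, hf, fun m n => measurable_inner_toLp κ (hf m) (hf n) _ _,
    hdense, fun ξ => ⟨fun h n => h _ (hf n) (hf2 n), fun h g hg hg2 => ?_⟩⟩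
  exact measurable_inner_of_fundamental (V := fun u => Lp ℂ 2 (κ u))
    (fun m n => measurable_inner_toLp κ (hf m) (hf n) (hf2 m) (hf2 n)) hdense
    (fun n => measurable_inner_toLp κ (hf n) hg (hf2 n) hg2) h

end L2Bundle

/-! ### Borel homomorphisms and tensor products of representations -/

section Representations

variable {X : Type u} [Groupoid.{v} X]

section Tensor

variable [MeasurableSpace X]

/-- A simple tensor, as an element of a fibre of the tensor product of two representations. -/
def HilbertRep.tmul (L : HilbertRep.{u, v, w} X) (L' : HilbertRep.{u, v, w'} X) {u : X}
    (x : L.Fiber u) (y : L'.Fiber u) : (L.tensor L').Fiber u := tmulC x y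

variable {L : HilbertRep.{u, v, w} X} {L' : HilbertRep.{u, v, w'} X}

theorem HilbertRep.inner_tmul {u : X} (x x' : L.Fiber u) (y y' : L'.Fiber u) :
    ⟪L.tmul L' x y, L.tmul L' x' y'⟫_ℂ = ⟪x, x'⟫_ℂ * ⟪y, y'⟫_ℂ := inner_tmulC x x' y y'

theorem HilbertRep.tensor_op_tmul {u v : X} (g : u ⟶ v) (x : L.Fiber u) (y : L'.Fiber u) :
    (L.tensor L').op g (L.tmul L' x y) = L.tmul L' (L.op g x) (L'.op g y) :=
  completionMap_coe _ _

theorem HilbertRep.tensor_ext {K : Type*} [NormedAddCommGroup K] [NormedSpace ℂ K] {u : X}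
    {f g : (L.tensor L').Fiber u →ₗᵢ[ℂ] K}
    (h : ∀ x y, f (L.tmul L' x y) = g (L.tmul L' x y)) (z) : f z = g z :=
  completion_tensor_ext (F := L.Fiber u) (G := L'.Fiber u) (f := f) (g := g) h z

theorem HilbertRep.isFundamental_tensor {f : ℕ → ∀ u, L.Fiber u} {f' : ℕ → ∀ u, L'.Fiber u}
    (hf : L.IsFundamental f) (hf' : L'.IsFundamental f') :
    (L.tensor L').IsFundamental fun n u => L.tmul L' (f n.unpair.1 u) (f' n.unpair.2 u) := by
  have hd : ∀ u, Dense (Submodule.span ℂ (Set.range fun n : ℕ =>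
      L.tmul L' (f n.unpair.1 u) (f' n.unpair.2 u)) : Set ((L.tensor L').Fiber u)) := by
    intro u
    have h := dense_span_tmulC (hf.dense u) (hf'.dense u)
    rwa [← Nat.pairEquiv.symm.surjective.range_comp] at h
  have hm : ∀ (ξ : ∀ u, L.Fiber u) (η : ∀ u, L'.Fiber u), L.IsBorelSection ξ →
      L'.IsBorelSection η → ∀ n : ℕ, Measurable fun u =>
        ⟪L.tmul L' (f n.unpair.1 u) (f' n.unpair.2 u), L.tmul L' (ξ u) (η u)⟫_ℂ := by
    intro ξ η hξ hη n
    simp_rw [HilbertRep.inner_tmul]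
    exact (hf.measurable_inner_sections (hf.isBorelSection _) hξ).mul
      (hf'.measurable_inner_sections (hf'.isBorelSection _) hη)
  refine ⟨fun m n => hm _ _ (hf.isBorelSection _) (hf'.isBorelSection _) m, hd, fun Ξ =>
    ⟨fun h n => h _ _ (hf.isBorelSection _) (hf'.isBorelSection _), fun h ξ η hξ hη => ?_⟩⟩
  exact measurable_inner_of_fundamental (V := (L.tensor L').Fiber)
    (f := fun n u => L.tmul L' (f n.unpair.1 u) (f' n.unpair.2 u))
    (fun m n => hm _ _ (hf.isBorelSection _) (hf'.isBorelSection _) m) hd (hm ξ η hξ hη) h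

end Tensor

variable [MeasurableSpace X] [MeasurableSpace (Arr X)]

/-- A homomorphism is Borel as soon as its coefficients with respect to one fundamental sequence
are Borel: `g ↦ L_g f_n(s(g))` is again fundamental for the bundle pulled back along the range
map. -/
theorem HilbertRep.isBorelHom_of_isFundamental {L : HilbertRep.{u, v, w} X}
    (hs : Measurable fun g : Arr X => g.left) (hr : Measurable fun g : Arr X => g.right)
    {f : ℕ → ∀ u, L.Fiber u} (hf : L.IsFundamental f)
    (map_id : ∀ (u : X) (ξ : L.Fiber u), L.op (𝟙 u) ξ = ξ)
    (map_comp : ∀ {u v w : X} (h : u ⟶ v) (g : v ⟶ w) (ξ : L.Fiber u),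
      L.op (h ≫ g) ξ = L.op g (L.op h ξ))
    (hm : ∀ m n, Measurable fun g : Arr X => ⟪f m g.right, L.op g.hom (f n g.left)⟫_ℂ) :
    L.IsBorelHom where
  bundle := hf.isBorel
  surjective {u v} g ξ := ⟨L.op (Groupoid.inv g) ξ, by
    rw [← map_comp, Groupoid.inv_comp, map_id]⟩
  map_id := map_id
  map_comp := map_comp
  borel ξ η hξ hη := by
    have hsurj : ∀ g : Arr X, Function.Surjective (L.op g.hom) := fun g ζ =>
      ⟨L.op (Groupoid.inv g.hom) ζ, by rw [← map_comp, Groupoid.inv_comp, map_id]⟩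
    have h1 : ∀ n, Measurable fun g : Arr X => ⟪η g.right, L.op g.hom (f n g.left)⟫_ℂ := fun n =>
      measurable_inner_of_fundamental (V := fun g : Arr X => L.Fiber g.right)
        (f := fun m g => f m g.right) (fun m k => (hf.measurable_inner m k).comp hr)
        (fun g => hf.dense g.right) (fun m => ((hf.isBorelSection_iff _).1 hη m).comp hr)
        fun m => hm m n
    refine measurable_inner_of_fundamental (V := fun g : Arr X => L.Fiber g.right)
      (f := fun m g => L.op g.hom (f m g.left)) (fun m k => ?_)
      (fun g => dense_span_map _ (hsurj g) (hf.dense g.left))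
      (fun n => measurable_inner_comm (h1 n)) fun n => ?_
    · simp only [LinearIsometry.inner_map_map]
      exact (hf.measurable_inner m k).comp hs
    · simp only [LinearIsometry.inner_map_map]
      exact ((hf.isBorelSection_iff _).1 hξ n).comp hs

/-- Borel homomorphisms are transported by isomorphisms of Borel Hilbert bundles. -/
theorem HilbertRep.IsBorelHom.of_intertwiner {L : HilbertRep.{u, v, w} X}
    {L' : HilbertRep.{u, v, w'} X} (hL : L.IsBorelHom) (U : ∀ u, L.Fiber u ≃ₗᵢ[ℂ] L'.Fiber u)
    (hU : ∀ ξ : ∀ u, L.Fiber u, L.IsBorelSection ξ ↔ L'.IsBorelSection fun u => U u (ξ u))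
    (hop : ∀ {u v : X} (g : u ⟶ v) (ξ : L.Fiber u), U v (L.op g ξ) = L'.op g (U u ξ)) :
    L'.IsBorelHom where
  bundle := by
    obtain ⟨f, hf⟩ := hL.bundle.exists_isFundamental
    exact (hf.map U hU).isBorel
  surjective {u v} g ξ := by
    obtain ⟨ζ, hζ⟩ := hL.surjective g ((U v).symm ξ)
    exact ⟨U u ζ, by rw [← hop, hζ, (U v).apply_symm_apply]⟩
  map_id u ξ := by
    obtain ⟨ζ, rfl⟩ := (U u).surjective ξ
    rw [← hop, hL.map_id]
  map_comp {u v w} h g ξ := by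
    obtain ⟨ζ, rfl⟩ := (U u).surjective ξ
    rw [← hop, ← hop, ← hop, hL.map_comp]
  borel ξ η hξ hη := by
    have key : ∀ ξ : ∀ u, L'.Fiber u, L'.IsBorelSection ξ →
        L.IsBorelSection fun u => (U u).symm (ξ u) := fun ξ hξ => by
      rw [hU]
      simpa only [LinearIsometryEquiv.apply_symm_apply] using hξ
    convert hL.borel _ _ (key ξ hξ) (key η hη) using 2 with g
    rw [← (U g.right).inner_map_map, (U g.right).apply_symm_apply, hop,
      (U g.left).apply_symm_apply]

theorem HilbertRep.IsBorelHom.tensor {L : HilbertRep.{u, v, w} X} {L' : HilbertRep.{u, v, w'} X}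
    (hs : Measurable fun g : Arr X => g.left) (hr : Measurable fun g : Arr X => g.right)
    (hL : L.IsBorelHom) (hL' : L'.IsBorelHom) : (L.tensor L').IsBorelHom := by
  obtain ⟨f, hf⟩ := hL.bundle.exists_isFundamental
  obtain ⟨f', hf'⟩ := hL'.bundle.exists_isFundamental
  refine HilbertRep.isBorelHom_of_isFundamental hs hr (HilbertRep.isFundamental_tensor hf hf')
    (fun u ξ => ?_) (fun {u v w} h g ξ => ?_) fun m n => ?_
  · refine HilbertRep.tensor_ext (f := (L.tensor L').op (𝟙 u)) (g := LinearIsometry.id)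
      (fun x y => ?_) ξ
    rw [HilbertRep.tensor_op_tmul, hL.map_id, hL'.map_id, LinearIsometry.id_apply]
  · refine HilbertRep.tensor_ext (f := (L.tensor L').op (h ≫ g))
      (g := ((L.tensor L').op g).comp ((L.tensor L').op h)) (fun x y => ?_) ξ
    change _ = (L.tensor L').op g ((L.tensor L').op h _)
    rw [HilbertRep.tensor_op_tmul, HilbertRep.tensor_op_tmul,
      HilbertRep.tensor_op_tmul, hL.map_comp, hL'.map_comp]
  · simp_rw [HilbertRep.tensor_op_tmul, HilbertRep.inner_tmul]
    exact (hL.borel _ _ (hf.isBorelSection n.unpair.1) (hf.isBorelSection m.unpair.1)).mul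
      (hL'.borel _ _ (hf'.isBorelSection n.unpair.2) (hf'.isBorelSection m.unpair.2))

end Representations

/-! ### The regular and the quasi-regular representation -/

section Translation

variable {X : Type u} [Groupoid.{v} X]

theorem lmul_id (u : X) (x : Arr X) : lmul (𝟙 u) x = x := by
  by_cases h : x.right = u
  · subst h
    rw [lmul_of_eq _ _ rfl]
    simp
  · exact lmul_of_ne _ _ h

theorem lmul_comp {u v w : X} (h : u ⟶ v) (g : v ⟶ w) (x : Arr X) (hx : x.right = u) :
    lmul (h ≫ g) x = lmul g (lmul h x) := by
  subst hx
  rw [lmul_of_eq _ _ rfl, lmul_of_eq h _ rfl, lmul_of_eq g _ rfl]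
  simp

theorem inv_comp_eq {u v w : X} (h : u ⟶ v) (g : v ⟶ w) :
    Groupoid.inv (h ≫ g) = Groupoid.inv g ≫ Groupoid.inv h := by
  simp [Groupoid.inv_eq_inv]

theorem inv_id_eq (u : X) : Groupoid.inv (𝟙 u) = 𝟙 u := by
  simp [Groupoid.inv_eq_inv]

theorem inv_inv_eq {u v : X} (g : u ⟶ v) : Groupoid.inv (Groupoid.inv g) = g := by
  simp [Groupoid.inv_eq_inv]

variable [TopologicalSpace (Arr X)] (H : ClosedSubgroupoid X)

theorem ClosedSubgroupoid.act_id (u : X) (y : H.Quo) : H.act (𝟙 u) y = y := by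
  induction y using Quotient.inductionOn with
  | h x => exact congrArg H.coset (lmul_id u x)

theorem ClosedSubgroupoid.act_comp {u v w : X} (h : u ⟶ v) (g : v ⟶ w) (y : H.Quo)
    (hy : H.anchor y = u) : H.act (h ≫ g) y = H.act g (H.act h y) := by
  induction y using Quotient.inductionOn with
  | h x => exact congrArg H.coset (lmul_comp h g x hy)

end Translation

section Regular

variable {X : Type u} [Groupoid.{v} X] [TopologicalSpace X] [MeasurableSpace X]
  [BorelSpace X] [TopologicalSpace (Arr X)] [MeasurableSpace (Arr X)] [BorelSpace (Arr X)]
  [LocallyCompactGroupoid X]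

variable (X) in
theorem measurable_left : Measurable fun g : Arr X => g.left :=
  (LocallyCompactGroupoid.continuous_source (X := X)).measurable

variable (X) in
theorem measurable_right : Measurable fun g : Arr X => g.right :=
  (LocallyCompactGroupoid.continuous_range (X := X)).measurable

omit [MeasurableSpace X] [BorelSpace X] in
variable (X) in
theorem measurable_inv : Measurable (Arr.inv : Arr X → Arr X) :=
  (LocallyCompactGroupoid.continuous_inv (X := X)).measurable

variable (haar : HaarSystem X)

/-- The operators of the regular representation, with the `L²`-spaces spelled out. -/
def regularOp {u v : X} (g : u ⟶ v) : Lp ℂ 2 (haar.meas u) →ₗᵢ[ℂ] Lp ℂ 2 (haar.meas v) :=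
  (regularRep haar).op g

omit [BorelSpace X] in
theorem regularOp_coe {u v : X} (g : u ⟶ v) (ξ : Lp ℂ 2 (haar.meas u)) :
    regularOp haar g ξ =ᵐ[haar.meas v] fun x => ξ (lmul (Groupoid.inv g) x) :=
  Lp.coeFn_compMeasurePreserving ξ (measurePreserving_lmul haar (Groupoid.inv g))

omit [BorelSpace X] in
theorem regularOp_toLp_coe {u v : X} (g : u ⟶ v) {f : Arr X → ℂ} (hf2 : MemLp f 2 (haar.meas u)) :
    regularOp haar g (hf2.toLp f) =ᵐ[haar.meas v] fun x => f (lmul (Groupoid.inv g) x) :=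
  (regularOp_coe haar g _).trans
    ((measurePreserving_lmul haar (Groupoid.inv g)).quasiMeasurePreserving.ae hf2.coeFn_toLp)

theorem exists_isFundamental_regularRep :
    ∃ (f : ℕ → Arr X → ℂ) (hf2 : ∀ n u, MemLp (f n) 2 (haar.meas u)), (∀ n, Measurable (f n)) ∧
      (regularRep haar).IsFundamental fun n u => (hf2 n u).toLp (f n) :=
  exists_isFundamental_l2Bundle haar.hasFiniteCover

theorem isBorelHom_regularRep : (regularRep haar).IsBorelHom := by
  obtain ⟨f, hf2, hf, hfund⟩ := exists_isFundamental_regularRep haar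
  refine HilbertRep.isBorelHom_of_isFundamental (measurable_left X) (measurable_right X) hfund
    (fun u ξ => ?_) (fun {u v w} h g ξ => ?_) fun m n => ?_
  · refine Lp.ext (μ := haar.meas u) ((regularOp_coe haar (𝟙 u) ξ).trans
      (Filter.Eventually.of_forall fun x => ?_))
    simp only [inv_id_eq, lmul_id]
  · refine Lp.ext (μ := haar.meas w) ((regularOp_coe haar (h ≫ g) ξ).trans
      (Filter.EventuallyEq.symm ((regularOp_coe haar g _).trans ?_)))
    have h1 := (measurePreserving_lmul haar (Groupoid.inv g)).quasiMeasurePreserving.ae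
      (regularOp_coe haar h ξ)
    filter_upwards [h1, haar.range_eq_ae w] with x hx hw
    rw [inv_comp_eq, lmul_comp _ _ x hw]
    exact hx
  · have := haar.hasFiniteCover.hasFiniteDensity.isSFiniteKernel
    have hint : Measurable fun p : Arr X × Arr X =>
        ⟪f m p.2, f n (lmul (Groupoid.inv p.1.hom) p.2)⟫_ℂ :=
      ((hf m).comp measurable_snd).inner ((hf n).comp (measurable_lmul_prod.comp
        (((measurable_inv X).comp measurable_fst).prodMk measurable_snd)))
    convert (StronglyMeasurable.integral_kernel_prod_right'
      (κ := haar.kernel.comap _ (measurable_right X)) hint.stronglyMeasurable).measurable using 2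
      with g
    refine (L2.inner_def _ _).trans (integral_congr_ae ?_)
    filter_upwards [(hf2 m g.right).coeFn_toLp, regularOp_toLp_coe haar g.hom (hf2 n g.left)]
      with x hx1 hx2
    rw [hx1]
    exact congrArg (fun z => ⟪f m x, z⟫_ℂ) hx2

namespace QuotientMeasure

variable {haar} {H : ClosedSubgroupoid X} {μ : Measure X} (m : QuotientMeasure H haar μ)

omit [BorelSpace X] in
theorem lintegral_deriv_mul_right {u v : X} (g : u ⟶ v) {ψ : H.Quo → ℝ≥0∞} (hψ : Measurable ψ) :
    ∫⁻ y, m.deriv g y * ψ y ∂(m.fiber v) = ∫⁻ y, ψ (H.act g y) ∂(m.fiber u) :=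
  (lintegral_rnDeriv_mul (m.translate_ac g) hψ.aemeasurable).trans
    (lintegral_map hψ (H.measurable_act g))

omit [BorelSpace X] [BorelSpace (Arr X)] in
theorem deriv_id (u : X) : m.deriv (𝟙 u) =ᵐ[m.fiber u] 1 := by
  have h : (m.fiber u).map (H.act (𝟙 u)) = m.fiber u := by
    rw [show H.act (𝟙 u) = id from funext (H.act_id u), Measure.map_id]
  rw [deriv, h]
  exact Measure.rnDeriv_self _

omit [BorelSpace X] in
/-- The cocycle identity of the Radon–Nikodym derivatives. -/
theorem deriv_comp {u v w : X} (h : u ⟶ v) (g : v ⟶ w) :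
    m.deriv (h ≫ g) =ᵐ[m.fiber w] fun y => m.deriv g y * m.deriv h (H.act (Groupoid.inv g) y) := by
  have hd := (m.measurable_deriv h).comp (H.measurable_act (Groupoid.inv g))
  refine ae_eq_of_forall_setLIntegral_eq_of_sigmaFinite (m.measurable_deriv _)
    ((m.measurable_deriv g).mul hd) fun A hA _ => ?_
  let ψ : H.Quo → ℝ≥0∞ := A.indicator 1
  have hψ : Measurable ψ := measurable_one.indicator hA
  have hA' : ∀ F : H.Quo → ℝ≥0∞, ∫⁻ y in A, F y ∂(m.fiber w) =
      ∫⁻ y, F y * ψ y ∂(m.fiber w) := fun F => by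
    rw [← lintegral_indicator hA]
    refine lintegral_congr fun y => ?_
    by_cases hy : y ∈ A <;> simp [ψ, hy]
  rw [hA', hA', m.lintegral_deriv_mul_right _ hψ]
  simp_rw [mul_assoc]
  refine Eq.trans ?_ (m.lintegral_deriv_mul_right g (hd.mul hψ)).symm
  have h1 : ∫⁻ z, m.deriv h (H.act (Groupoid.inv g) (H.act g z)) * ψ (H.act g z) ∂(m.fiber v) =
      ∫⁻ z, m.deriv h z * ψ (H.act g z) ∂(m.fiber v) := by
    refine lintegral_congr_ae ?_
    filter_upwards [m.act_inv_act_ae g] with z hz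
    rw [hz]
  refine Eq.trans ?_ h1.symm
  refine Eq.trans ?_ (m.lintegral_deriv_mul_right h (hψ.comp (H.measurable_act g))).symm
  refine lintegral_congr_ae ?_
  filter_upwards [m.carried u] with y hy
  rw [H.act_comp h g y hy]
  rfl

omit [BorelSpace X] in
theorem sqrtDeriv_comp {u v w : X} (h : u ⟶ v) (g : v ⟶ w) :
    m.sqrtDeriv (h ≫ g) =ᵐ[m.fiber w]
      fun y => m.sqrtDeriv g y * m.sqrtDeriv h (H.act (Groupoid.inv g) y) := by
  filter_upwards [m.deriv_comp h g] with y hy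
  rw [sqrtDeriv, hy, ENNReal.toReal_mul, Real.sqrt_mul ENNReal.toReal_nonneg]
  rfl

omit [BorelSpace X] in
theorem koopmanOp_coe {u v : X} (g : u ⟶ v) (ξ : Lp ℂ 2 (m.fiber u)) :
    m.koopmanOp g ξ =ᵐ[m.fiber v] m.koopmanFun g ξ :=
  (m.memLp_koopmanFun g ξ).coeFn_toLp

omit [BorelSpace X] in
theorem koopmanOp_toLp_coe {u v : X} (g : u ⟶ v) {f : H.Quo → ℂ} (hf : Measurable f)
    (hf2 : MemLp f 2 (m.fiber u)) :
    m.koopmanOp g (hf2.toLp f) =ᵐ[m.fiber v] m.koopmanFun g f :=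
  (m.koopmanOp_coe g _).trans
    (m.koopmanFun_congr g (Lp.stronglyMeasurable _).measurable hf hf2.coeFn_toLp)

/-- The Radon–Nikodym derivatives `D(g⁻¹, y)` can be chosen jointly measurable in `g` and `y`. -/
theorem exists_measurable_deriv (haarH : HaarSystem H.Obj) :
    ∃ D : Arr X × H.Quo → ℝ≥0∞, Measurable D ∧
      ∀ g : Arr X, (fun y => D (g, y)) =ᵐ[m.fiber g.right] m.deriv g.hom := by
  have := H.borelSpace_quo haarH
  have := H.secondCountableTopology_quo haarH
  have hT := H.measurable_act_prod haarH
  have hS : Measurable fun p : Arr X × H.Quo => H.act (Groupoid.inv p.1.hom) p.2 :=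
    hT.comp (((measurable_inv X).comp measurable_fst).prodMk measurable_snd)
  have hd := (m.hasFiniteCover haarH).hasFiniteDensity
  have hs := hd.comap (measurable_left X)
  have := hs.isSFiniteKernel
  exact (hs.mapFamily hT hS fun g => m.act_inv_act_ae g.hom).exists_measurable_rnDeriv
    (hd.comap (measurable_right X)) fun g => m.translate_ac g.hom

omit [BorelSpace X] in
theorem exists_isFundamental_quasiRegularRep (haarH : HaarSystem H.Obj) :
    ∃ (f : ℕ → H.Quo → ℂ) (hf2 : ∀ n u, MemLp (f n) 2 (m.fiber u)), (∀ n, Measurable (f n)) ∧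
      m.quasiRegularRep.IsFundamental fun n u => (hf2 n u).toLp (f n) := by
  have := H.borelSpace_quo haarH
  have := H.secondCountableTopology_quo haarH
  exact exists_isFundamental_l2Bundle (m.hasFiniteCover haarH)

theorem isBorelHom_quasiRegularRep (haarH : HaarSystem H.Obj) :
    m.quasiRegularRep.IsBorelHom := by
  obtain ⟨f, hf2, hf, hfund⟩ := m.exists_isFundamental_quasiRegularRep haarH
  refine HilbertRep.isBorelHom_of_isFundamental (measurable_left X) (measurable_right X) hfund
    (fun u ξ => ?_) (fun {u v w} h g ξ => ?_) fun k n => ?_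
  · refine Lp.ext (μ := m.fiber u) ((m.koopmanOp_coe (𝟙 u) ξ).trans ?_)
    filter_upwards [m.deriv_id u] with y hy
    simp only [koopmanFun, sqrtDeriv, hy, inv_id_eq, H.act_id]
    simp
  · refine Lp.ext (μ := m.fiber w) ((m.koopmanOp_coe (h ≫ g) ξ).trans
      (Filter.EventuallyEq.symm ((m.koopmanOp_coe g _).trans ?_)))
    have hξ := (Lp.stronglyMeasurable (μ := m.fiber u) ξ).measurable
    refine (m.koopmanFun_congr g (Lp.stronglyMeasurable _).measurable
      (m.measurable_koopmanFun h hξ) (m.koopmanOp_coe h ξ)).trans ?_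
    filter_upwards [m.sqrtDeriv_comp h g, m.carried w] with y hy hw
    simp only [koopmanFun, hy, inv_comp_eq, H.act_comp _ _ y hw, smul_eq_mul]
    push_cast
    ring
  · obtain ⟨D, hD, hDe⟩ := m.exists_measurable_deriv haarH
    have := (m.hasFiniteCover haarH).hasFiniteDensity.isSFiniteKernel
    have hint : Measurable fun p : Arr X × H.Quo =>
        ⟪f k p.2, ((√(D p).toReal : ℝ) : ℂ) • f n (H.act (Groupoid.inv p.1.hom) p.2)⟫_ℂ :=
      ((hf k).comp measurable_snd).inner
        ((Complex.measurable_ofReal.comp hD.ennreal_toReal.sqrt).smul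
          ((hf n).comp ((H.measurable_act_prod haarH).comp
            (((measurable_inv X).comp measurable_fst).prodMk measurable_snd))))
    convert (StronglyMeasurable.integral_kernel_prod_right'
      (κ := m.fiber.comap _ (measurable_right X)) hint.stronglyMeasurable).measurable using 2
      with g
    refine (L2.inner_def _ _).trans (integral_congr_ae ?_)
    filter_upwards [(hf2 k g.right).coeFn_toLp, m.koopmanOp_toLp_coe g.hom (hf n) (hf2 n g.left),
      hDe g] with y hy1 hy2 hy3
    rw [hy1]
    refine congrArg (fun z => ⟪f k y, z⟫_ℂ) (hy2.trans ?_)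
    rw [koopmanFun, sqrtDeriv, ← hy3]

end QuotientMeasure

end Regular

/-! ### Vector-valued square integrable functions -/

section VectorValued

variable {Y : Type*} [MeasurableSpace Y]

/-- A function with values in a Hilbert space is strongly measurable if its inner products with a
sequence that spans a dense subspace are measurable. -/
theorem stronglyMeasurable_of_inner {V : Type*} [NormedAddCommGroup V] [InnerProductSpace ℂ V]
    {e : ℕ → V} (he : Dense (Submodule.span ℂ (Set.range e) : Set V)) {φ : Y → V}
    (hφ : ∀ n, Measurable fun y => ⟪e n, φ y⟫_ℂ) : StronglyMeasurable φ := by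
  have hsep : TopologicalSpace.SeparableSpace V := by
    have h := ((Set.countable_range e).isSeparable.span (R := ℂ)).closure
    rw [he.closure_eq] at h
    exact TopologicalSpace.isSeparable_univ_iff.1 h
  have : SecondCountableTopology V := UniformSpace.secondCountable_of_separable V
  borelize V
  have hb : TopologicalSpace.IsTopologicalBasis {B : Set V | ∃ z r, B = Metric.ball z r} := by
    refine TopologicalSpace.isTopologicalBasis_of_isOpen_of_nhds ?_ fun z U hz hU => ?_
    · rintro _ ⟨z, r, rfl⟩
      exact Metric.isOpen_ball
    · obtain ⟨r, hr, hrU⟩ := Metric.isOpen_iff.1 hU z hz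
      exact ⟨_, ⟨z, r, rfl⟩, Metric.mem_ball_self hr, hrU⟩
  have hm : Measurable φ := by
    rw [BorelSpace.measurable_eq (α := V), hb.borel_eq_generateFrom]
    refine measurable_generateFrom ?_
    rintro _ ⟨z, r, rfl⟩
    have h := measurable_norm_sq_of_fundamental (V := fun _ : Y => V) (f := fun n _ => e n)
      (fun m n => measurable_const) (fun _ => he) (ξ := fun y => φ y - z) fun n => by
        simp only [inner_sub_right]
        exact (hφ n).sub measurable_const
    have e : φ ⁻¹' Metric.ball z r = {y | √(‖φ y - z‖ ^ 2) < r} := by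
      ext y
      rw [Set.mem_preimage, mem_ball_iff_norm, Set.mem_ofPred_eq, Real.sqrt_sq (norm_nonneg _)]
    rw [e]
    exact measurableSet_lt h.sqrt measurable_const
  exact hm.stronglyMeasurable

variable (V : Type*) [NormedAddCommGroup V] [InnerProductSpace ℂ V] (τ : Measure Y)

/-- The linear map `V ⊗ L²(τ) → L²(τ; V)` with `v ⊗ f ↦ (y ↦ f(y) v)`. -/
def tensorLpₗ : V ⊗[ℂ] Lp ℂ 2 τ →ₗ[ℂ] Lp V 2 τ :=
  TensorProduct.lift (ContinuousLinearMap.compLpₗ₂ 2 τ (ContinuousLinearMap.lsmul ℂ ℂ).flip)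

variable {V τ}

theorem tensorLpₗ_tmul (v : V) (f : Lp ℂ 2 τ) :
    tensorLpₗ V τ (v ⊗ₜ f) =ᵐ[τ] fun y => f y • v :=
  ContinuousLinearMap.coeFn_compLp' ((ContinuousLinearMap.lsmul ℂ ℂ).flip v) f

theorem inner_tensorLpₗ (a b : V ⊗[ℂ] Lp ℂ 2 τ) :
    ⟪tensorLpₗ V τ a, tensorLpₗ V τ b⟫_ℂ = ⟪a, b⟫_ℂ := by
  induction a using TensorProduct.induction_on with
  | zero => simp
  | add a a' h h' => rw [map_add, inner_add_left, inner_add_left, h, h']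
  | tmul v f =>
    induction b using TensorProduct.induction_on with
    | zero => simp
    | add b b' h h' => rw [map_add, inner_add_right, inner_add_right, h, h']
    | tmul v' f' =>
      rw [TensorProduct.inner_tmul, L2.inner_def, L2.inner_def, ← integral_const_mul]
      refine integral_congr_ae ?_
      filter_upwards [tensorLpₗ_tmul v f, tensorLpₗ_tmul v' f'] with y h h'
      rw [h, h', inner_smul_left, inner_smul_right]
      simp only [RCLike.inner_apply]
      ring

variable (V τ) in
/-- The isometry `V ⊗ L²(τ) → L²(τ; V)` with `v ⊗ f ↦ (y ↦ f(y) v)`. -/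
def tensorLp : V ⊗[ℂ] Lp ℂ 2 τ →ₗᵢ[ℂ] Lp V 2 τ :=
  (tensorLpₗ V τ).isometryOfInner inner_tensorLpₗ

theorem denseRange_tensorLp : DenseRange (tensorLp V τ) := by
  intro F
  refine Lp.induction (by norm_num) (motive := fun F => F ∈ closure (Set.range (tensorLp V τ)))
    (fun c s hs hμs => subset_closure ?_) (fun f g hf hg _ h h' => ?_) isClosed_closure F
  · refine ⟨c ⊗ₜ indicatorConstLp 2 hs hμs.ne 1, Lp.ext ((tensorLpₗ_tmul c _).trans ?_)⟩
    rw [Lp.simpleFunc.coe_indicatorConst]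
    filter_upwards [indicatorConstLp_coeFn (p := 2) (hs := hs) (hμs := hμs.ne) (c := (1 : ℂ)),
      indicatorConstLp_coeFn (p := 2) (hs := hs) (hμs := hμs.ne) (c := c)] with y h1 h2
    rw [h1, h2]
    by_cases hy : y ∈ s <;> simp [hy]
  · have := (LinearMap.range (tensorLp V τ).toLinearMap).topologicalClosure.add_mem h h'
    exact this

variable [CompleteSpace V]

variable (V τ) in
/-- The Hilbert space tensor product of `V` and `L²(τ)` is `L²(τ; V)`. -/
def tensorLpEquiv : UniformSpace.Completion (V ⊗[ℂ] Lp ℂ 2 τ) ≃ₗᵢ[ℂ] Lp V 2 τ :=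
  completionEquiv (tensorLp V τ) denseRange_tensorLp

theorem tensorLpEquiv_tmulC (v : V) (f : Lp ℂ 2 τ) :
    tensorLpEquiv V τ (tmulC v f) =ᵐ[τ] fun y => f y • v := by
  have h : tensorLpEquiv V τ (tmulC v f) = tensorLp V τ (v ⊗ₜ f) := completionEquiv_coe _ _ _
  rw [h]
  exact tensorLpₗ_tmul v f

end VectorValued

/-! ### Equivalences from intertwining unitaries -/

section Equivalences

variable {X : Type u} [Groupoid.{v} X] [TopologicalSpace X] [MeasurableSpace X]
  [TopologicalSpace (Arr X)] [MeasurableSpace (Arr X)]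

theorem Equivalent.symm {haar : HaarSystem X} {μ : Measure X} {L : HilbertRep.{u, v, w} X}
    {L' : HilbertRep.{u, v, w'} X} (h : Equivalent haar μ L L') : Equivalent haar μ L' L := by
  obtain ⟨hL, hL', U, hU, hop⟩ := h
  refine ⟨hL', hL, fun u => (U u).symm, fun ξ => ?_, fun {u v} g ξ => ?_⟩
  · rw [hU]
    simp only [LinearIsometryEquiv.apply_symm_apply]
  · rw [LinearIsometryEquiv.symm_apply_eq, hop, LinearIsometryEquiv.apply_symm_apply]

end Equivalences

/-! ### The induced representation of a restriction -/

section Sections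

variable {X : Type u}

open Classical in
/-- The section with value `z` at `u` and `0` elsewhere. -/
def HilbertBundle.single (E : HilbertBundle.{u, w} X) (u : X) (z : E.Fiber u) (v : X) : E.Fiber v :=
  if h : v = u then h ▸ z else 0

theorem HilbertBundle.single_self (E : HilbertBundle.{u, w} X) (u : X) (z : E.Fiber u) :
    E.single u z u = z := by simp [single]

theorem HilbertBundle.single_of_ne (E : HilbertBundle.{u, w} X) {u v : X} (z : E.Fiber u)
    (h : v ≠ u) : E.single u z v = 0 := by simp [single, h]

end Sections

section Operators

variable {X : Type u} [Groupoid.{v} X] [MeasurableSpace X] [MeasurableSpace (Arr X)]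
  {L : HilbertRep.{u, v, w} X}

theorem HilbertRep.IsBorelHom.op_op_inv (hL : L.IsBorelHom) {u v : X} (g : u ⟶ v) (z : L.Fiber v) :
    L.op g (L.op (Groupoid.inv g) z) = z := by
  rw [← hL.map_comp, Groupoid.inv_comp, hL.map_id]

theorem HilbertRep.IsBorelHom.inner_op_inv (hL : L.IsBorelHom) {u v : X} (g : u ⟶ v)
    (y : L.Fiber u) (z : L.Fiber v) : ⟪y, L.op (Groupoid.inv g) z⟫_ℂ = ⟪L.op g y, z⟫_ℂ := by
  rw [← (L.op g).inner_map_map, hL.op_op_inv]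

end Operators

section Equivariant

variable {X : Type u} [Groupoid.{v} X] [TopologicalSpace (Arr X)] {L : HilbertRep.{u, v, w} X}

theorem ClosedSubgroupoid.coset_out (H : ClosedSubgroupoid X) (y : H.Quo) :
    H.coset y.out = y := Quotient.out_eq y

variable {H : ClosedSubgroupoid X}

/-- The equivariant function `x ↦ f(x H) L_x⁻¹ s(r(x))` defined by a section `s` and a function `f`
on `G/H`. It stands for the section `u ↦ s(u) ⊗ f` of `L ⊗ ρ^{G/H}`. -/
def sectionInd (H : ClosedSubgroupoid X) (s : ∀ u, L.Fiber u) (f : H.Quo → ℂ) (x : Arr X) :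
    (L.restrict H).Fiber (H.obj x.left) :=
  f (H.coset x) • L.op (Groupoid.inv x.hom) (s x.right)

theorem norm_sectionInd (s : ∀ u, L.Fiber u) (f : H.Quo → ℂ) (x : Arr X) :
    ‖sectionInd H s f x‖ = ‖f (H.coset x)‖ * ‖s x.right‖ :=
  (norm_smul (β := L.Fiber x.left) _ _).trans (congrArg _ ((L.op _).norm_map _))

open Classical in
/-- The function `x ↦ L_x ξ(x)` on the arrows with range `u`, with values in the fibre of `L` over
`u`; it is extended by zero. It is constant on cosets if `ξ` is equivariant. -/
def transport (u : X) (ξ : ∀ x : Arr X, (L.restrict H).Fiber (H.obj x.left)) (x : Arr X) :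
    L.Fiber u :=
  if h : x.right = u then L.op (x.hom ≫ eqToHom h) (show L.Fiber x.left from ξ x) else 0

theorem transport_right (ξ : ∀ x : Arr X, (L.restrict H).Fiber (H.obj x.left)) (x : Arr X) :
    transport x.right ξ x = L.op x.hom (show L.Fiber x.left from ξ x) := by
  rw [transport, dif_pos rfl, eqToHom_refl, Category.comp_id]

theorem transport_add (u : X) (ξ η : ∀ x : Arr X, (L.restrict H).Fiber (H.obj x.left))
    (x : Arr X) : transport u (ξ + η) x = transport u ξ x + transport u η x := by
  unfold transport
  split_ifs
  · exact map_add (L.op _) _ _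
  · rw [add_zero]

theorem transport_smul (u : X) (c : ℂ) (ξ : ∀ x : Arr X, (L.restrict H).Fiber (H.obj x.left))
    (x : Arr X) : transport u (c • ξ) x = c • transport u ξ x := by
  unfold transport
  split_ifs
  · exact map_smul (L.op _) c _
  · rw [smul_zero]

theorem inner_transport {u : X} (ξ η : ∀ x : Arr X, (L.restrict H).Fiber (H.obj x.left))
    {x : Arr X} (hx : x.right = u) :
    ⟪transport u ξ x, transport u η x⟫_ℂ = ⟪ξ x, η x⟫_ℂ := by
  subst hx
  rw [transport_right, transport_right]
  exact (L.op x.hom).inner_map_map _ _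

theorem norm_transport_le (u : X) (ξ : ∀ x : Arr X, (L.restrict H).Fiber (H.obj x.left))
    (x : Arr X) : ‖transport u ξ x‖ ≤ ‖ξ x‖ := by
  by_cases hx : x.right = u
  · subst hx
    rw [transport_right]
    exact ((L.op x.hom).norm_map _).le
  · rw [transport, dif_neg hx, norm_zero]
    exact norm_nonneg _

end Equivariant

section Induced

variable {X : Type u} [Groupoid.{v} X] [TopologicalSpace X] [MeasurableSpace X]
  [BorelSpace X] [TopologicalSpace (Arr X)] [MeasurableSpace (Arr X)] [BorelSpace (Arr X)]
  [LocallyCompactGroupoid X] {L : HilbertRep.{u, v, w} X} {H : ClosedSubgroupoid X}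

omit [BorelSpace (Arr X)] in
theorem HilbertRep.IsBorelHom.isBorelSection_single (hL : L.IsBorelHom) (u : X) (z : L.Fiber u) :
    L.IsBorelSection (L.single u z) := by
  have := t2Space_unit X
  obtain ⟨f, hf⟩ := hL.bundle.exists_isFundamental
  refine (hf.isBorelSection_iff _).2 fun n => ?_
  have e : (fun v => ⟪f n v, L.single u z v⟫_ℂ) =
      ({u} : Set X).indicator fun _ => ⟪f n u, z⟫_ℂ := by
    ext v
    by_cases h : v = u
    · subst h
      rw [L.single_self, Set.indicator_of_mem (Set.mem_singleton v)]
    · rw [L.single_of_ne z h, Set.indicator_of_notMem (by simpa using h), inner_zero_right]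
  rw [e]
  exact measurable_const.indicator (measurableSet_singleton u)

/-- The coefficients `⟪η(r(x)), L_x ξ(x)⟫` are Borel, for `ξ` defined on arrows. -/
theorem HilbertRep.IsBorelHom.measurable_inner_op (hL : L.IsBorelHom)
    {ξ : ∀ x : Arr X, L.Fiber x.left} (hξ : ∀ f : ∀ u, L.Fiber u, L.IsBorelSection f →
      Measurable fun x : Arr X => ⟪f x.left, ξ x⟫_ℂ)
    {η : ∀ u, L.Fiber u} (hη : L.IsBorelSection η) :
    Measurable fun x : Arr X => ⟪η x.right, L.op x.hom (ξ x)⟫_ℂ := by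
  obtain ⟨f, hf⟩ := hL.bundle.exists_isFundamental
  refine measurable_inner_of_fundamental (V := fun x : Arr X => L.Fiber x.right)
    (f := fun n x => L.op x.hom (f n x.left)) (fun m n => ?_)
    (fun x => dense_span_map _ (hL.surjective x.hom) (hf.dense x.left))
    (fun n => measurable_inner_comm (hL.borel _ _ (hf.isBorelSection n) hη)) fun n => ?_
  · simp only [LinearIsometry.inner_map_map]
    exact (hf.measurable_inner m n).comp (measurable_left X)
  · simp only [LinearIsometry.inner_map_map]
    exact hξ _ (hf.isBorelSection n)

omit [TopologicalSpace X] [BorelSpace X] [BorelSpace (Arr X)] [LocallyCompactGroupoid X] in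
theorem isEquivariant_sectionInd (hL : L.IsBorelHom) {s : ∀ u, L.Fiber u}
    (hs : L.IsBorelSection s) {f : H.Quo → ℂ} (hf : Measurable f) :
    IsEquivariant (L.restrict H) (sectionInd H s f) where
  borel η hη := by
    have h1 : Measurable fun x : Arr X => f (H.coset x) * ⟪L.op x.hom (η x.left), s x.right⟫_ℂ :=
      (hf.comp H.measurable_coset).mul (measurable_inner_comm (hL.borel η s hη hs))
    refine Eq.mp (congrArg Measurable (funext fun x => ?_)) h1
    exact (congrArg _ (hL.inner_op_inv _ _ _).symm).trans
      (inner_smul_right (E := L.Fiber x.left) _ _ _).symm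
  equivariant x a h hh := by
    have hc : H.coset ⟨a, x.right, h ≫ x.hom⟩ = H.coset x :=
      (Quotient.sound (s := H.cosetSetoid) ⟨a, h, hh, rfl⟩).symm
    change f (H.coset ⟨a, x.right, h ≫ x.hom⟩) • L.op (Groupoid.inv (h ≫ x.hom)) (s x.right) =
      L.op (Groupoid.inv h) (f (H.coset x) • L.op (Groupoid.inv x.hom) (s x.right))
    rw [hc, map_smul, inv_comp_eq, hL.map_comp]

omit [TopologicalSpace X] [BorelSpace X] [BorelSpace (Arr X)] [LocallyCompactGroupoid X] in
theorem transport_eq_of_rel (hL : L.IsBorelHom) (u : X)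
    {ξ : ∀ x : Arr X, (L.restrict H).Fiber (H.obj x.left)}
    (hξ : IsEquivariant (L.restrict H) ξ) (x y : Arr X) (hxy : H.Rel x y) :
    transport u ξ x = transport u ξ y := by
  obtain ⟨a, h, hh, rfl⟩ := hxy
  by_cases hx : x.right = u
  · subst hx
    rw [transport_right]
    refine Eq.trans ?_ (transport_right ξ ⟨a, x.right, h ≫ x.hom⟩).symm
    rw [hL.map_comp, hξ.equivariant x h hh]
    exact congrArg (L.op x.hom) (hL.op_op_inv h _).symm
  · rw [transport, dif_neg hx, transport,
      dif_neg (show ¬(⟨a, x.right, h ≫ x.hom⟩ : Arr X).right = u from hx)]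

theorem stronglyMeasurable_transport (hL : L.IsBorelHom) (u : X)
    {ξ : ∀ x : Arr X, (L.restrict H).Fiber (H.obj x.left)}
    (hξ : IsEquivariant (L.restrict H) ξ) :
    StronglyMeasurable fun y : H.Quo => transport u ξ y.out := by
  obtain ⟨f, hf⟩ := hL.bundle.exists_isFundamental
  refine stronglyMeasurable_of_inner (hf.dense u) fun n => ?_
  refine H.measurable_out (φ := fun x => ⟪f n u, transport u ξ x⟫_ℂ)
    (fun x y hxy => by rw [transport_eq_of_rel hL u hξ x y hxy]) ?_
  have e : (fun x => ⟪f n u, transport u ξ x⟫_ℂ) = {x : Arr X | x.right = u}.indicator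
      fun x => ⟪f n x.right, L.op x.hom (show L.Fiber x.left from ξ x)⟫_ℂ := by
    ext x
    by_cases hx : x.right = u
    · rw [Set.indicator_of_mem (show x ∈ {x : Arr X | x.right = u} from hx)]
      subst hx
      rw [transport_right]
    · rw [Set.indicator_of_notMem (show x ∉ {x : Arr X | x.right = u} from hx), transport,
        dif_neg hx, inner_zero_right]
  rw [e]
  exact (hL.measurable_inner_op hξ.borel (hf.isBorelSection n)).indicator
    (measurableSet_range_eq u)

omit [TopologicalSpace X] [BorelSpace X] [BorelSpace (Arr X)] [LocallyCompactGroupoid X] in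
theorem transport_sectionInd (hL : L.IsBorelHom) (s : ∀ u, L.Fiber u) (f : H.Quo → ℂ) {u : X}
    {x : Arr X} (hx : x.right = u) : transport u (sectionInd H s f) x = f (H.coset x) • s u := by
  subst hx
  rw [transport_right]
  refine (map_smul (L.op x.hom) _ _).trans ?_
  rw [hL.op_op_inv]

variable {haar : HaarSystem X} {μ : Measure X} (m : QuotientMeasure H haar μ)

omit [BorelSpace X] [BorelSpace (Arr X)] [LocallyCompactGroupoid X] in
theorem QuotientMeasure.right_out_ae (u : X) :
    ∀ᵐ y ∂(m.fiber u), (Quotient.out y : Arr X).right = u := by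
  filter_upwards [m.carried u] with y hy
  rw [← hy]
  exact congrArg H.anchor (H.coset_out y)

theorem memLp_transport (hL : L.IsBorelHom) {u : X} (ξ : IndPre (hL.restrict H) m u) :
    MemLp (fun y : H.Quo => transport u ξ.toFun y.out) 2 (m.fiber u) :=
  ξ.memLp_norm.mono (stronglyMeasurable_transport hL u ξ.isEquivariant).aestronglyMeasurable
    (Filter.Eventually.of_forall fun y => by
      rw [norm_norm]
      exact norm_transport_le u ξ.toFun y.out)

/-- The isometry from the equivariant functions to `L²((G/H)_u, m_u; H(u))` with
`ξ ↦ (x H ↦ L_x ξ(x))`. -/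
def indToLp (hL : L.IsBorelHom) (u : X) :
    IndPre (hL.restrict H) m u →ₗᵢ[ℂ] Lp (L.Fiber u) 2 (m.fiber u) :=
  LinearMap.isometryOfInner
    { toFun := fun ξ => (memLp_transport m hL ξ).toLp _
      map_add' := fun ξ η => by
        rw [← MemLp.toLp_add, MemLp.toLp_eq_toLp_iff]
        exact Filter.Eventually.of_forall fun y => transport_add u ξ.toFun η.toFun _
      map_smul' := fun c ξ => by
        rw [RingHom.id_apply, ← MemLp.toLp_const_smul, MemLp.toLp_eq_toLp_iff]
        exact Filter.Eventually.of_forall fun y => transport_smul u c ξ.toFun _ }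
    fun ξ η => by
      rw [IndPre.inner_def, L2.inner_def]
      refine integral_congr_ae ?_
      filter_upwards [(memLp_transport m hL ξ).coeFn_toLp, (memLp_transport m hL η).coeFn_toLp,
        m.right_out_ae u] with y h1 h2 hy
      exact (congrArg₂ (fun a b => ⟪a, b⟫_ℂ) h1 h2).trans (inner_transport _ _ hy)

theorem indToLp_coe (hL : L.IsBorelHom) {u : X} (ξ : IndPre (hL.restrict H) m u) :
    indToLp m hL u ξ =ᵐ[m.fiber u] fun y => transport u ξ.toFun y.out :=
  (memLp_transport m hL ξ).coeFn_toLp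

theorem sectionInd_mem (hL : L.IsBorelHom) {s : ∀ u, L.Fiber u} (hs : L.IsBorelSection s)
    {f : H.Quo → ℂ} (hf : Measurable f) {u : X} (hf2 : MemLp f 2 (m.fiber u)) :
    sectionInd H s f ∈ indSubmodule (hL.restrict H) m u := by
  refine ⟨isEquivariant_sectionInd hL hs hf, ?_⟩
  have h1 : ∫⁻ y, ‖sectionInd H s f y.out‖ₑ ^ 2 ∂(m.fiber u) =
      ∫⁻ y, ‖f y‖ₑ ^ 2 * ‖s u‖ₑ ^ 2 ∂(m.fiber u) := by
    refine lintegral_congr_ae ?_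
    filter_upwards [m.right_out_ae u] with y hy
    rw [← mul_pow, ← ofReal_norm, norm_sectionInd, H.coset_out, hy, ENNReal.ofReal_mul (norm_nonneg _),
      ofReal_norm, ofReal_norm]
  rw [h1, lintegral_mul_const' _ _ (by simp)]
  refine ENNReal.mul_lt_top ?_ (by simp)
  have h2 := hf2.2
  rw [QuotientMeasure.eLpNorm_two_eq] at h2
  exact (ENNReal.rpow_lt_top_iff_of_pos (by norm_num)).1 h2

/-- The function `sectionInd H s f` corresponds to the elementary tensor of `s(u)` and `f`. -/
theorem indToLp_sectionInd (hL : L.IsBorelHom) {s : ∀ u, L.Fiber u} (hs : L.IsBorelSection s)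
    {f : H.Quo → ℂ} (hf : Measurable f) {u : X} (hf2 : MemLp f 2 (m.fiber u)) :
    indToLp m hL u ⟨sectionInd H s f, sectionInd_mem m hL hs hf hf2⟩ =
      tensorLpEquiv (L.Fiber u) (m.fiber u) (tmulC (s u) (hf2.toLp f)) := by
  refine Lp.ext ((indToLp_coe m hL _).trans (Filter.EventuallyEq.symm
    ((tensorLpEquiv_tmulC _ _).trans ?_)))
  filter_upwards [m.right_out_ae u, hf2.coeFn_toLp] with y hy hfy
  rw [hfy]
  refine Eq.trans ?_ (transport_sectionInd hL s f hy).symm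
  rw [H.coset_out]

/-- Every vector `z` over `u` is the value of the Borel section that is `z` at `u` and zero
elsewhere, so that the range contains all elementary tensors. -/
theorem denseRange_indToLp (hL : L.IsBorelHom) (u : X) : DenseRange (indToLp m hL u) := by
  have hd : DenseRange (tensorLp (L.Fiber u) (m.fiber u)) := denseRange_tensorLp
  have hsub : Set.range (tensorLp (L.Fiber u) (m.fiber u)) ⊆ Set.range (indToLp m hL u) := by
    rintro _ ⟨a, rfl⟩
    induction a using TensorProduct.induction_on with
    | zero => exact ⟨0, by rw [map_zero, map_zero]⟩
    | add a b ha hb =>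
      obtain ⟨ξ, hξ⟩ := ha
      obtain ⟨η, hη⟩ := hb
      exact ⟨ξ + η, by rw [map_add, map_add, hξ, hη]⟩
    | tmul x ξ =>
      have h := indToLp_sectionInd m hL (hL.isBorelSection_single u x)
        (Lp.stronglyMeasurable ξ).measurable (Lp.memLp ξ)
      rw [L.single_self, Lp.toLp_coeFn] at h
      exact ⟨_, h.trans (completionEquiv_coe _ _ _)⟩
  exact hd.mono hsub

/-- The unitary from the fibre of `L ⊗ ρ^{G/H}` to the fibre of the induced representation. -/
def tensorIndEquiv (hL : L.IsBorelHom) (u : X) :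
    (L.tensor m.quasiRegularRep).Fiber u ≃ₗᵢ[ℂ] (ind (hL.restrict H) m).Fiber u :=
  (tensorLpEquiv (L.Fiber u) (m.fiber u)).trans
    (completionEquiv (indToLp m hL u) (denseRange_indToLp m hL u)).symm

theorem tensorIndEquiv_tmul (hL : L.IsBorelHom) {s : ∀ u, L.Fiber u} (hs : L.IsBorelSection s)
    {f : H.Quo → ℂ} (hf : Measurable f) {u : X} (hf2 : MemLp f 2 (m.fiber u)) :
    tensorIndEquiv m hL u (L.tmul m.quasiRegularRep (s u) (hf2.toLp f)) =
      IndPre.toCompletion (sectionInd H s f) (sectionInd_mem m hL hs hf hf2) := by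
  refine (completionEquiv (indToLp m hL u) (denseRange_indToLp m hL u)).symm_apply_eq.2 ?_
  exact (indToLp_sectionInd m hL hs hf hf2).symm.trans (completionEquiv_coe _ _ _).symm

omit [BorelSpace X] [BorelSpace (Arr X)] [LocallyCompactGroupoid X] in
/-- On elementary tensors both operators are given by
`x ↦ D(g⁻¹, x H)^(1/2) f(g⁻¹ x H) L_x⁻¹ L_g z`. -/
theorem indFun_sectionInd (hL : L.IsBorelHom) {u v : X} (g : u ⟶ v) (z : L.Fiber u)
    (f : H.Quo → ℂ) :
    indFun (M := L.restrict H) m g (sectionInd H (L.single u z) f) =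
      sectionInd H (L.single v (L.op g z)) (m.koopmanFun g f) := by
  funext x
  by_cases hx : x.right = v
  · obtain ⟨a, b, x⟩ := x
    obtain rfl : b = v := hx
    rw [indFun, dif_pos rfl]
    have e : L.op (Groupoid.inv (x ≫ 𝟙 b ≫ Groupoid.inv g)) z =
        L.op (Groupoid.inv x) (L.op g z) := by
      rw [← hL.map_comp, Category.id_comp, inv_comp_eq, inv_inv_eq]
    have ha : H.act (Groupoid.inv g) (H.coset ⟨a, b, x⟩) =
        H.coset ⟨a, u, x ≫ 𝟙 b ≫ Groupoid.inv g⟩ :=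
      congrArg H.coset (lmul_of_eq (Groupoid.inv g) ⟨a, b, x⟩ rfl)
    change (m.sqrtDeriv g (H.coset ⟨a, b, x⟩) : ℂ) •
        (f (H.coset ⟨a, u, x ≫ 𝟙 b ≫ Groupoid.inv g⟩) •
          L.op (Groupoid.inv (x ≫ 𝟙 b ≫ Groupoid.inv g)) (L.single u z u)) =
      ((m.sqrtDeriv g (H.coset ⟨a, b, x⟩) : ℂ) •
        f (H.act (Groupoid.inv g) (H.coset ⟨a, b, x⟩))) •
          L.op (Groupoid.inv x) (L.single b (L.op g z) b)
    rw [L.single_self, L.single_self, e, ha, smul_smul, smul_eq_mul]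
  · rw [indFun, dif_neg hx]
    change 0 = m.koopmanFun g f (H.coset x) • L.op (Groupoid.inv x.hom) (L.single v _ x.right)
    rw [L.single_of_ne _ hx, map_zero, smul_zero]

theorem tensorIndEquiv_op (hL : L.IsBorelHom) {u v : X} (g : u ⟶ v)
    (ζ : (L.tensor m.quasiRegularRep).Fiber u) :
    tensorIndEquiv m hL v ((L.tensor m.quasiRegularRep).op g ζ) =
      (ind (hL.restrict H) m).op g (tensorIndEquiv m hL u ζ) := by
  refine HilbertRep.tensor_ext
    (f := (tensorIndEquiv m hL v).toLinearIsometry.comp ((L.tensor m.quasiRegularRep).op g))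
    (g := ((ind (hL.restrict H) m).op g).comp (tensorIndEquiv m hL u).toLinearIsometry)
    (fun z (ξ : Lp ℂ 2 (m.fiber u)) => ?_) ζ
  change tensorIndEquiv m hL v ((L.tensor m.quasiRegularRep).op g _) =
    (ind (hL.restrict H) m).op g (tensorIndEquiv m hL u _)
  have hξ : Measurable ξ := (Lp.stronglyMeasurable _).measurable
  have h1 := tensorIndEquiv_tmul m hL (hL.isBorelSection_single u z) hξ (Lp.memLp ξ)
  have h2 := tensorIndEquiv_tmul m hL (hL.isBorelSection_single v (L.op g z))
    (m.measurable_koopmanFun g hξ) (m.memLp_koopmanFun g ξ)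
  rw [L.single_self, Lp.toLp_coeFn] at h1
  rw [L.single_self] at h2
  refine (congrArg _ (HilbertRep.tensor_op_tmul g z _)).trans ?_
  refine h2.trans (Eq.trans ?_ (congrArg _ h1).symm)
  refine Eq.trans ?_ (completionMap_coe (indOp (hL.restrict H) m g) _).symm
  exact congrArg UniformSpace.Completion.coe' (Subtype.ext (indFun_sectionInd m hL g z ξ).symm)

theorem isBorelSection_tensorIndEquiv (haarH : HaarSystem H.Obj) (hL : L.IsBorelHom)
    (ζ : ∀ u, (L.tensor m.quasiRegularRep).Fiber u) :
    (L.tensor m.quasiRegularRep).IsBorelSection ζ ↔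
      (ind (hL.restrict H) m).IsBorelSection fun u => tensorIndEquiv m hL u (ζ u) := by
  obtain ⟨s, hs⟩ := hL.bundle.exists_isFundamental
  obtain ⟨f, hf2, hf, hfund⟩ := m.exists_isFundamental_quasiRegularRep haarH
  have := (m.hasFiniteCover haarH).hasFiniteDensity.isSFiniteKernel
  have hmem : ∀ (n : ℕ) u, sectionInd H (s n.unpair.1) (f n.unpair.2) ∈
      indSubmodule (hL.restrict H) m u := fun n u =>
    sectionInd_mem m hL (hs.isBorelSection _) (hf _) (hf2 _ u)
  have hU : ∀ (n : ℕ) u, tensorIndEquiv m hL u (L.tmul m.quasiRegularRep (s n.unpair.1 u)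
      ((hf2 n.unpair.2 u).toLp (f n.unpair.2))) = IndPre.toCompletion _ (hmem n u) := fun n u =>
    tensorIndEquiv_tmul m hL (hs.isBorelSection _) (hf _) (hf2 _ u)
  refine (HilbertRep.isFundamental_tensor hs hfund).isBorelSection_iff_map
    (E' := (ind (hL.restrict H) m).toHilbertBundle) (tensorIndEquiv m hL)
    (S := {Ξ | ∃ (ξ : ∀ x : Arr X, (L.restrict H).Fiber (H.obj x.left))
      (hξ : ∀ u, ξ ∈ indSubmodule (hL.restrict H) m u),
      Ξ = fun u => IndPre.toCompletion ξ (hξ u)}) (fun Ξ => ⟨?_, ?_⟩) (fun n => ?_) ?_ ζ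
  · rintro h _ ⟨ξ, hξ, rfl⟩
    exact h ξ hξ
  · exact fun h ξ hξ => h _ ⟨ξ, hξ, rfl⟩
  · exact ⟨_, hmem n, funext (hU n)⟩
  · rintro _ ⟨ξ, hξ, rfl⟩ n
    -- Membership in the space over one unit already contains that `ξ` is Borel and equivariant.
    by_cases hX : Nonempty X
    · obtain ⟨u₀⟩ := hX
      have h1 := (hmem n u₀).1.measurable_inner_out (hL.restrict H) (hξ u₀).1
      refine Eq.mp (congrArg Measurable (funext fun u => ?_))
        (StronglyMeasurable.integral_kernel (κ := m.fiber) h1.stronglyMeasurable).measurable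
      refine Eq.trans ?_ (congrArg (fun a => ⟪a, _⟫_ℂ) (hU n u)).symm
      let a : IndPre (hL.restrict H) m u := ⟨_, hmem n u⟩
      let b : IndPre (hL.restrict H) m u := ⟨ξ, hξ u⟩
      exact (UniformSpace.Completion.inner_coe (𝕜 := ℂ) a b).symm
    · rw [not_nonempty_iff] at hX
      exact measurable_of_empty _

/-- The induced representation of `L|_H` is `L ⊗ ρ^{G/H}`. -/
theorem equivalent_ind_tensor (haarH : HaarSystem H.Obj) (hL : IsUnitaryRep haar μ L) :
    Equivalent haar μ (ind (hL.2.restrict H) m) (L.tensor m.quasiRegularRep) := by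
  have h := HilbertRep.IsBorelHom.tensor (measurable_left X) (measurable_right X) hL.2
    (m.isBorelHom_quasiRegularRep haarH)
  exact Equivalent.symm ⟨⟨hL.1, h⟩, ⟨hL.1, h.of_intertwiner (tensorIndEquiv m hL.2)
    (isBorelSection_tensorIndEquiv m haarH hL.2) (tensorIndEquiv_op m hL.2)⟩,
    tensorIndEquiv m hL.2, isBorelSection_tensorIndEquiv m haarH hL.2, tensorIndEquiv_op m hL.2⟩

end Induced

/-! ### Orthonormal frames -/

section Frames

open Submodule

variable {V W : Type*} [NormedAddCommGroup V] [InnerProductSpace ℂ V]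
  [NormedAddCommGroup W] [InnerProductSpace ℂ W] {n : ℕ∞} {ε : ℕ → V}

open Classical in
/-- The vectors `ε k` with `k < n` are an orthonormal basis, and the other ones are zero. -/
structure IsStdFrame (n : ℕ∞) (ε : ℕ → V) : Prop where
  inner_eq : ∀ j k, ⟪ε j, ε k⟫_ℂ = if j = k ∧ (k : ℕ∞) < n then 1 else 0
  dense : Dense (span ℂ (Set.range ε) : Set V)

namespace IsStdFrame

theorem eq_zero (h : IsStdFrame n ε) {k : ℕ} (hk : ¬(k : ℕ∞) < n) : ε k = 0 := by
  rw [← inner_self_eq_zero (𝕜 := ℂ), h.inner_eq, if_neg fun hk' => hk hk'.2]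

theorem orthonormal (h : IsStdFrame n ε) :
    Orthonormal ℂ fun k : {k : ℕ // (k : ℕ∞) < n} => ε k := by
  classical
  rw [orthonormal_iff_ite]
  intro j k
  rw [h.inner_eq]
  simp [Subtype.ext_iff, k.2]

theorem dense_subtype (h : IsStdFrame n ε) :
    Dense (span ℂ (Set.range fun k : {k : ℕ // (k : ℕ∞) < n} => ε k) : Set V) := by
  refine h.dense.mono (span_le.2 ?_)
  rintro _ ⟨k, rfl⟩
  by_cases hk : (k : ℕ∞) < n
  · exact subset_span ⟨⟨k, hk⟩, rfl⟩
  · rw [h.eq_zero hk]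
    exact zero_mem _

theorem map (h : IsStdFrame n ε) (T : V →ₗᵢ[ℂ] W) (hT : Function.Surjective T) :
    IsStdFrame n fun k => T (ε k) where
  inner_eq j k := by rw [T.inner_map_map, h.inner_eq]
  dense := dense_span_map T hT h.dense

/-- The number of nonzero vectors of a frame is the algebraic dimension, with all infinite
dimensions identified. -/
theorem toENat_rank (h : IsStdFrame n ε) : Cardinal.toENat (Module.rank ℂ V) = n := by
  induction n using ENat.recTopCoe with
  | top =>
    have hli := h.orthonormal.linearIndependent.cardinal_lift_le_rank
    have : Infinite {k : ℕ // (k : ℕ∞) < ⊤} :=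
      Infinite.of_injective (fun k : ℕ => ⟨k, ENat.natCast_lt_top k⟩) fun a b hab =>
        congrArg Subtype.val hab
    exact Cardinal.toENat_eq_top.2 (Cardinal.aleph0_le_lift.1
      ((Cardinal.aleph0_le_lift.2 (Cardinal.aleph0_le_mk _)).trans hli))
  | coe m =>
    have ho : Orthonormal ℂ fun k : Fin m => ε k :=
      h.orthonormal.comp (fun k : Fin m => (⟨k, by exact_mod_cast k.2⟩ :
        {k : ℕ // (k : ℕ∞) < (m : ℕ∞)})) fun a b hab =>
          Fin.ext (congrArg (fun k : {k : ℕ // (k : ℕ∞) < (m : ℕ∞)} => (k : ℕ)) hab)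
    have hd : ⊤ ≤ span ℂ (Set.range fun k : Fin m => ε k) := by
      have := FiniteDimensional.span_of_finite ℂ (Set.finite_range fun k : Fin m => ε k)
      have hc := (span ℂ (Set.range fun k : Fin m => ε k)).closed_of_finiteDimensional
      intro z _
      refine hc.closure_subset (h.dense_subtype.mono (span_mono ?_) z)
      rintro _ ⟨⟨k, hk⟩, rfl⟩
      exact ⟨⟨k, by exact_mod_cast hk⟩, rfl⟩
    rw [rank_eq_card_basis (Module.Basis.mk ho.linearIndependent hd)]
    simp

variable [CompleteSpace V]

/-- The Hilbert basis that belongs to a frame. -/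
def basis (h : IsStdFrame n ε) : HilbertBasis {k : ℕ // (k : ℕ∞) < n} ℂ V :=
  HilbertBasis.mk h.orthonormal
    (dense_iff_topologicalClosure_eq_top.1 h.dense_subtype).ge

end IsStdFrame

open Classical in
/-- The standard basis vectors of the standard Hilbert space of dimension `n`, followed by zeros. -/
def stdVec (n : ℕ∞) (k : ℕ) : StdHilbert n :=
  if h : (k : ℕ∞) < n then lp.single 2 ⟨k, h⟩ 1 else 0

open Classical in
theorem inner_stdVec (k : ℕ) (z : StdHilbert n) : ⟪stdVec n k, z⟫_ℂ =
    if h : (k : ℕ∞) < n then (z : ∀ _ : {k : ℕ // (k : ℕ∞) < n}, ℂ) ⟨k, h⟩ else 0 := by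
  unfold stdVec
  split_ifs with h
  · rw [lp.inner_single_left]
    simp
  · exact inner_zero_left _

theorem isStdFrame_stdVec (n : ℕ∞) : IsStdFrame n (stdVec n) where
  inner_eq j k := by
    rw [inner_stdVec]
    by_cases hj : (j : ℕ∞) < n
    · rw [dif_pos hj]
      by_cases hk : (k : ℕ∞) < n
      · rw [stdVec, dif_pos hk, lp.coeFn_single, Pi.single_apply]
        simp [hk]
      · rw [stdVec, dif_neg hk, if_neg fun h => hk h.2]
        rfl
    · rw [dif_neg hj, if_neg]
      rintro ⟨rfl, h⟩
      exact hj h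
  dense := by
    have h := (HilbertBasis.ofRepr (LinearIsometryEquiv.refl ℂ (StdHilbert n))).dense_span
    refine (dense_iff_topologicalClosure_eq_top.2 h).mono (span_mono ?_)
    rintro _ ⟨k, rfl⟩
    refine ⟨k, ?_⟩
    rw [stdVec, dif_pos k.2, ← HilbertBasis.repr_symm_single]
    rfl

theorem cast_stdVec {m n : ℕ∞} (h : m = n) (k : ℕ) :
    StdHilbert.cast h (stdVec m k) = stdVec n k := by
  subst h
  rfl

theorem IsStdFrame.repr_symm_stdVec [CompleteSpace V] (h : IsStdFrame n ε) (k : ℕ) :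
    h.basis.repr.symm (stdVec n k) = ε k := by
  classical
  by_cases hk : (k : ℕ∞) < n
  · rw [stdVec, dif_pos hk, HilbertBasis.repr_symm_single]
    exact congrFun (HilbertBasis.coe_mk _ _) _
  · rw [stdVec, dif_neg hk, map_zero, h.eq_zero hk]

/-- Removal of the zeros from a sequence of vectors. -/
def compress (g : ℕ → V) (k : ℕ) : V :=
  open Classical in
  if (k : ℕ∞) < {i | g i ≠ 0}.encard then g (Nat.nth (fun i => g i ≠ 0) k) else 0

theorem lt_encard_iff {p : ℕ → Prop} {k : ℕ} : (k : ℕ∞) < {i | p i}.encard ↔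
    ∀ hf : {i | p i}.Finite, k < hf.toFinset.card := by
  by_cases hf : {i | p i}.Finite
  · rw [hf.encard_eq_coe_toFinset_card, Nat.cast_lt]
    exact ⟨fun h _ => h, fun h => h hf⟩
  · rw [Set.encard_eq_top hf]
    exact ⟨fun _ h => absurd h hf, fun _ => ENat.natCast_lt_top k⟩

omit [InnerProductSpace ℂ V] in
open Classical in
theorem compress_count {g : ℕ → V} {i : ℕ} (hi : g i ≠ 0) :
    compress g (Nat.count (fun i => g i ≠ 0) i) = g i := by
  rw [compress, if_pos (lt_encard_iff.2 fun hf => Nat.count_lt_card hf hi), Nat.nth_count hi]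

omit [InnerProductSpace ℂ V] in
open Classical in
theorem exists_of_compress_ne_zero {g : ℕ → V} {k : ℕ} (hk : compress g k ≠ 0) :
    ∃ i, g i ≠ 0 ∧ Nat.count (fun i => g i ≠ 0) i = k := by
  have h : (k : ℕ∞) < {i | g i ≠ 0}.encard := by
    by_contra h
    exact hk (if_neg h)
  exact ⟨_, Nat.nth_mem k (lt_encard_iff.1 h), Nat.count_nth (lt_encard_iff.1 h)⟩

open Classical in
theorem isStdFrame_compress {g : ℕ → V}
    (hg : ∀ i j, ⟪g i, g j⟫_ℂ = if i = j ∧ g j ≠ 0 then 1 else 0)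
    (hd : Dense (span ℂ (Set.range g) : Set V)) :
    IsStdFrame {i | g i ≠ 0}.encard (compress g) where
  inner_eq j k := by
    by_cases hk : (k : ℕ∞) < {i | g i ≠ 0}.encard
    · by_cases hj : (j : ℕ∞) < {i | g i ≠ 0}.encard
      · have h : Nat.nth (fun i => g i ≠ 0) j = Nat.nth (fun i => g i ≠ 0) k ↔ j = k := by
          refine ⟨fun h => ?_, fun h => by rw [h]⟩
          rw [← Nat.count_nth (lt_encard_iff.1 hj), h, Nat.count_nth (lt_encard_iff.1 hk)]
        rw [compress, compress, if_pos hj, if_pos hk, hg]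
        simp only [h, hk, and_true]
        simp [show g (Nat.nth (fun i => g i ≠ 0) k) ≠ 0 from Nat.nth_mem k (lt_encard_iff.1 hk)]
      · rw [compress, if_neg hj, inner_zero_left, if_neg]
        rintro ⟨rfl, -⟩
        exact hj hk
    · rw [compress, compress, if_neg hk, inner_zero_right, if_neg fun h => hk h.2]
  dense := by
    refine hd.mono (span_le.2 ?_)
    rintro _ ⟨i, rfl⟩
    by_cases hi : g i = 0
    · rw [hi]
      exact zero_mem _
    · exact subset_span ⟨_, compress_count hi⟩

open Classical in
theorem inner_gramSchmidtNormed (f : ℕ → V) (i j : ℕ) :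
    ⟪InnerProductSpace.gramSchmidtNormed ℂ f i, InnerProductSpace.gramSchmidtNormed ℂ f j⟫_ℂ =
      if i = j ∧ InnerProductSpace.gramSchmidtNormed ℂ f j ≠ 0 then 1 else 0 := by
  by_cases hij : i = j
  · subst hij
    by_cases h : InnerProductSpace.gramSchmidtNormed ℂ f i = 0
    · simp [h]
    · rw [if_pos ⟨rfl, h⟩, inner_self_eq_norm_sq_to_K,
        InnerProductSpace.gramSchmidtNormed_unit_length' h]
      simp
  · rw [if_neg fun h => hij h.1, InnerProductSpace.gramSchmidtNormed,
      InnerProductSpace.gramSchmidtNormed, inner_smul_left, inner_smul_right,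
      InnerProductSpace.gramSchmidt_orthogonal ℂ f hij]
    simp

end Frames

/-! ### Borel frames -/

section BorelFrames

variable {X : Type u} [MeasurableSpace X]

/-- A function that is `ψ i` on the set `A i`, and constant off the union of these sets. -/
theorem measurable_of_cover {Y β : Type*} [MeasurableSpace Y] [MeasurableSpace β] {A : ℕ → Set Y}
    (hA : ∀ i, MeasurableSet (A i)) {φ : Y → β} {ψ : ℕ → Y → β} (hψ : ∀ i, Measurable (ψ i))
    (c : β) (h : ∀ i, ∀ y ∈ A i, φ y = ψ i y) (h' : ∀ y, (∀ i, y ∉ A i) → φ y = c) :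
    Measurable φ := by
  intro B hB
  have e : φ ⁻¹' B = (⋃ i, A i ∩ ψ i ⁻¹' B) ∪ ((⋃ i, A i)ᶜ ∩ {_y | c ∈ B}) := by
    ext y
    by_cases hy : ∃ i, y ∈ A i
    · obtain ⟨i, hi⟩ := hy
      simp only [Set.mem_preimage, Set.mem_union, Set.mem_iUnion, Set.mem_inter_iff,
        Set.mem_compl_iff]
      refine ⟨fun hB => Or.inl ⟨i, hi, by rwa [← h i y hi]⟩, ?_⟩
      rintro (⟨j, hj, hB⟩ | ⟨hn, -⟩)
      · rwa [h j y hj]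
      · exact absurd ⟨i, hi⟩ hn
    · push Not at hy
      simp [h' y hy, hy]
  rw [e]
  exact (MeasurableSet.iUnion fun i => (hA i).inter (hψ i hB)).union
    ((MeasurableSet.iUnion hA).compl.inter (MeasurableSet.const _))

/-- A sequence of Borel sections which is an orthonormal basis of the fibre over `u` up to the
index `dim u`, and zero from there on. -/
structure HilbertBundle.IsFrame (E : HilbertBundle.{u, w} X) (ε : ℕ → ∀ u, E.Fiber u) : Prop where
  isBorelSection : ∀ k, E.IsBorelSection (ε k)
  isStdFrame : ∀ u, IsStdFrame (E.dim u) fun k => ε k u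

open Classical in
/-- The Gram–Schmidt process, applied to a fundamental sequence. -/
theorem HilbertBundle.IsBorel.exists_isFrame {E : HilbertBundle.{u, w} X} (hE : E.IsBorel) :
    ∃ ε, E.IsFrame ε := by
  obtain ⟨f, hf⟩ := hE.exists_isFundamental
  let h : ℕ → ∀ u, E.Fiber u := fun i u => InnerProductSpace.gramSchmidt ℂ (fun j => f j u) i
  let g : ℕ → ∀ u, E.Fiber u := fun i u => InnerProductSpace.gramSchmidtNormed ℂ (fun j => f j u) i
  have hh : ∀ i, E.IsBorelSection (h i) := by
    intro i
    induction i using Nat.strong_induction_on with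
    | _ i ih =>
      refine (hf.isBorelSection_iff _).2 fun n => ?_
      have e : ∀ u, ⟪f n u, h i u⟫_ℂ = ⟪f n u, f i u⟫_ℂ - ∑ j ∈ Finset.Iio i,
          ⟪h j u, f i u⟫_ℂ / ⟪h j u, h j u⟫_ℂ * ⟪f n u, h j u⟫_ℂ := fun u => by
        change ⟪f n u, InnerProductSpace.gramSchmidt ℂ (fun j => f j u) i⟫_ℂ = _
        rw [InnerProductSpace.gramSchmidt_def, inner_sub_right, inner_sum]
        congr 1
        refine Finset.sum_congr rfl fun j _ => ?_
        rw [Submodule.starProjection_singleton, inner_smul_right, inner_self_eq_norm_sq_to_K]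
        norm_cast
      simp_rw [e]
      refine (hf.measurable_inner n i).sub (Finset.measurable_fun_sum _ fun j hj => ?_)
      have hj' := ih j (Finset.mem_Iio.1 hj)
      exact ((hf.measurable_inner_sections hj' (hf.isBorelSection i)).div
        (hf.measurable_inner_sections hj' hj')).mul ((hf.isBorelSection_iff _).1 hj' n)
  have hg : ∀ i, E.IsBorelSection (g i) := fun i => by
    refine (hf.isBorelSection_iff _).2 fun n => ?_
    have e : ∀ u, ⟪f n u, g i u⟫_ℂ = ((√(⟪h i u, h i u⟫_ℂ).re : ℝ) : ℂ)⁻¹ * ⟪f n u, h i u⟫_ℂ :=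
      fun u => by
        change ⟪f n u, InnerProductSpace.gramSchmidtNormed ℂ (fun j => f j u) i⟫_ℂ = _
        rw [InnerProductSpace.gramSchmidtNormed, inner_smul_right,
          norm_eq_sqrt_re_inner (𝕜 := ℂ)]
        rfl
    simp_rw [e]
    exact (Complex.measurable_ofReal.comp (Complex.measurable_re.comp
      (hf.measurable_inner_sections (hh i) (hh i))).sqrt).inv.mul
        ((hf.isBorelSection_iff _).1 (hh i) n)
  have hne : ∀ i, MeasurableSet {u | g i u ≠ 0} := fun i => by
    have e : {u | g i u ≠ 0} = ((fun u => ⟪g i u, g i u⟫_ℂ) ⁻¹' {0})ᶜ := by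
      ext u
      simp
    rw [e]
    exact (hf.measurable_inner_sections (hg i) (hg i) (measurableSet_singleton 0)).compl
  -- The position of `g i u` among the nonzero vectors is a Borel function of `u`.
  have hcount : ∀ i, Measurable fun u => Nat.count (fun j => g j u ≠ 0) i := by
    intro i
    induction i with
    | zero => simp
    | succ i ih =>
      simp_rw [Nat.count_succ]
      exact ih.add (Measurable.ite (hne i) measurable_const measurable_const)
  refine ⟨fun k u => compress (fun i => g i u) k, fun k => ?_, fun u => ?_⟩
  · refine (hf.isBorelSection_iff _).2 fun n => ?_
    refine measurable_of_cover (A := fun i => {u | g i u ≠ 0} ∩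
        {u | Nat.count (fun j => g j u ≠ 0) i = k})
      (fun i => (hne i).inter (hcount i (measurableSet_singleton k)))
      (ψ := fun i u => ⟪f n u, g i u⟫_ℂ) (fun i => (hf.isBorelSection_iff _).1 (hg i) n) 0 ?_ ?_
    · rintro i u ⟨hu, rfl⟩
      rw [compress_count (g := fun i => g i u) hu]
    · intro u hu
      by_contra hk
      obtain ⟨i, hi, hik⟩ := exists_of_compress_ne_zero (g := fun i => g i u) (k := k) fun h0 =>
        hk (by rw [h0, inner_zero_right])
      exact hu i ⟨hi, hik⟩
  · have hstd := isStdFrame_compress (g := fun i => g i u)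
      (inner_gramSchmidtNormed fun j => f j u) (by
        have := (InnerProductSpace.span_gramSchmidtNormed_range (𝕜 := ℂ) fun j => f j u).trans
          (InnerProductSpace.span_gramSchmidt ℂ fun j => f j u)
        exact (congrArg SetLike.coe this).symm ▸ hf.dense u)
    have hdim : E.dim u = _ := hstd.toENat_rank
    rw [hdim]
    exact hstd

theorem HilbertBundle.IsFrame.measurableSet_lt_dim {E : HilbertBundle.{u, w} X} (hE : E.IsBorel)
    {ε : ℕ → ∀ u, E.Fiber u} (hε : E.IsFrame ε) (k : ℕ) :
    MeasurableSet {u | (k : ℕ∞) < E.dim u} := by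
  obtain ⟨f, hf⟩ := hE.exists_isFundamental
  have e : {u | (k : ℕ∞) < E.dim u} = ((fun u => ⟪ε k u, ε k u⟫_ℂ) ⁻¹' {0})ᶜ := by
    ext u
    rw [Set.mem_compl_iff, Set.mem_preimage, (hε.isStdFrame u).inner_eq k k]
    simp
  rw [e]
  exact (hf.measurable_inner_sections (hε.isBorelSection k) (hε.isBorelSection k)
    (measurableSet_singleton 0)).compl

end BorelFrames

/-! ### Multiplication by fields of isometries -/

section Fields

variable {Y : Type*} [MeasurableSpace Y] {V W : Type*} [NormedAddCommGroup V]
  [InnerProductSpace ℂ V] [NormedAddCommGroup W] [InnerProductSpace ℂ W]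

/-- Simple functions `φ` are treated piece by piece, and the general case is a pointwise limit. -/
theorem stronglyMeasurable_field_apply {b : Y → V →ₗᵢ[ℂ] W}
    (hb : ∀ z, StronglyMeasurable fun y => b y z) {φ : Y → V} (hφ : StronglyMeasurable φ) :
    StronglyMeasurable fun y => b y (φ y) := by
  have hs : ∀ s : SimpleFunc Y V, StronglyMeasurable fun y => b y (s y) := by
    intro s
    induction s using SimpleFunc.induction with
    | const c hA =>
      rename_i A
      have e : (fun y => b y ((SimpleFunc.piecewise A hA (SimpleFunc.const Y c)
          (SimpleFunc.const Y 0)) y)) = A.indicator fun y => b y c := by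
        ext y
        by_cases hy : y ∈ A <;> simp [hy]
      rw [e]
      exact (hb c).indicator hA
    | add _ hf hg =>
      simp only [SimpleFunc.coe_add, Pi.add_apply, map_add]
      exact hf.add hg
  exact stronglyMeasurable_of_tendsto Filter.atTop (fun n => hs (hφ.approx n))
    (tendsto_pi_nhds.2 fun y => ((b y).continuous.tendsto _).comp (hφ.tendsto_approx y))

variable (τ : Measure Y)

theorem memLp_field_apply {b : Y → V →ₗᵢ[ℂ] W} (hb : ∀ z, StronglyMeasurable fun y => b y z)
    (F : Lp V 2 τ) : MemLp (fun y => b y (F y)) 2 τ :=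
  (Lp.memLp F).congr_norm
    (stronglyMeasurable_field_apply hb (Lp.stronglyMeasurable F)).aestronglyMeasurable
    (Filter.Eventually.of_forall fun y => ((b y).norm_map _).symm)

/-- The operator `F ↦ (y ↦ b(y) F(y))` defined by a measurable field of isometries. -/
def fieldLp (b : Y → V →ₗᵢ[ℂ] W) (hb : ∀ z, StronglyMeasurable fun y => b y z) :
    Lp V 2 τ →ₗᵢ[ℂ] Lp W 2 τ where
  toFun F := (memLp_field_apply τ hb F).toLp _
  map_add' F G := by
    rw [← MemLp.toLp_add, MemLp.toLp_eq_toLp_iff]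
    filter_upwards [Lp.coeFn_add F G] with y hy
    rw [hy]
    exact map_add (b y) _ _
  map_smul' c F := by
    rw [RingHom.id_apply, ← MemLp.toLp_const_smul, MemLp.toLp_eq_toLp_iff]
    filter_upwards [Lp.coeFn_smul c F] with y hy
    rw [hy]
    exact map_smul (b y) _ _
  norm_map' F := by
    change ‖(memLp_field_apply τ hb F).toLp _‖ = _
    rw [Lp.norm_toLp, Lp.norm_def]
    exact congrArg ENNReal.toReal (eLpNorm_congr_norm_ae
      (Filter.Eventually.of_forall fun y => (b y).norm_map _))

theorem fieldLp_coe {b : Y → V →ₗᵢ[ℂ] W} (hb : ∀ z, StronglyMeasurable fun y => b y z)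
    (F : Lp V 2 τ) : fieldLp τ b hb F =ᵐ[τ] fun y => b y (F y) :=
  (memLp_field_apply τ hb F).coeFn_toLp

/-- The unitary `F ↦ (y ↦ b(y) F(y))` defined by a measurable field of unitaries. -/
def fieldLpEquiv [CompleteSpace V] (b : Y → V ≃ₗᵢ[ℂ] W) (hb : ∀ z, StronglyMeasurable fun y => b y z)
    (hb' : ∀ z, StronglyMeasurable fun y => (b y).symm z) : Lp V 2 τ ≃ₗᵢ[ℂ] Lp W 2 τ :=
  LinearIsometryEquiv.ofSurjective (fieldLp τ (fun y => (b y).toLinearIsometry) hb) fun G => by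
    refine ⟨fieldLp τ (fun y => (b y).symm.toLinearIsometry) hb' G, Lp.ext ?_⟩
    filter_upwards [fieldLp_coe τ (b := fun y => (b y).toLinearIsometry) hb
      (fieldLp τ (fun y => (b y).symm.toLinearIsometry) hb' G),
      fieldLp_coe τ (b := fun y => (b y).symm.toLinearIsometry) hb' G] with y h1 h2
    rw [h1, h2]
    exact (b y).apply_symm_apply _

end Fields

/-! ### The multiples of the trivial representation -/

section DimRep

variable {X : Type u} [Groupoid.{v} X] [MeasurableSpace X] [MeasurableSpace (Arr X)]
  {L : HilbertRep.{u, v, w} X}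

theorem StdHilbert.cast_trans {l m n : ℕ∞} (h : l = m) (h' : m = n) (z : StdHilbert l) :
    StdHilbert.cast (h.trans h') z = StdHilbert.cast h' (StdHilbert.cast h z) := by
  subst h h'
  rfl

theorem HilbertRep.isFundamental_dimRep (hL : L.IsBorelHom) :
    (L.dimRep hL).IsFundamental fun k u => stdVec (L.dim u) k where
  measurable_inner j k := by
    classical
    obtain ⟨ε, hε⟩ := hL.bundle.exists_isFrame
    have h : Measurable fun u => if j = k ∧ (k : ℕ∞) < L.dim u then (1 : ℂ) else 0 :=
      Measurable.ite ((MeasurableSet.const _).inter (hε.measurableSet_lt_dim hL.bundle k))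
        measurable_const measurable_const
    refine Eq.mp (congrArg Measurable (funext fun u => ?_)) h
    refine Eq.trans ?_ ((isStdFrame_stdVec (L.dim u)).inner_eq j k).symm
    congr
  dense u := (isStdFrame_stdVec (L.dim u)).dense
  isBorelSection_iff ξ := by
    refine forall_congr' fun k => ?_
    have e : (fun u => ⟪(stdVec (L.dim u) k : (L.dimRep hL).Fiber u), ξ u⟫_ℂ) = _ :=
      funext fun u => inner_stdVec k _
    exact Iff.of_eq (congrArg Measurable e.symm)

theorem HilbertRep.isBorelHom_dimRep (hs : Measurable fun g : Arr X => g.left)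
    (hr : Measurable fun g : Arr X => g.right) (hL : L.IsBorelHom) :
    (L.dimRep hL).IsBorelHom := by
  have hf := HilbertRep.isFundamental_dimRep hL
  refine HilbertRep.isBorelHom_of_isFundamental hs hr hf (fun u ξ => rfl)
    (fun {u v w} h g ξ => StdHilbert.cast_trans (L.dim_eq hL h) (L.dim_eq hL g) ξ) fun j k => ?_
  refine Eq.mp (congrArg Measurable (funext fun g => ?_)) ((hf.measurable_inner j k).comp hr)
  exact congrArg (fun z => ⟪(stdVec (L.dim g.right) j : StdHilbert _), z⟫_ℂ)
    (cast_stdVec (L.dim_eq hL g.hom) k).symm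

end DimRep

/-! ### Absorption of representations by the regular representation -/

section Absorption

theorem IsStdFrame.hom_ext {V W : Type*} [NormedAddCommGroup V] [InnerProductSpace ℂ V]
    [NormedAddCommGroup W] [InnerProductSpace ℂ W] {n : ℕ∞} {ε : ℕ → V} (h : IsStdFrame n ε)
    {S T : V →ₗᵢ[ℂ] W} (hST : ∀ k, S (ε k) = T (ε k)) (z : V) : S z = T z := by
  have e : S.toContinuousLinearMap = T.toContinuousLinearMap :=
    ContinuousLinearMap.ext_on h.dense (by
      rintro _ ⟨k, rfl⟩
      exact hST k)
  exact congrArg (fun f : V →L[ℂ] W => f z) e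

/-- Fibrewise unitaries identify the Borel sections if their matrix coefficients with respect to two
fundamental sequences are Borel. -/
theorem HilbertBundle.IsFundamental.isBorelSection_iff_map_of_fundamental {X : Type u}
    [MeasurableSpace X] {E : HilbertBundle.{u, w} X} {f : ℕ → ∀ u, E.Fiber u}
    (hf : E.IsFundamental f) {E' : HilbertBundle.{u, w'} X} {f' : ℕ → ∀ u, E'.Fiber u}
    (hf' : E'.IsFundamental f') (U : ∀ u, E.Fiber u ≃ₗᵢ[ℂ] E'.Fiber u)
    (hm : ∀ m n, Measurable fun u => ⟪f' m u, U u (f n u)⟫_ℂ) (ξ : ∀ u, E.Fiber u) :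
    E.IsBorelSection ξ ↔ E'.IsBorelSection fun u => U u (ξ u) := by
  have hU : ∀ n, E'.IsBorelSection fun u => U u (f n u) := fun n =>
    (hf'.isBorelSection_iff _).2 fun m => hm m n
  refine hf.isBorelSection_iff_map U (S := {s | E'.IsBorelSection s})
    (fun Ξ => ⟨fun h s hs => hf'.measurable_inner_sections hs h, fun h =>
      (hf'.isBorelSection_iff _).2 fun m => h _ (hf'.isBorelSection m)⟩) hU
    (fun s hs n => hf'.measurable_inner_sections (hU n) hs) ξ

variable {X : Type u} [Groupoid.{v} X] {L : HilbertRep.{u, v, w} X}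

open Classical in
/-- The vectors `L_x ε_k(s(x))` in the fibre over `u`, for `r(x) = u`. For other arrows, which are
a null set for `λ^u`, the vectors `ε_k(u)` are used. -/
def movedFrame (ε : ℕ → ∀ u, L.Fiber u) (u : X) (x : Arr X) (k : ℕ) : L.Fiber u :=
  if h : x.right = u then L.op (x.hom ≫ eqToHom h) (ε k x.left) else ε k u

theorem movedFrame_right (ε : ℕ → ∀ u, L.Fiber u) (x : Arr X) (k : ℕ) :
    movedFrame ε x.right x k = L.op x.hom (ε k x.left) := by
  rw [movedFrame, dif_pos rfl, eqToHom_refl, Category.comp_id]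

section

variable [MeasurableSpace X] [MeasurableSpace (Arr X)] {ε : ℕ → ∀ u, L.Fiber u}

theorem movedFrame_lmul (hL : L.IsBorelHom) {u v : X} (g : u ⟶ v) {x : Arr X} (hx : x.right = v)
    (k : ℕ) : movedFrame ε v x k = L.op g (movedFrame ε u (lmul (Groupoid.inv g) x) k) := by
  subst hx
  rw [movedFrame_right, lmul_of_eq _ _ rfl]
  refine Eq.trans ?_ (congrArg (L.op g) (movedFrame_right ε
    ⟨x.left, u, x.hom ≫ eqToHom rfl ≫ Groupoid.inv g⟩ k).symm)
  rw [← hL.map_comp]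
  simp

theorem isStdFrame_movedFrame (hL : L.IsBorelHom) (hε : L.IsFrame ε) (u : X) (x : Arr X) :
    IsStdFrame (L.dim u) (movedFrame ε u x) := by
  by_cases h : x.right = u
  · subst h
    have e : movedFrame ε x.right x = fun k => L.op x.hom (ε k x.left) :=
      funext (movedFrame_right ε x)
    rw [e, ← L.dim_eq hL x.hom]
    exact (hε.isStdFrame x.left).map _ (hL.surjective x.hom)
  · have e : movedFrame ε u x = fun k => ε k u := funext fun k => dif_neg h
    rw [e]
    exact hε.isStdFrame u

end

variable [TopologicalSpace X] [MeasurableSpace X] [BorelSpace X] [TopologicalSpace (Arr X)]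
  [MeasurableSpace (Arr X)] [BorelSpace (Arr X)] [LocallyCompactGroupoid X]
  {ε : ℕ → ∀ u, L.Fiber u}

omit [BorelSpace X] in
theorem stronglyMeasurable_movedFrame (hL : L.IsBorelHom) (hε : L.IsFrame ε) (u : X) (k : ℕ) :
    StronglyMeasurable fun x => movedFrame ε u x k := by
  classical
  refine stronglyMeasurable_of_inner (hε.isStdFrame u).dense fun n => ?_
  have e : (fun x => ⟪ε n u, movedFrame ε u x k⟫_ℂ) = fun x : Arr X => if x.right = u then
      ⟪ε n x.right, L.op x.hom (ε k x.left)⟫_ℂ else ⟪ε n u, ε k u⟫_ℂ := by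
    ext x
    split_ifs with h
    · subst h
      rw [movedFrame_right]
    · rw [movedFrame, dif_neg h]
  rw [e]
  exact Measurable.ite (measurableSet_range_eq u)
    (hL.borel _ _ (hε.isBorelSection k) (hε.isBorelSection n)) measurable_const

/-- The unitary that maps the standard basis to the vectors `L_x ε_k(s(x))`. -/
def coordEquiv (hL : L.IsBorelHom) (hε : L.IsFrame ε) (u : X) (x : Arr X) :
    StdHilbert (L.dim u) ≃ₗᵢ[ℂ] L.Fiber u :=
  (isStdFrame_movedFrame hL hε u x).basis.repr.symm

omit [TopologicalSpace X] [BorelSpace X] [TopologicalSpace (Arr X)] [BorelSpace (Arr X)]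
  [LocallyCompactGroupoid X] in
theorem coordEquiv_stdVec (hL : L.IsBorelHom) (hε : L.IsFrame ε) (u : X) (x : Arr X) (k : ℕ) :
    coordEquiv hL hε u x (stdVec (L.dim u) k) = movedFrame ε u x k :=
  (isStdFrame_movedFrame hL hε u x).repr_symm_stdVec k

omit [BorelSpace X] in
theorem stronglyMeasurable_coordEquiv_symm (hL : L.IsBorelHom) (hε : L.IsFrame ε) (u : X)
    (z : L.Fiber u) : StronglyMeasurable fun x => (coordEquiv hL hε u x).symm z := by
  refine stronglyMeasurable_of_inner (isStdFrame_stdVec (L.dim u)).dense fun k => ?_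
  have e : (fun x => ⟪stdVec (L.dim u) k, (coordEquiv hL hε u x).symm z⟫_ℂ) =
      fun x => ⟪movedFrame ε u x k, z⟫_ℂ := by
    ext x
    rw [← coordEquiv_stdVec hL hε, ← (coordEquiv hL hε u x).inner_map_map,
      (coordEquiv hL hε u x).apply_symm_apply]
  rw [e]
  exact ((stronglyMeasurable_movedFrame hL hε u k).inner stronglyMeasurable_const).measurable

omit [BorelSpace X] in
theorem stronglyMeasurable_coordEquiv (hL : L.IsBorelHom) (hε : L.IsFrame ε) (u : X)
    (z : StdHilbert (L.dim u)) : StronglyMeasurable fun x => coordEquiv hL hε u x z := by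
  refine stronglyMeasurable_of_inner (hε.isStdFrame u).dense fun n => ?_
  have e : (fun x => ⟪ε n u, coordEquiv hL hε u x z⟫_ℂ) =
      fun x => ⟪(coordEquiv hL hε u x).symm (ε n u), z⟫_ℂ := by
    ext x
    rw [← (coordEquiv hL hε u x).inner_map_map ((coordEquiv hL hε u x).symm _),
      (coordEquiv hL hε u x).apply_symm_apply]
  rw [e]
  exact ((stronglyMeasurable_coordEquiv_symm hL hε u _).inner stronglyMeasurable_const).measurable

omit [TopologicalSpace X] [BorelSpace X] [TopologicalSpace (Arr X)] [BorelSpace (Arr X)]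
  [LocallyCompactGroupoid X] in
/-- The unitaries `B_x` of `coordEquiv` satisfy `B_x = L_g B_{g⁻¹ x}`. -/
theorem coordEquiv_cast (hL : L.IsBorelHom) (hε : L.IsFrame ε) {u v : X} (g : u ⟶ v)
    {x : Arr X} (hx : x.right = v) (z : StdHilbert (L.dim u)) :
    coordEquiv hL hε v x (StdHilbert.cast (L.dim_eq hL g) z) =
      L.op g (coordEquiv hL hε u (lmul (Groupoid.inv g) x) z) := by
  refine (isStdFrame_stdVec (L.dim u)).hom_ext
    (S := (coordEquiv hL hε v x).toLinearIsometry.comp (StdHilbert.cast (L.dim_eq hL g)))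
    (T := (L.op g).comp (coordEquiv hL hε u (lmul (Groupoid.inv g) x)).toLinearIsometry)
    (fun k => ?_) z
  change coordEquiv hL hε v x (StdHilbert.cast (L.dim_eq hL g) (stdVec (L.dim u) k)) =
      L.op g (coordEquiv hL hε u (lmul (Groupoid.inv g) x) (stdVec (L.dim u) k))
  rw [cast_stdVec, coordEquiv_stdVec, coordEquiv_stdVec, movedFrame_lmul hL g hx]

variable (haar : HaarSystem X)

/-- The operator `F ↦ (x ↦ L_g F(g⁻¹ x))`, which is that of `L ⊗ ρ^G` when the Hilbert space tensor
product is seen as a space of vector-valued functions. -/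
def translateLp {u v : X} (g : u ⟶ v) :
    Lp (L.Fiber u) 2 (haar.meas u) →ₗᵢ[ℂ] Lp (L.Fiber v) 2 (haar.meas v) :=
  (fieldLp (haar.meas v) (fun _ => L.op g) fun _ => stronglyMeasurable_const).comp
    (Lp.compMeasurePreservingₗᵢ ℂ (lmul (Groupoid.inv g))
      (measurePreserving_lmul haar (Groupoid.inv g)))

omit [MeasurableSpace X] [BorelSpace X] in
theorem translateLp_coe {u v : X} (g : u ⟶ v) {F : Lp (L.Fiber u) 2 (haar.meas u)}
    {φ : Arr X → L.Fiber u} (hF : F =ᵐ[haar.meas u] φ) :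
    translateLp haar g F =ᵐ[haar.meas v] fun x => L.op g (φ (lmul (Groupoid.inv g) x)) := by
  have hp := measurePreserving_lmul haar (Groupoid.inv g)
  refine (fieldLp_coe (haar.meas v) (b := fun _ => L.op g) (fun _ => stronglyMeasurable_const)
    _).trans ?_
  filter_upwards [Lp.coeFn_compMeasurePreserving F hp, hp.quasiMeasurePreserving.ae hF]
    with x h1 h2
  exact congrArg (L.op g) (h1.trans h2)

omit [BorelSpace X] in
theorem tensorLpEquiv_op {u v : X} (g : u ⟶ v) (ζ : (L.tensor (regularRep haar)).Fiber u) :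
    tensorLpEquiv (L.Fiber v) (haar.meas v) ((L.tensor (regularRep haar)).op g ζ) =
      translateLp haar g (tensorLpEquiv (L.Fiber u) (haar.meas u) ζ) := by
  refine HilbertRep.tensor_ext (f := (tensorLpEquiv (L.Fiber v)
      (haar.meas v)).toLinearIsometry.comp ((L.tensor (regularRep haar)).op g))
    (g := (translateLp haar g).comp (tensorLpEquiv (L.Fiber u) (haar.meas u)).toLinearIsometry)
    (fun z (ξ : Lp ℂ 2 (haar.meas u)) => ?_) ζ
  refine (congrArg (tensorLpEquiv (L.Fiber v) (haar.meas v))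
    (HilbertRep.tensor_op_tmul g z _)).trans (Lp.ext ?_)
  refine (tensorLpEquiv_tmulC (L.op g z) (regularOp haar g ξ)).trans (Filter.EventuallyEq.symm
    ((translateLp_coe haar g (tensorLpEquiv_tmulC z ξ)).trans ?_))
  filter_upwards [regularOp_coe haar g ξ] with x hx
  rw [map_smul, hx]

variable (hL : L.IsBorelHom) (hε : L.IsFrame ε)

/-- The unitary from the fibre of `(dim L) ⊗ ρ^G` to the fibre of `L ⊗ ρ^G`. On vector-valued
functions it is `F ↦ (x ↦ B_x F(x))`, where `B_x` maps the standard basis to the vectors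
`L_x ε_k(s(x))`. -/
def dimTensorEquiv (u : X) : ((L.dimRep hL).tensor (regularRep haar)).Fiber u ≃ₗᵢ[ℂ]
    (L.tensor (regularRep haar)).Fiber u :=
  ((tensorLpEquiv (StdHilbert (L.dim u)) (haar.meas u)).trans
    (fieldLpEquiv (haar.meas u) (coordEquiv hL hε u) (stronglyMeasurable_coordEquiv hL hε u)
      (stronglyMeasurable_coordEquiv_symm hL hε u))).trans
    (tensorLpEquiv (L.Fiber u) (haar.meas u)).symm

omit [BorelSpace X] in
theorem tensorLpEquiv_dimTensorEquiv (u : X) (z : StdHilbert (L.dim u))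
    (ξ : Lp ℂ 2 (haar.meas u)) :
    tensorLpEquiv (L.Fiber u) (haar.meas u) (dimTensorEquiv haar hL hε u
      ((L.dimRep hL).tmul (regularRep haar) z ξ)) =ᵐ[haar.meas u]
      fun x => ξ x • coordEquiv hL hε u x z := by
  have h : tensorLpEquiv (L.Fiber u) (haar.meas u) (dimTensorEquiv haar hL hε u
      ((L.dimRep hL).tmul (regularRep haar) z ξ)) =
      fieldLp (haar.meas u) (fun x => (coordEquiv hL hε u x).toLinearIsometry)
        (stronglyMeasurable_coordEquiv hL hε u)
        (tensorLpEquiv (StdHilbert (L.dim u)) (haar.meas u) (tmulC z ξ)) :=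
    (tensorLpEquiv (L.Fiber u) (haar.meas u)).apply_symm_apply _
  rw [h]
  refine (fieldLp_coe (haar.meas u) _ _).trans ?_
  filter_upwards [tensorLpEquiv_tmulC z ξ] with x hx
  rw [hx]
  exact map_smul (coordEquiv hL hε u x) _ _

omit [BorelSpace X] in
theorem dimTensorEquiv_op {u v : X} (g : u ⟶ v)
    (ζ : ((L.dimRep hL).tensor (regularRep haar)).Fiber u) :
    dimTensorEquiv haar hL hε v (((L.dimRep hL).tensor (regularRep haar)).op g ζ) =
      (L.tensor (regularRep haar)).op g (dimTensorEquiv haar hL hε u ζ) := by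
  refine HilbertRep.tensor_ext (f := (dimTensorEquiv haar hL hε v).toLinearIsometry.comp
      (((L.dimRep hL).tensor (regularRep haar)).op g))
    (g := ((L.tensor (regularRep haar)).op g).comp (dimTensorEquiv haar hL hε u).toLinearIsometry)
    (fun z (ξ : Lp ℂ 2 (haar.meas u)) => ?_) ζ
  refine (congrArg (dimTensorEquiv haar hL hε v) (HilbertRep.tensor_op_tmul g z _)).trans ?_
  refine (tensorLpEquiv (L.Fiber v) (haar.meas v)).injective
    (Eq.trans (Lp.ext ?_) (tensorLpEquiv_op haar g _).symm)
  refine (tensorLpEquiv_dimTensorEquiv haar hL hε v (StdHilbert.cast (L.dim_eq hL g) z)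
    (regularOp haar g ξ)).trans ?_
  refine Filter.EventuallyEq.symm ?_
  refine (translateLp_coe haar g (tensorLpEquiv_dimTensorEquiv haar hL hε u z ξ)).trans ?_
  filter_upwards [regularOp_coe haar g ξ, haar.range_eq_ae v] with x hx hv
  rw [map_smul, hx]
  exact congrArg _ (coordEquiv_cast hL hε g hv z).symm

/-- The coefficients are the integrals of the Borel functions
`x ↦ conj (f x) f'(x) ⟪s(r(x)), L_x ε_k(s(x))⟫`. -/
theorem measurable_inner_dimTensorEquiv {s : ∀ u, L.Fiber u} (hs : L.IsBorelSection s)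
    {f f' : Arr X → ℂ} (hf : Measurable f) (hf' : Measurable f')
    (hf2 : ∀ u, MemLp f 2 (haar.meas u)) (hf2' : ∀ u, MemLp f' 2 (haar.meas u)) (k : ℕ) :
    Measurable fun u => ⟪L.tmul (regularRep haar) (s u) ((hf2 u).toLp f),
      dimTensorEquiv haar hL hε u
        ((L.dimRep hL).tmul (regularRep haar) (stdVec (L.dim u) k) ((hf2' u).toLp f'))⟫_ℂ := by
  have := haar.hasFiniteCover.hasFiniteDensity.isSFiniteKernel
  have h : Measurable fun x : Arr X =>
      (starRingEnd ℂ) (f x) * (f' x * ⟪s x.right, L.op x.hom (ε k x.left)⟫_ℂ) :=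
    (Complex.continuous_conj.measurable.comp hf).mul
      (hf'.mul (hL.borel _ _ (hε.isBorelSection k) hs))
  refine Eq.mp (congrArg Measurable (funext fun u => ?_))
    (StronglyMeasurable.integral_kernel (κ := haar.kernel) h.stronglyMeasurable).measurable
  refine Eq.trans ?_ ((tensorLpEquiv (L.Fiber u) (haar.meas u)).inner_map_map _ _)
  refine Eq.trans (integral_congr_ae ?_) (L2.inner_def _ _).symm
  filter_upwards [tensorLpEquiv_tmulC (s u) ((hf2 u).toLp f), (hf2 u).coeFn_toLp,
    (hf2' u).coeFn_toLp, haar.range_eq_ae u,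
    tensorLpEquiv_dimTensorEquiv haar hL hε u (stdVec (L.dim u) k) ((hf2' u).toLp f')]
    with x h1 h2 h3 hx h4
  refine Eq.trans ?_ (congrArg₂ (fun a b => ⟪a, b⟫_ℂ) h1 h4).symm
  rw [coordEquiv_stdVec, inner_smul_left, inner_smul_right, h2, h3]
  subst hx
  rw [movedFrame_right]

theorem isBorelSection_dimTensorEquiv
    (ζ : ∀ u, ((L.dimRep hL).tensor (regularRep haar)).Fiber u) :
    ((L.dimRep hL).tensor (regularRep haar)).IsBorelSection ζ ↔
      (L.tensor (regularRep haar)).IsBorelSection fun u => dimTensorEquiv haar hL hε u (ζ u) := by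
  obtain ⟨s, hs⟩ := hL.bundle.exists_isFundamental
  obtain ⟨f, hf2, hf, hfund⟩ := exists_isFundamental_regularRep haar
  exact (HilbertRep.isFundamental_tensor (HilbertRep.isFundamental_dimRep hL)
    hfund).isBorelSection_iff_map_of_fundamental (HilbertRep.isFundamental_tensor hs hfund)
    (dimTensorEquiv haar hL hε) (fun m n => measurable_inner_dimTensorEquiv haar hL hε
      (hs.isBorelSection m.unpair.1) (hf _) (hf _) (hf2 _) (hf2 _) n.unpair.1) ζ

/-- The tensor product of a representation with the regular representation only depends on the
dimensions of the fibres. -/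
theorem equivalent_tensor_dimRep {μ : Measure X} (hL : IsUnitaryRep haar μ L) :
    Equivalent haar μ (L.tensor (regularRep haar))
      ((L.dimRep hL.2).tensor (regularRep haar)) := by
  obtain ⟨ε, hε⟩ := hL.2.bundle.exists_isFrame
  have hr := isBorelHom_regularRep haar
  refine Equivalent.symm ⟨⟨hL.1, ?_⟩, ⟨hL.1, ?_⟩, dimTensorEquiv haar hL.2 hε,
    isBorelSection_dimTensorEquiv haar hL.2 hε, dimTensorEquiv_op haar hL.2 hε⟩
  · exact (HilbertRep.isBorelHom_dimRep (measurable_left X) (measurable_right X) hL.2).tensor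
      (measurable_left X) (measurable_right X) hr
  · exact hL.2.tensor (measurable_left X) (measurable_right X) hr

end Absorption

end LCG

end

theorem corollaryE2p6 {X : Type u} [CategoryTheory.Groupoid.{v} X]
    [TopologicalSpace X] [MeasurableSpace X] [BorelSpace X]
    [TopologicalSpace (LCG.Arr X)] [MeasurableSpace (LCG.Arr X)] [BorelSpace (LCG.Arr X)]
    [LCG.LocallyCompactGroupoid X] (haar : LCG.HaarSystem X)
    (μ : Measure X) [IsFiniteMeasureOnCompacts μ]
    (L : LCG.HilbertRep.{u, v, w} X) (hL : LCG.IsUnitaryRep haar μ L) :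
    (∀ (H : LCG.ClosedSubgroupoid X) (_ : LCG.HaarSystem H.Obj)
        (m : LCG.QuotientMeasure H haar μ),
      LCG.Equivalent haar μ (LCG.ind (hL.2.restrict H) m) (L.tensor m.quasiRegularRep)) ∧
    LCG.Equivalent haar μ (L.tensor (LCG.regularRep haar))
      ((L.dimRep hL.2).tensor (LCG.regularRep haar)) :=
  ⟨fun _ haarH m => LCG.equivalent_ind_tensor m haarH hL, LCG.equivalent_tensor_dimRep haar hL⟩
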